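/- **Setting.** Types, qualities and posterior means lie in $[0,1]$. In each of $T\ge 2$ rounds the seller posts a price $p_t\in[0,U]$ and an advertising strategy $\rho_t$: a Markov kernel from qualities to posterior means that is Bayes-consistent with the known prior $\lambda$ (an arbitrary, discrete or continuous, probability measure on $[0,1]$), i.e. $\mathbb E[\omega\mid q]=q$ when $\omega\sim\lambda$, $q\sim\rho_t(\cdot\mid\omega)$. Both may depend on the past qualities, posterior means and purchases. Then $\omega_t\sim\lambda$, $q_t\sim\rho_t(\cdot\mid\omega_t)$ and, independently, a type $\theta_t\sim F$ are drawn, where $F$ is an unknown probability distribution on $[0,1]$ with no atom at $1$ (otherwise arbitrary), and the buyer purchases iff $v(\theta_t,q_t)\ge p_t$. Let $\mathrm{Rev}(p,\rho)=p\,\Pr[v(\theta,q)\ge p]$, let $\mathrm{OPT}(\lambda)$ be the supremum of $\mathrm{Rev}(p,\rho)$ over $p\in[0,U]$ and all Bayes-consistent $\rho$, and $\mathrm{Regret}(T)=T\cdot\mathrm{OPT}(\lambda)-\sum_{t=1}^T\mathbb E[\mathrm{Rev}(p_t,\rho_t)]$. The critical type is $\kappa(p,q)=\inf\{\theta\in[0,1]:v(\theta,q)\ge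 p\}$, with $\inf\emptyset=1$. **Assumptions on $v$.** Either $v(\theta,\omega)=\theta+\omega$; or $v$ is affine and non-decreasing in $\omega$, strictly increasing and 1-Lipschitz in $\theta$, and $\kappa(p,q_1)-\kappa(p,q_2)\le q_2-q_1$ for all $p\in[0,U]$ and $q_1\le q_2$. In both cases $v(\theta,\mathbb E_\lambda[\omega])\in[0,U]$ for every $\theta\in[0,1]$ (so that the exploration prices below exist). **Algorithm 1** (finite quality space $\{\omega_i\}$ with prior $(\lambda_i)$, parameter $\varepsilon$). Let $\mathcal P=\{\varepsilon,2\varepsilon,\dots,U\}$, $\mathcal S=\{0,\varepsilon,2\varepsilon,\dots,1\}\cup\{\kappa(p,\omega_i):p\in\mathcal P,\ i\}$ and $\mathcal Q_p=\{q:\kappa(p,q)\in\mathcal S\}$. In the first $|\mathcal S|$ rounds, for each $x\in\mathcal S$ in some order, post a price $p$ with $\kappa(p,\mathbb E_\lambda[\omega])=x$ and give no information. In every later round $t$, let $N_t(x)$ be the number of past rounds with critical type exactly $x$, $\bar D_t(x)$ the fraction of these with a purchase, and $$D^{\mathrm{UCB}}_t(x)=\min_{x'\in\mathcal S,\,x'\le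 x}\Big(\bar D_t(x')+\sqrt{\tfrac{16\log T}{N_t(x')}}+\tfrac{\sqrt{(1+N_t(x'))\ln(1+N_t(x'))}}{N_t(x')}\Big)\wedge 1,$$ and play a maximizer of $p\,\mathbb E_{q\sim\rho}[D^{\mathrm{UCB}}_t(\kappa(p,q))]$ over $p\in\mathcal P$ and Bayes-consistent $\rho$ supported on $\mathcal Q_p$. **Algorithm 2** (parameters $\varepsilon,\hat\varepsilon$). Pool the qualities into the cells $\{0\}$ and $((i-1)\hat\varepsilon,i\hat\varepsilon]$, $1\le i\le\lceil 1/\hat\varepsilon\rceil$; give each cell its $\lambda$-probability and the quality $\mathbb E_\lambda[\omega\mid\text{cell}]$ ($0$ for the cell $\{0\}$). Run Algorithm 1 with parameter $\varepsilon$ on this pooled instance, applying its advertising strategy to the cell of the realized quality. **Theorem.** For every $U$ there is a constant $C$ depending only on $U$ such that, for all $v,F,\lambda$ as above: 1. For every $\hat\varepsilon>0$, $\mathrm{OPT}(\lambda)\le\mathrm{OPT}(\text{pooled instance})+\hat\varepsilon$. 2. For every $T\ge2$, Algorithm 2 with $\varepsilon=\hat\varepsilon=(\log T/T)^{1/4}$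 can be implemented as a feasible policy, and every implementation of it (any exploration order, any choice among maximizers that makes the policy a measurable function of the history) satisfies $\mathrm{Regret}(T)\le C\,T^{3/4}(\log T)^{1/4}$. In particular the bound does not depend on the size of the quality space. -/

import Mathlib

open MeasureTheory ProbabilityTheory Set
open scoped unitInterval

noncomputable section

namespace PricingPersuasion

/-! ## Valuations and critical types

Buyer types, product qualities and posterior means all live in `I = [0,1]`. -/

/-- `v θ ω` is linear (affine) and non-decreasing in the quality `ω`, and increasing and
1-Lipschitz in the type `θ`. -/
structure ValuationAssumption (v : I → I → ℝ) : Prop where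
  linear_quality : ∃ a b : I → ℝ, ∀ θ ω : I, v θ ω = a θ + b θ * (ω : ℝ)
  mono_quality : ∀ θ : I, Monotone (v θ)
  strictMono_type : ∀ ω : I, StrictMono fun θ : I => v θ ω
  lipschitz_type : ∀ ω : I, LipschitzWith 1 fun θ : I => v θ ω

/-- The critical type: the least type in `[0,1]` that buys at price `p` when the posterior mean is
`q`.  The infimum is taken in the complete lattice `[0,1]`, so it is `1` if no type buys. -/
def criticalType (v : I → I → ℝ) (p : ℝ) (q : I) : I :=
  sInf {θ : I | p ≤ v θ q}

/-- For every price in `[0,U]`, the critical type decreases at rate at most `1` in the posterior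
mean. -/
def CriticalTypeLipschitz (v : I → I → ℝ) (U : ℝ) : Prop :=
  ∀ p ∈ Icc (0 : ℝ) U, ∀ q₁ q₂ : I, q₁ ≤ q₂ →
    (criticalType v p q₁ : ℝ) - criticalType v p q₂ ≤ (q₂ : ℝ) - q₁

/-! ## Advertising, revenue

A quality space is a measurable space `X` with a prior and a quality map `val : X → [0,1]`:
either `X = [0,1]` itself, with `val = id` and an arbitrary prior, or a finite set.  An advertising
strategy is a Markov kernel from `X` to posterior means. -/

section Instances

variable {X : Type} [MeasurableSpace X]

/-- Bayes consistency: when the quality is drawn from the prior and the posterior mean `q` from the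
advertising strategy, the conditional expectation of the quality given `q` is `q`. -/
def BayesConsistent (prior : Measure X) (val : X → I) (ρ : Kernel X I) : Prop :=
  ∀ B : Set I, MeasurableSet B →
    ∫ x, (val x : ℝ) * (ρ x).real B ∂prior = ∫ q in B, (q : ℝ) ∂(ρ ∘ₘ prior)

/-- Expected one-round revenue `E[p · 1{v(θ,q) ≥ p}]`, with `θ ∼ F` independent of `q ∼ ρ`. -/
def rev (prior : Measure X) (F : Measure I) (v : I → I → ℝ) (p : ℝ) (ρ : Kernel X I) : ℝ :=
  p * ∫ q, F.real {θ : I | p ≤ v θ q} ∂(ρ ∘ₘ prior)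

/-- The optimal one-round revenue over prices in `[0,U]` and feasible advertising strategies. -/
def optRevenue (prior : Measure X) (val : X → I) (F : Measure I) (v : I → I → ℝ) (U : ℝ) : ℝ :=
  sSup {r : ℝ | ∃ p ∈ Icc (0 : ℝ) U, ∃ ρ : Kernel X I,
    IsMarkovKernel ρ ∧ BayesConsistent prior val ρ ∧ r = rev prior F v p ρ}

/-- The prior mean of the quality, as a point of `[0,1]` (for a probability measure the projection
to `[0,1]` does nothing, see `coe_priorMean`). -/
def priorMean (prior : Measure X) (val : X → I) : I :=
  projIcc 0 1 zero_le_one (∫ x, (val x : ℝ) ∂prior)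

theorem coe_priorMean (prior : Measure X) [IsProbabilityMeasure prior] (val : X → I) :
    (priorMean prior val : ℝ) = ∫ x, (val x : ℝ) ∂prior := by
  have h0 : 0 ≤ ∫ x, (val x : ℝ) ∂prior := integral_nonneg fun x => (val x).2.1
  have h1 : ∫ x, (val x : ℝ) ∂prior ≤ 1 := by
    have h := integral_mono_of_nonneg (μ := prior) (f := fun x => (val x : ℝ)) (g := fun _ => 1)
      (Filter.Eventually.of_forall fun x => (val x).2.1) (integrable_const 1)
      (Filter.Eventually.of_forall fun x => (val x).2.2)
    simpa using h
  simp [priorMean, projIcc, h0, h1]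

end Instances

/-! ## The repeated game -/

/-- What the seller observes in a round: realized quality, realized posterior mean, purchase. -/
abbrev Obs : Type := I × I × Bool

/-- A seller's policy for the prior `μ` on `[0,1]`: in round `t` (rounds are numbered from `0`) the
price in `[0,U]` and the Bayes-consistent advertising strategy are measurable functions of the
observations of the earlier rounds. -/
structure Policy (μ : Measure I) (U : ℝ) where
  price : (t : ℕ) → (Fin t → Obs) → ℝ
  adv : (t : ℕ) → Kernel ((Fin t → Obs) × I) I
  measurable_price : ∀ t, Measurable (price t)
  price_mem : ∀ t h, price t h ∈ Icc (0 : ℝ) U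
  markov : ∀ t, IsMarkovKernel (adv t)
  feasible : ∀ t h, BayesConsistent μ id ((adv t).sectR h)

/-- The law of the observation in a round with price `p` and advertising strategy `ρ`: the quality
`ω ∼ μ`, the posterior mean `q ∼ ρ(ω)`, and, for an independent type `θ ∼ F`, the purchase
`1{v(θ,q) ≥ p}`. -/
def roundLaw (μ F : Measure I) (v : I → I → ℝ) (p : ℝ) (ρ : Kernel I I) : Measure Obs :=
  ((μ ⊗ₘ ρ).prod F).map fun x : (I × I) × I => (x.1.1, x.1.2, decide (p ≤ v x.2 x.1.2))

/-- The law of the first `t` observations under the policy `π`. -/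
def histLaw {μ : Measure I} {U : ℝ} (F : Measure I) (v : I → I → ℝ) (π : Policy μ U) :
    (t : ℕ) → Measure (Fin t → Obs)
  | 0 => Measure.dirac Fin.elim0
  | t + 1 => (histLaw F v π t).bind fun h =>
      (roundLaw μ F v (π.price t h) ((π.adv t).sectR h)).map
        fun o : Obs => (Fin.snoc h o : Fin (t + 1) → Obs)

/-- Expected regret over `T` rounds. -/
def regret {μ : Measure I} {U : ℝ} (F : Measure I) (v : I → I → ℝ) (π : Policy μ U) (T : ℕ) : ℝ :=
  T * optRevenue μ id F v U -
    ∑ t ∈ Finset.range T,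
      ∫ h, rev μ F v (π.price t h) ((π.adv t).sectR h) ∂(histLaw F v π t)

/-! ## Algorithm 1: optimism over a discretized type space -/

/-- `{ε, 2ε, …, U}`. -/
def priceGrid (U ε : ℝ) : Finset ℝ :=
  (Finset.Icc 1 ⌈U / ε⌉₊).image fun k : ℕ => min (k * ε) U

/-- `{0, ε, 2ε, …, 1}` together with the critical types of all grid prices at all qualities. -/
def typeGrid {ι : Type} [Fintype ι] (v : I → I → ℝ) (U ε : ℝ) (quality : ι → I) : Finset I :=
  (Finset.range (⌈1 / ε⌉₊ + 1)).image (fun k : ℕ => projIcc (0 : ℝ) 1 zero_le_one (k * ε)) ∪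
    (priceGrid U ε ×ˢ (Finset.univ : Finset ι)).image fun x => criticalType v x.1 (quality x.2)

/-- Number of the first `t` rounds whose critical type was exactly `x`; the data `d` lists the
critical types and the purchase decisions. -/
def visits {t : ℕ} (d : Fin t → I × Bool) (x : I) : ℕ :=
  (Finset.univ.filter fun s => (d s).1 = x).card

/-- Empirical demand at `x`. -/
def empDemand {t : ℕ} (d : Fin t → I × Bool) (x : I) : ℝ :=
  ((Finset.univ.filter fun s => (d s).1 = x ∧ (d s).2 = true).card : ℝ) / visits d x

/-- Upper confidence bound on the demand at `x`: the minimum of `1` and, over the grid types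
`x' ≤ x`, of the empirical demand at `x'` plus its confidence radius (horizon `T`). -/
def ucbDemand (S : Finset I) (T : ℕ) {t : ℕ} (d : Fin t → I × Bool) (x : I) : ℝ :=
  (S.filter fun x' => x' ≤ x).fold min 1 fun x' =>
    empDemand d x' + √(16 * Real.log T / visits d x') +
      √((1 + visits d x') * Real.log (1 + visits d x')) / visits d x'

section AlgorithmOne

variable {ι : Type} [Fintype ι] [MeasurableSpace ι]

/-- Feasible points of the optimistic program: a grid price `p` and a Bayes-consistent advertising
strategy supported on posterior means whose critical type at price `p` is a grid type. -/
def ProgramFeasible (prior : Measure ι) (quality : ι → I) (v : I → I → ℝ) (U ε : ℝ)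
    (p : ℝ) (ρ : Kernel ι I) : Prop :=
  p ∈ priceGrid U ε ∧ IsMarkovKernel ρ ∧ BayesConsistent prior quality ρ ∧
    ∀ i, ρ i {q : I | criticalType v p q ∉ typeGrid v U ε quality} = 0

/-- Revenue of `(p, ρ)` when the demand function is replaced by its upper confidence bound. -/
def ucbRevenue (prior : Measure ι) (quality : ι → I) (v : I → I → ℝ) (U ε : ℝ) (T : ℕ) {t : ℕ}
    (d : Fin t → I × Bool) (p : ℝ) (ρ : Kernel ι I) : ℝ :=
  p * ∫ q, ucbDemand (typeGrid v U ε quality) T d (criticalType v p q) ∂(ρ ∘ₘ prior)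

/-- `(p, ρ)` is an admissible decision of Algorithm 1 in round `t` given the past data `d`.  With
`S` the type grid, round `t < |S|` explores the `t`-th grid type (in the enumeration `e`) without
giving information: the posterior mean is the prior mean.  Later rounds play a solution of the
optimistic program. -/
def AlgorithmOneDecision (prior : Measure ι) (quality : ι → I) (v : I → I → ℝ) (U ε : ℝ) (T : ℕ)
    (e : Fin (typeGrid v U ε quality).card ≃ typeGrid v U ε quality) {t : ℕ}
    (d : Fin t → I × Bool) (p : ℝ) (ρ : Kernel ι I) : Prop :=
  (∀ ht : t < (typeGrid v U ε quality).card,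
    criticalType v p (priorMean prior quality) = e ⟨t, ht⟩ ∧
      ρ = Kernel.const ι (Measure.dirac (priorMean prior quality))) ∧
  ((typeGrid v U ε quality).card ≤ t →
    ProgramFeasible prior quality v U ε p ρ ∧
      ∀ p' ρ', ProgramFeasible prior quality v U ε p' ρ' →
        ucbRevenue prior quality v U ε T d p' ρ' ≤ ucbRevenue prior quality v U ε T d p ρ)

end AlgorithmOne

/-! ## Algorithm 2: pooling -/

/-- The pooling cell of a quality: cell `0` is `{0}` and cell `i ≥ 1` is `((i-1)δ, iδ]`, for
`i ≤ ⌈1/δ⌉` (the minimum in the code is attained by its first argument for `δ > 0`). -/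
def cell (δ : ℝ) (ω : I) : Fin (⌈1 / δ⌉₊ + 1) :=
  ⟨min ⌈(ω : ℝ) / δ⌉₊ ⌈1 / δ⌉₊, by omega⟩

/-- The prior probabilities of the cells. -/
def pooledPrior (μ : Measure I) (δ : ℝ) : Measure (Fin (⌈1 / δ⌉₊ + 1)) :=
  μ.map (cell δ)

/-- The pooled quality of a cell, `E[ω | ω ∈ cell i]`.  It is `0` for the cell `{0}` and, by
convention, for cells of prior probability zero; the latter does not enlarge the set of pooled
qualities, which contains `0` anyway. -/
def pooledQuality (μ : Measure I) (δ : ℝ) (i : Fin (⌈1 / δ⌉₊ + 1)) : I :=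
  projIcc 0 1 zero_le_one (⨍ ω in cell δ ⁻¹' {i}, (ω : ℝ) ∂μ)

/-- The data used by Algorithm 1: critical types and purchases of the past rounds. -/
def policyData {μ : Measure I} {U : ℝ} (v : I → I → ℝ) (π : Policy μ U) {t : ℕ}
    (h : Fin t → Obs) : Fin t → I × Bool :=
  fun s => (criticalType v (π.price s fun r => h (Fin.castLE s.2.le r)) (h s).2.1, (h s).2.2)

/-- `π` is a run of Algorithm 2 with discretization `ε` and pooling precision `δ`: it plays
Algorithm 1 on the pooled instance, the advertising strategy being that of the pooled instance
applied to the cell of the realized quality.  The order of exploration and the choice among several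
solutions of the optimistic program are arbitrary. -/
def IsAlgorithmTwo {μ : Measure I} {U : ℝ} (v : I → I → ℝ) (ε δ : ℝ) (T : ℕ) (π : Policy μ U) :
    Prop :=
  ∃ e : Fin (typeGrid v U ε (pooledQuality μ δ)).card ≃ typeGrid v U ε (pooledQuality μ δ),
    ∀ (t : ℕ) (h : Fin t → Obs), ∃ ρ : Kernel (Fin (⌈1 / δ⌉₊ + 1)) I,
      AlgorithmOneDecision (pooledPrior μ δ) (pooledQuality μ δ) v U ε T e
        (policyData v π h) (π.price t h) ρ ∧
      ∀ ω : I, (π.adv t).sectR h ω = ρ (cell δ ω)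

end PricingPersuasion

end

noncomputable section

namespace PricingPersuasion

/-! ## Critical types of regular valuations -/

section CriticalType

variable {v : I → I → ℝ} {p : ℝ} {q x : I}

/-! Without an atom of `F` at `1`, a buyer facing price `p` and posterior mean `q` buys with
probability `D (κ(p,q))`, where `D x = F[x,1]`. Learning the unknown `F` is therefore learning one
antitone function of the critical type. Three facts carry the bound.

Pooling costs `δ` (`optRevenue_le_pooled`). If posterior means are recomputed from pooled qualities,
they fall by at most `δ`. Values are 1-Lipschitz in the posterior mean, so a price cut of `δ` keeps
every sale. In the affine case this Lipschitz property is derived from the one for critical types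
(`ValuationAssumption.regularValuation`).

Discretization costs `2ε` (`exists_programFeasible_rev_le`). A price cut of at least `ε` and less
than `2ε` lowers critical types below `1` by at least `ε`, or to `0`. This leaves room to spread
each posterior mean to adjacent points of a finite grid. Spreading is possible without violating
Bayes consistency because the grid contains all qualities (`exists_gap_split`,
`exists_grid_weights`). The same argument makes the optimistic program a finite-dimensional compact
one, so it has a maximizer.

Optimism then gives the regret. Given that the critical type is `x`, a purchase is Bernoulli with
mean `D x`, however the policy adapts. An exponential supermartingale yields confidence bounds
(`measureReal_deviationSet_le`). When they hold, the optimistic value dominates the optimum up to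
discretization, and the loss in a round is at most the confidence width at the type played. This
width is bounded by an increment of the potential `∑ √(visits)`, so the widths telescope to order
`√(log T · |S| T)` (`rev_add_potential_ge`, `regret_le`).

After pooling there are about `1/ε` qualities and hence `O(1/ε²)` grid types. The resulting sum of
terms `Tε`, `1/ε²` and `√(T log T)/ε` is of order `Tε` for `ε = (log T / T)^(1/4)`. -/

theorem criticalType_le (h : p ≤ v x q) : criticalType v p q ≤ x :=
  sInf_le h

theorem le_valuation_criticalType (hc : Continuous fun θ => v θ q)
    (h : criticalType v p q < 1) : p ≤ v (criticalType v p q) q := by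
  have hne : {θ : I | p ≤ v θ q}.Nonempty := by
    by_contra hne
    rw [not_nonempty_iff_eq_empty] at hne
    rw [criticalType, hne, sInf_empty] at h
    exact absurd h (lt_irrefl _)
  exact (isClosed_le continuous_const hc).csInf_mem hne (OrderBot.bddBelow _)

/-- By continuity the infimum is attained unless no type buys. The restriction `x < 1` is needed
because an empty infimum is also `1`. -/
theorem criticalType_le_iff (hc : Continuous fun θ => v θ q) (hm : Monotone fun θ => v θ q)
    (hx : x < 1) : criticalType v p q ≤ x ↔ p ≤ v x q :=
  ⟨fun h => (le_valuation_criticalType hc (h.trans_lt hx)).trans (hm h), criticalType_le⟩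

theorem criticalType_valuation (hs : StrictMono fun θ => v θ q) (x : I) :
    criticalType v (v x q) q = x :=
  le_antisymm (criticalType_le le_rfl) (le_sInf fun _ hθ => hs.le_iff_le.1 hθ)

theorem criticalType_antitone (hm : ∀ θ, Monotone (v θ)) : Antitone (criticalType v p) :=
  fun _ _ h => sInf_le_sInf fun θ hθ => le_trans hθ (hm θ h)

end CriticalType

/-- Valuations that are increasing in the type, non-decreasing in the quality, and nonexpansive in
either argument. -/
structure RegularValuation (v : I → I → ℝ) : Prop where
  mono_quality : ∀ θ : I, Monotone (v θ)
  strictMono_type : ∀ ω : I, StrictMono fun θ : I => v θ ω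
  lipschitz_type : ∀ ω θ₁ θ₂ : I, θ₁ ≤ θ₂ → v θ₂ ω - v θ₁ ω ≤ θ₂ - θ₁
  lipschitz_quality : ∀ θ q₁ q₂ : I, q₁ ≤ q₂ → v θ q₂ - v θ q₁ ≤ q₂ - q₁

theorem regularValuation_add {v : I → I → ℝ} (h : ∀ θ ω : I, v θ ω = (θ : ℝ) + (ω : ℝ)) :
    RegularValuation v where
  mono_quality θ ω₁ ω₂ hω := by simpa [h] using hω
  strictMono_type ω θ₁ θ₂ hθ := by simpa [h] using hθ
  lipschitz_type ω θ₁ θ₂ _ := by simp [h]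
  lipschitz_quality θ q₁ q₂ _ := by simp [h]

theorem ValuationAssumption.lipschitz {v : I → I → ℝ} (hv : ValuationAssumption v)
    (ω θ₁ θ₂ : I) (h : θ₁ ≤ θ₂) : v θ₂ ω - v θ₁ ω ≤ θ₂ - θ₁ := by
  have h1 := (hv.lipschitz_type ω).dist_le_mul θ₂ θ₁
  rw [NNReal.coe_one, one_mul, Real.dist_eq, Subtype.dist_eq, Real.dist_eq,
    abs_of_nonneg (sub_nonneg.2 (show (θ₁ : ℝ) ≤ θ₂ from h))] at h1
  exact (le_abs_self _).trans h1

/-- Only the Lipschitz bound in the quality is not immediate; it says that the slope `b θ` is at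
most `1`. If the quality drops by `s` at price `v θ q₂`, the critical type rises from `θ` to at most
`θ + s`, and the extra type adds at most `s` to the value, so `b θ * s ≤ s`. -/
theorem ValuationAssumption.regularValuation {v : I → I → ℝ} {U : ℝ} (hv : ValuationAssumption v)
    (hκ : CriticalTypeLipschitz v U) {m : I} (hm : ∀ θ, v θ m ∈ Icc 0 U) :
    RegularValuation v := by
  obtain ⟨a, b, hab⟩ := hv.linear_quality
  have hb0 : ∀ θ, 0 ≤ b θ := fun θ => by
    have := hv.mono_quality θ (zero_le_one : (0 : I) ≤ 1)
    simp only [hab] at this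
    simpa using this
  have key : ∀ θ : I, θ < 1 → b θ ≤ 1 := by
    intro θ hθ
    -- The critical-type hypothesis covers only prices in `[0,U]`. The prior mean supplies such a
    -- price with room to lower the quality; if it is `0`, a small positive quality does, because `v
    -- θ 0 < v 1 0 ≤ U`.
    obtain ⟨q₂, hq₂, hq₂U⟩ : ∃ q₂ : I, 0 < (q₂ : ℝ) ∧ v θ q₂ ∈ Icc 0 U := by
      rcases (m.2.1 : (0 : ℝ) ≤ m).lt_or_eq with h | h
      · exact ⟨m, h, hm θ⟩
      · have hm0 : m = 0 := Subtype.ext h.symm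
        subst hm0
        have hlt : v θ 0 < U := (hv.strictMono_type 0 hθ).trans_le (hm 1).2
        have hη : 0 < min 1 ((U - v θ 0) / (b θ + 1)) :=
          lt_min one_pos (div_pos (sub_pos.2 hlt) (by linarith [hb0 θ]))
        set η := min 1 ((U - v θ 0) / (b θ + 1)) with hηdef
        refine ⟨⟨η, hη.le, min_le_left _ _⟩, hη, ?_, ?_⟩
        · exact (hm θ).1.trans (hv.mono_quality θ (Subtype.coe_le_coe.1 hη.le))
        · have h1 : η * (b θ + 1) ≤ U - v θ 0 := by
            rw [← le_div_iff₀ (by linarith [hb0 θ])]; exact min_le_right _ _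
          have h2 : v θ 0 = a θ := by simp [hab]
          have h3 : v θ ⟨η, hη.le, min_le_left _ _⟩ = a θ + b θ * η := by simp [hab]
          rw [h3]; nlinarith
    have hθ' : (θ : ℝ) < 1 := hθ
    -- The step keeps `q₂ - s ≥ 0` and `θ + s < 1`; the latter ensures that the type `θ + s` really
    -- buys.
    set s := min (q₂ : ℝ) ((1 - θ) / 2) with hs
    have hs0 : 0 < s := lt_min hq₂ (by linarith)
    have hsq : s ≤ q₂ := min_le_left _ _
    have hsθ : s ≤ (1 - θ) / 2 := min_le_right _ _
    let q₁ : I := ⟨q₂ - s, by linarith, by linarith [q₂.2.2]⟩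
    let θ' : I := ⟨θ + s, by linarith [θ.2.1], by linarith⟩
    have h1 := hκ _ hq₂U q₁ q₂ (Subtype.coe_le_coe.1 (by simp [q₁, hs0.le]))
    rw [criticalType_valuation (hv.strictMono_type q₂)] at h1
    have h2 : criticalType v (v θ q₂) q₁ ≤ θ' := Subtype.coe_le_coe.1 (by
      simp only [q₁, θ'] at h1 ⊢; linarith)
    have h3 : v θ q₂ ≤ v θ' q₁ :=
      (criticalType_le_iff (hv.lipschitz_type q₁).continuous (hv.strictMono_type q₁).monotone
        (show (θ' : ℝ) < 1 by simp only [θ']; linarith)).1 h2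
    have h4 := hv.lipschitz q₁ θ θ' (Subtype.coe_le_coe.1 (by simp [θ', hs0.le]))
    have h5 : v θ q₁ = a θ + b θ * (q₂ - s) := hab _ _
    have h6 : v θ q₂ = a θ + b θ * q₂ := hab _ _
    have h7 : ((θ' : I) : ℝ) - θ = s := by simp [θ']
    have h8 : b θ * s ≤ 1 * s := by nlinarith
    exact le_of_mul_le_mul_right h8 hs0
  have hb1 : ∀ θ, b θ ≤ 1 := by
    intro θ
    rcases (unitInterval.le_one' : θ ≤ 1).lt_or_eq with h | h
    · exact key θ h
    · subst h
      -- At `θ = 1` there is no room above, so the bound is passed to the limit from smaller types.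
      refine le_of_forall_pos_le_add fun η hη => ?_
      let θ' : I := ⟨1 - min η 1, by simp, by simp [hη.le]⟩
      have hθ' : θ' < 1 := show (θ' : ℝ) < 1 by simp [θ', hη]
      have h1 := hv.lipschitz 1 θ' 1 hθ'.le
      have h2 := (hv.strictMono_type 0 hθ').le
      have h3 := key θ' hθ'
      have h4 : (1 : ℝ) - (θ' : ℝ) ≤ η := by simp [θ']
      simp only [hab, Icc.coe_one, Icc.coe_zero] at h1 h2
      linarith
  refine ⟨hv.mono_quality, hv.strictMono_type, hv.lipschitz, fun θ q₁ q₂ h => ?_⟩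
  have h' : (q₁ : ℝ) ≤ q₂ := h
  rw [hab, hab]
  nlinarith [hb1 θ]

namespace RegularValuation

variable {v : I → I → ℝ} (hv : RegularValuation v) {p : ℝ} {q x : I}

include hv

theorem continuous_uncurry : Continuous fun x : I × I => v x.1 x.2 := by
  have h1 : ∀ ω θ₁ θ₂ : I, |v θ₁ ω - v θ₂ ω| ≤ |(θ₁ : ℝ) - θ₂| := by
    intro ω θ₁ θ₂
    rcases le_total θ₁ θ₂ with h | h
    · rw [abs_sub_comm, abs_sub_comm (θ₁ : ℝ)]
      rw [abs_of_nonneg (sub_nonneg.2 ((hv.strictMono_type ω).monotone h))]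
      exact (hv.lipschitz_type ω _ _ h).trans (le_abs_self _)
    · rw [abs_of_nonneg (sub_nonneg.2 ((hv.strictMono_type ω).monotone h))]
      exact (hv.lipschitz_type ω _ _ h).trans (le_abs_self _)
  have h2 : ∀ θ ω₁ ω₂ : I, |v θ ω₁ - v θ ω₂| ≤ |(ω₁ : ℝ) - ω₂| := by
    intro θ ω₁ ω₂
    rcases le_total ω₁ ω₂ with h | h
    · rw [abs_sub_comm, abs_sub_comm (ω₁ : ℝ)]
      rw [abs_of_nonneg (sub_nonneg.2 (hv.mono_quality θ h))]
      exact (hv.lipschitz_quality θ _ _ h).trans (le_abs_self _)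
    · rw [abs_of_nonneg (sub_nonneg.2 (hv.mono_quality θ h))]
      exact (hv.lipschitz_quality θ _ _ h).trans (le_abs_self _)
  refine (LipschitzWith.of_dist_le_mul (K := 2) fun x y => ?_).continuous
  have h3 : dist (x.1 : ℝ) y.1 ≤ dist x y := le_max_left _ _
  have h4 : dist (x.2 : ℝ) y.2 ≤ dist x y := le_max_right _ _
  rw [Real.dist_eq] at h3 h4 ⊢
  have h5 := abs_sub_le (v x.1 x.2) (v y.1 x.2) (v y.1 y.2)
  have h6 := h1 x.2 x.1 y.1
  have h7 := h2 y.1 x.2 y.2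
  simp only [NNReal.coe_ofNat]
  linarith

theorem continuous_type (q : I) : Continuous fun θ => v θ q :=
  hv.continuous_uncurry.comp (by fun_prop : Continuous fun θ : I => (θ, q))

theorem continuous_quality (θ : I) : Continuous fun q => v θ q :=
  hv.continuous_uncurry.comp (by fun_prop : Continuous fun q : I => (θ, q))

theorem criticalType_le_iff (hx : x < 1) : criticalType v p q ≤ x ↔ p ≤ v x q :=
  PricingPersuasion.criticalType_le_iff (hv.continuous_type q) (hv.strictMono_type q).monotone hx

theorem criticalType_valuation (x q : I) : criticalType v (v x q) q = x :=
  PricingPersuasion.criticalType_valuation (hv.strictMono_type q) x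

theorem criticalType_antitone : Antitone (criticalType v p) :=
  PricingPersuasion.criticalType_antitone hv.mono_quality

/-- If `p < v x q`, continuity yields a buying type strictly below `x`; this is where `0 < x` is
used. -/
theorem le_criticalType_iff (hx : 0 < x) : x ≤ criticalType v p q ↔ v x q ≤ p := by
  constructor
  · intro h
    by_contra! hlt
    have hU : {θ : I | p < v θ q} ∈ nhds x :=
      (isOpen_lt continuous_const (hv.continuous_type q)).mem_nhds hlt
    obtain ⟨l, hl, hls⟩ := exists_Ioc_subset_of_mem_nhds hU ⟨0, hx⟩
    obtain ⟨y, hly, hyx⟩ := exists_between hl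
    have : p < v y q := hls ⟨hly, hyx.le⟩
    exact absurd (h.trans (criticalType_le this.le)) (not_le.2 hyx)
  · intro h
    exact le_sInf fun θ hθ => (hv.strictMono_type q).le_iff_le.1 (h.trans hθ)

/-- Closedness makes the end points of a level set belong to it, so that they can serve as grid
points for posterior means. -/
theorem isClosed_criticalType_eq (p : ℝ) (x : I) : IsClosed {q : I | criticalType v p q = x} := by
  have h : {q : I | criticalType v p q = x} =
      {q | criticalType v p q ≤ x} ∩ {q | x ≤ criticalType v p q} := by
    ext q; exact le_antisymm_iff
  rw [h]
  refine IsClosed.inter ?_ ?_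
  · rcases (unitInterval.le_one' : x ≤ 1).lt_or_eq with hx | hx
    · simp only [hv.criticalType_le_iff hx]
      exact isClosed_le continuous_const (hv.continuous_quality x)
    · convert isClosed_univ
      ext q; simp only [mem_ofPred_eq, mem_univ, iff_true]; rw [hx]; exact le_top
  · rcases (bot_le : (0 : I) ≤ x).lt_or_eq with hx | hx
    · simp only [hv.le_criticalType_iff hx]
      exact isClosed_le (hv.continuous_quality x) continuous_const
    · convert isClosed_univ
      ext q; simp only [mem_ofPred_eq, mem_univ, iff_true]; rw [← hx]; exact bot_le

theorem measurable_criticalType : Measurable fun y : ℝ × I => criticalType v y.1 y.2 := by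
  refine measurable_of_Iic fun x => ?_
  rcases (unitInterval.le_one' : x ≤ 1).lt_or_eq with hx | hx
  · have : (fun y : ℝ × I => criticalType v y.1 y.2) ⁻¹' Iic x = {y | y.1 ≤ v x y.2} := by
      ext y; exact hv.criticalType_le_iff hx
    rw [this]
    exact (isClosed_le continuous_fst
      ((hv.continuous_quality x).comp continuous_snd)).measurableSet
  · convert MeasurableSet.univ
    ext y; simp only [mem_preimage, mem_Iic, mem_univ, iff_true]; rw [hx]; exact le_top

theorem measurable_criticalType_right (p : ℝ) : Measurable fun q : I => criticalType v p q :=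
  hv.measurable_criticalType.comp (by fun_prop : Measurable fun q : I => (p, q))

/-- The buying set and `[κ,1]` can differ only at the type `1`, which has no mass. -/
theorem measureReal_purchase {F : Measure I} (hF : F {1} = 0) (p : ℝ) (q : I) :
    F.real {θ : I | p ≤ v θ q} = F.real (Ici (criticalType v p q)) := by
  refine measureReal_congr ?_
  have h1 : ∀ᵐ θ ∂F, θ ≠ 1 := by
    rw [ae_iff]; simpa using hF
  filter_upwards [h1] with θ hθ
  exact propext (hv.criticalType_le_iff (lt_of_le_of_ne le_top hθ)).symm

/-- Lowering the price by `s` lowers a critical type below `1` by `s`, unless it reaches `0`. -/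
theorem criticalType_sub_le {p' s : ℝ} (hs : 0 ≤ s) (hp : p' + s ≤ p)
    (h1 : criticalType v p q < 1) :
    (criticalType v p' q : ℝ) ≤ max 0 ((criticalType v p q : ℝ) - s) := by
  set x := criticalType v p q with hx
  have hpx : p ≤ v x q := le_valuation_criticalType (hv.continuous_type q) h1
  let y : I := ⟨max 0 ((x : ℝ) - s), le_max_left _ _, max_le zero_le_one (by linarith [x.2.2])⟩
  have hyx : y ≤ x := Subtype.coe_le_coe.1 (max_le x.2.1 (by linarith))
  have h2 := hv.lipschitz_type q y x hyx
  have h3 : (x : ℝ) - s ≤ y := le_max_right _ _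
  exact criticalType_le (x := y) (by linarith)

end RegularValuation

/-! ## Pooling -/

theorem measurable_measureReal {X Y : Type*} [MeasurableSpace X] [MeasurableSpace Y]
    (ρ : Kernel X Y) {B : Set Y} (hB : MeasurableSet B) :
    Measurable fun x => (ρ x).real B :=
  (ρ.measurable_coe hB).ennreal_toReal

theorem measureReal_comp {X Y : Type*} [MeasurableSpace X] [MeasurableSpace Y] (m : Measure X)
    (ρ : Kernel X Y) [IsFiniteKernel ρ] {B : Set Y} (hB : MeasurableSet B) :
    (ρ ∘ₘ m).real B = ∫ x, (ρ x).real B ∂m := by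
  rw [measureReal_def, Measure.bind_apply hB ρ.aemeasurable]
  exact (integral_toReal (ρ.measurable_coe hB).aemeasurable
    (Filter.Eventually.of_forall fun x => measure_lt_top _ _)).symm

theorem cell_val {δ : ℝ} (hδ : 0 < δ) (ω : I) : (cell δ ω : ℕ) = ⌈(ω : ℝ) / δ⌉₊ :=
  min_eq_left (Nat.ceil_mono (div_le_div_of_nonneg_right ω.2.2 hδ.le))

theorem measurable_cell (δ : ℝ) : Measurable (cell δ) := by
  refine measurable_to_countable' fun i => ?_
  have h : cell δ ⁻¹' {i} =
      (fun ω : I => min ⌈(ω : ℝ) / δ⌉₊ ⌈1 / δ⌉₊) ⁻¹' {(i : ℕ)} := by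
    ext ω; simp [cell, Fin.ext_iff]
  rw [h]
  have h2 : Measurable fun ω : I => min ⌈(ω : ℝ) / δ⌉₊ ⌈1 / δ⌉₊ :=
    (Nat.measurable_ceil.comp (by fun_prop : Measurable fun ω : I => (ω : ℝ) / δ)).min
      measurable_const
  exact h2 (measurableSet_singleton _)

instance (μ : Measure I) [IsProbabilityMeasure μ] (δ : ℝ) :
    IsProbabilityMeasure (pooledPrior μ δ) :=
  Measure.isProbabilityMeasure_map (measurable_cell δ).aemeasurable

theorem comap_cell_comp (μ : Measure I) (δ : ℝ) (ρ : Kernel (Fin (⌈1 / δ⌉₊ + 1)) I)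
    {ρ' : Kernel I I}
    (h : ∀ ω, ρ' ω = ρ (cell δ ω)) : ρ' ∘ₘ μ = ρ ∘ₘ pooledPrior μ δ := by
  ext B hB
  rw [Measure.bind_apply hB ρ'.aemeasurable, Measure.bind_apply hB ρ.aemeasurable, pooledPrior,
    lintegral_map (ρ.measurable_coe hB) (measurable_cell δ)]
  simp only [h]

section Pooling

variable (μ : Measure I) [IsProbabilityMeasure μ] (δ : ℝ)

theorem integrable_coe_I (ν : Measure I) [IsFiniteMeasure ν] :
    Integrable (fun ω : I => (ω : ℝ)) ν :=
  Integrable.of_mem_Icc 0 1 (by fun_prop) (Filter.Eventually.of_forall fun ω => ω.2)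

/-- The projection to `[0,1]` is inactive, and on a cell of mass zero both sides vanish whatever its
quality is. -/
theorem pooledPrior_mul_pooledQuality (i : Fin (⌈1 / δ⌉₊ + 1)) :
    (pooledPrior μ δ).real {i} * (pooledQuality μ δ i : ℝ) =
      ∫ ω in cell δ ⁻¹' {i}, (ω : ℝ) ∂μ := by
  have hS : MeasurableSet (cell δ ⁻¹' {i}) := measurable_cell δ (measurableSet_singleton i)
  set S := cell δ ⁻¹' {i} with hSdef
  have h0 : 0 ≤ ∫ ω in S, (ω : ℝ) ∂μ := integral_nonneg fun ω => ω.2.1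
  have h1 : ∫ ω in S, (ω : ℝ) ∂μ ≤ μ.real S := by
    have := integral_mono (μ := μ.restrict S) (integrable_coe_I _) (integrable_const (1 : ℝ))
      (fun ω => ω.2.2)
    simpa using this
  have h2 : (pooledPrior μ δ).real {i} = μ.real S := by
    rw [pooledPrior, map_measureReal_apply (measurable_cell δ) (measurableSet_singleton i)]
  rw [h2, pooledQuality, setAverage_eq, smul_eq_mul]
  rcases eq_or_lt_of_le (measureReal_nonneg (μ := μ) (s := S)) with h | h
  · rw [← h] at h1 ⊢
    simp only [zero_mul]
    linarith
  · have h3 : (μ.real S)⁻¹ * ∫ ω in S, (ω : ℝ) ∂μ ≤ 1 := by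
      rw [inv_mul_le_iff₀ h]; simpa using h1
    have h4 : 0 ≤ (μ.real S)⁻¹ * ∫ ω in S, (ω : ℝ) ∂μ := by positivity
    rw [coe_projIcc, min_eq_right h3, max_eq_right h4, mul_inv_cancel_left₀ h.ne']

/-- Tower property over the cells; all transfers between the original and the pooled instance rest
on it. -/
theorem integral_mul_cell (f : Fin (⌈1 / δ⌉₊ + 1) → ℝ) :
    ∫ ω, (ω : ℝ) * f (cell δ ω) ∂μ =
      ∫ i, (pooledQuality μ δ i : ℝ) * f i ∂(pooledPrior μ δ) := by
  have hS : ∀ i, MeasurableSet (cell δ ⁻¹' {i}) := fun i =>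
    measurable_cell δ (measurableSet_singleton i)
  have h1 : ∀ ω : I, (ω : ℝ) * f (cell δ ω) =
      ∑ i, (cell δ ⁻¹' {i}).indicator (fun ω : I => (ω : ℝ) * f i) ω := by
    intro ω
    rw [Finset.sum_eq_single (cell δ ω)]
    · simp
    · intro i _ hi
      exact indicator_of_notMem (by simpa using hi.symm) _
    · simp
  simp only [h1]
  rw [integral_finsetSum _ fun i _ => ((integrable_coe_I μ).mul_const _).indicator (hS i),
    integral_fintype (Integrable.of_finite)]
  refine Finset.sum_congr rfl fun i _ => ?_
  rw [integral_indicator (hS i), integral_mul_const, ← pooledPrior_mul_pooledQuality, smul_eq_mul,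
    mul_assoc]

theorem priorMean_pooled : priorMean (pooledPrior μ δ) (pooledQuality μ δ) = priorMean μ id := by
  have := integral_mul_cell μ δ fun _ => 1
  simp only [mul_one] at this
  rw [priorMean, priorMean, ← this]
  rfl

theorem bayesConsistent_comap_cell {ρ : Kernel (Fin (⌈1 / δ⌉₊ + 1)) I} {ρ' : Kernel I I}
    (h : ∀ ω, ρ' ω = ρ (cell δ ω))
    (hρ : BayesConsistent (pooledPrior μ δ) (pooledQuality μ δ) ρ) :
    BayesConsistent μ id ρ' := by
  intro B hB
  rw [comap_cell_comp μ δ ρ h, ← hρ B hB, ← integral_mul_cell]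
  simp [h]

/-- Qualities in one cell differ by less than `δ`, so the conditional mean is above each of them
minus `δ`. Cells of mass zero are excluded almost surely. -/
theorem ae_sub_le_pooledQuality {δ : ℝ} (hδ : 0 < δ) :
    ∀ᵐ ω : I ∂μ, (ω : ℝ) - δ ≤ pooledQuality μ δ (cell δ ω) := by
  have h : ∀ i, ∀ᵐ ω ∂μ, cell δ ω = i → (ω : ℝ) - δ ≤ pooledQuality μ δ i := by
    intro i
    have hS : MeasurableSet (cell δ ⁻¹' {i}) := measurable_cell δ (measurableSet_singleton i)
    by_cases h0 : μ (cell δ ⁻¹' {i}) = 0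
    · filter_upwards [measure_eq_zero_iff_ae_notMem.1 h0] with ω hω hi
      exact absurd hi hω
    · refine Filter.Eventually.of_forall fun ω hω => ?_
      have hpos : 0 < μ.real (cell δ ⁻¹' {i}) :=
        ENNReal.toReal_pos h0 (measure_ne_top _ _)
      have h1 := pooledPrior_mul_pooledQuality μ δ i
      have h2 : (pooledPrior μ δ).real {i} = μ.real (cell δ ⁻¹' {i}) := by
        rw [pooledPrior, map_measureReal_apply (measurable_cell δ) (measurableSet_singleton i)]
      rw [h2] at h1
      have h3 : ∫ ω' in cell δ ⁻¹' {i}, ((ω : ℝ) - δ) ∂μ ≤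
          ∫ ω' in cell δ ⁻¹' {i}, (ω' : ℝ) ∂μ := by
        refine setIntegral_mono_on (integrable_const _) (integrable_coe_I _) hS ?_
        intro ω' hω'
        have h4 : ⌈(ω' : ℝ) / δ⌉₊ = ⌈(ω : ℝ) / δ⌉₊ := by
          rw [← cell_val hδ, ← cell_val hδ, hω, show cell δ ω' = i from hω']
        have h5 : (ω : ℝ) / δ ≤ ⌈(ω : ℝ) / δ⌉₊ := Nat.le_ceil _
        have h6 : (⌈(ω' : ℝ) / δ⌉₊ : ℝ) < (ω' : ℝ) / δ + 1 :=
          Nat.ceil_lt_add_one (div_nonneg ω'.2.1 hδ.le)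
        rw [h4] at h6
        have h7 := h5.trans_lt h6
        rw [div_add_one hδ.ne', div_lt_div_iff_of_pos_right hδ] at h7
        linarith
      rw [setIntegral_const, ← h1, smul_eq_mul] at h3
      exact le_of_mul_le_mul_left h3 hpos
  filter_upwards [ae_all_iff.2 h] with ω hω
  exact hω _ rfl

end Pooling

/-! ### Elementary bounds on one-round revenue -/

section OptRevenue

variable {X : Type} [MeasurableSpace X] {prior : Measure X} {val : X → I} {F : Measure I}
  {v : I → I → ℝ} {U p : ℝ}
  {ρ : Kernel X I}

theorem rev_nonneg (hp : 0 ≤ p) : 0 ≤ rev prior F v p ρ :=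
  mul_nonneg hp (integral_nonneg fun _ => measureReal_nonneg)

theorem optRevenue_nonneg : 0 ≤ optRevenue prior val F v U := by
  refine Real.sSup_nonneg ?_
  rintro _ ⟨p, hp, ρ, -, -, rfl⟩
  exact rev_nonneg hp.1

theorem optRevenue_le {c : ℝ} (hc : 0 ≤ c)
    (h : ∀ p ∈ Icc 0 U, ∀ ρ : Kernel X I, IsMarkovKernel ρ → BayesConsistent prior val ρ →
      rev prior F v p ρ ≤ c) : optRevenue prior val F v U ≤ c := by
  refine Real.sSup_le ?_ hc
  rintro _ ⟨p, hp, ρ, hρ, hb, rfl⟩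
  exact h p hp ρ hρ hb

variable [IsProbabilityMeasure prior]

theorem bayesConsistent_const_dirac :
    BayesConsistent prior val (Kernel.const X (Measure.dirac (priorMean prior val))) := by
  intro B hB
  have h : Kernel.const X (Measure.dirac (priorMean prior val)) ∘ₘ prior =
      Measure.dirac (priorMean prior val) := by
    rw [Measure.const_comp, measure_univ, one_smul]
  rw [h]
  classical
  rw [setIntegral_dirac' (by fun_prop : Continuous fun q : I => (q : ℝ)).stronglyMeasurable _ hB]
  by_cases hm : priorMean prior val ∈ B
  · rw [if_pos hm, coe_priorMean]
    simp [measureReal_def, hB, hm]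
  · simp [measureReal_def, hB, hm]

variable [IsProbabilityMeasure F]

theorem rev_le (hp : 0 ≤ p) [IsMarkovKernel ρ] : rev prior F v p ρ ≤ p := by
  have h : ∫ q, F.real {θ : I | p ≤ v θ q} ∂(ρ ∘ₘ prior) ≤ ∫ _, 1 ∂(ρ ∘ₘ prior) :=
    integral_mono_of_nonneg (Filter.Eventually.of_forall fun _ => measureReal_nonneg)
      (integrable_const 1) (Filter.Eventually.of_forall fun _ => measureReal_le_one)
  rw [integral_const, probReal_univ, one_smul] at h
  exact mul_le_of_le_one_right hp h

theorem bddAbove_revenue : BddAbove {r : ℝ | ∃ p ∈ Icc (0 : ℝ) U, ∃ ρ : Kernel X I,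
    IsMarkovKernel ρ ∧ BayesConsistent prior val ρ ∧ r = rev prior F v p ρ} := by
  refine ⟨U, ?_⟩
  rintro _ ⟨p, hp, ρ, hρ, -, rfl⟩
  exact (rev_le hp.1).trans hp.2

theorem rev_le_optRevenue (hp : p ∈ Icc 0 U) [hρ : IsMarkovKernel ρ]
    (hb : BayesConsistent prior val ρ) : rev prior F v p ρ ≤ optRevenue prior val F v U :=
  le_csSup bddAbove_revenue ⟨p, hp, ρ, hρ, hb, rfl⟩

end OptRevenue

theorem monotone_purchase {v : I → I → ℝ} (hv : RegularValuation v) (F : Measure I)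
    [IsProbabilityMeasure F] (p : ℝ) : Monotone fun q => F.real {θ : I | p ≤ v θ q} :=
  fun _ _ h => measureReal_mono fun θ hθ => le_trans hθ (hv.mono_quality θ h)

theorem integrable_purchase {v : I → I → ℝ} (hv : RegularValuation v) (F : Measure I)
    [IsProbabilityMeasure F] (p : ℝ) (ν : Measure I) [IsFiniteMeasure ν] :
    Integrable (fun q => F.real {θ : I | p ≤ v θ q}) ν :=
  Integrable.of_mem_Icc 0 1 (monotone_purchase hv F p).measurable.aemeasurable
    (Filter.Eventually.of_forall fun _ => ⟨measureReal_nonneg, measureReal_le_one⟩)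

/-- Replacing qualities by the qualities of their cells moves posterior means down by at most `δ`
after the posterior means have been recomputed. -/
theorem exists_pooled_strategy (μ : Measure I) [IsProbabilityMeasure μ] {δ : ℝ} (hδ : 0 < δ)
    (ρ : Kernel I I) [IsMarkovKernel ρ] (hρ : BayesConsistent μ id ρ) :
    ∃ (ρ' : Kernel (Fin (⌈1 / δ⌉₊ + 1)) I) (Q : I → I), IsMarkovKernel ρ' ∧
      BayesConsistent (pooledPrior μ δ) (pooledQuality μ δ) ρ' ∧ Measurable Q ∧
      ρ' ∘ₘ pooledPrior μ δ = (ρ ∘ₘ μ).map Q ∧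
      ∀ᵐ q : I ∂(ρ ∘ₘ μ), (q : ℝ) - δ ≤ Q q := by
  have hcell := measurable_cell δ
  set c : Kernel I (Fin (⌈1 / δ⌉₊ + 1)) := Kernel.deterministic (cell δ) hcell with hc
  have hcμ : c ∘ₘ μ = pooledPrior μ δ := Measure.deterministic_comp_eq_map hcell
  set g : I → I := fun ω => pooledQuality μ δ (cell δ ω) with hg
  have hgm : Measurable g := (measurable_of_countable (pooledQuality μ δ)).comp hcell
  have hgm' : Measurable fun ω => (g ω : ℝ) := by fun_prop
  set ν := ρ ∘ₘ μ with hν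
  let Q : I → I := fun q => priorMean ((ρ†μ) q) g
  have hQcoe : ∀ q, (Q q : ℝ) = ∫ ω, (g ω : ℝ) ∂((ρ†μ) q) := fun q => coe_priorMean _ _
  have hQm : Measurable Q := by
    have h : StronglyMeasurable fun q => ∫ ω, (g ω : ℝ) ∂((ρ†μ) q) :=
      hgm'.stronglyMeasurable.integral_kernel
    exact continuous_projIcc.measurable.comp h.measurable
  -- Given a cell, a quality is redrawn from its conditional law, `ρ` is applied to it, and `Q q` is
  -- reported in place of `q`. Redrawing does not change the law of `q`.
  let ρ' : Kernel (Fin (⌈1 / δ⌉₊ + 1)) I := (ρ ∘ₖ (c†μ)).map Q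
  have hρ'ν : ρ' ∘ₘ pooledPrior μ δ = ν.map Q := by
    rw [← Measure.map_comp _ _ hQm, ← Measure.comp_assoc, ← hcμ, posterior_comp_self]
  -- Disintegrating the joint law of quality and posterior mean in both orders identifies `Q` as the
  -- conditional expectation of `g`.
  have key : ∀ A : Set I, MeasurableSet A →
      ∫ q in A, (Q q : ℝ) ∂ν = ∫ ω, (g ω : ℝ) * (ρ ω).real A ∂μ := by
    intro A hA
    simp only [hQcoe]
    have hint : Integrable (fun x : I × I => A.indicator (fun _ => (g x.2 : ℝ)) x.1)
        (ν ⊗ₘ (ρ†μ)) := by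
      refine Integrable.of_mem_Icc 0 1 ?_ (Filter.Eventually.of_forall fun x => ?_)
      · exact ((hgm'.comp measurable_snd).indicator (measurable_fst hA)).aemeasurable
      · by_cases h : x.1 ∈ A
        · simp [h]
        · simp [h]
    have h1 := Measure.integral_compProd hint
    have h2 : ∀ q, ∫ ω, A.indicator (fun _ => (g ω : ℝ)) q ∂((ρ†μ) q) =
        A.indicator (fun q => ∫ ω, (g ω : ℝ) ∂((ρ†μ) q)) q := by
      intro q
      by_cases h : q ∈ A <;> simp [h]
    simp only [h2] at h1
    rw [integral_indicator hA] at h1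
    rw [← h1, compProd_posterior_eq_map_swap]
    rw [compProd_posterior_eq_map_swap] at hint
    rw [integral_map measurable_swap.aemeasurable hint.aestronglyMeasurable,
      Measure.integral_compProd]
    · refine integral_congr_ae (Filter.Eventually.of_forall fun ω => ?_)
      have : ∀ y, A.indicator (fun _ => (g ω : ℝ)) y = (g ω : ℝ) * A.indicator 1 y := by
        intro y; by_cases h : y ∈ A <;> simp [h]
      simp only [Prod.swap, this]
      rw [integral_const_mul, integral_indicator_one hA]
    · exact (integrable_map_measure hint.aestronglyMeasurable measurable_swap.aemeasurable).1 hint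
  have hρ'M : IsMarkovKernel ρ' := Kernel.IsMarkovKernel.map _ hQm
  refine ⟨ρ', Q, hρ'M, ?_, hQm, hρ'ν, ?_⟩
  · intro B hB
    rw [hρ'ν, setIntegral_map hB (by fun_prop) hQm.aemeasurable, key _ (hQm hB)]
    have hA : MeasurableSet (Q ⁻¹' B) := hQm hB
    have h1 : ∀ i, (ρ' i).real B = ∫ ω, (ρ ω).real (Q ⁻¹' B) ∂((c†μ) i) := by
      intro i
      rw [← measureReal_comp _ _ hA, Kernel.map_apply _ hQm, map_measureReal_apply hQm hB,
        Kernel.comp_apply]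
    have hr := measurable_measureReal ρ hA
    have hint : Integrable (fun x : Fin (⌈1 / δ⌉₊ + 1) × I =>
        (pooledQuality μ δ x.1 : ℝ) * (ρ x.2).real (Q ⁻¹' B)) ((c ∘ₘ μ) ⊗ₘ (c†μ)) := by
      refine Integrable.of_mem_Icc 0 1 ?_ (Filter.Eventually.of_forall fun x => ?_)
      · exact (((measurable_of_countable
          (fun i => (pooledQuality μ δ i : ℝ))).comp measurable_fst).mul
            (hr.comp measurable_snd)).aemeasurable
      · exact ⟨mul_nonneg (pooledQuality μ δ x.1).2.1 measureReal_nonneg,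
          mul_le_one₀ (pooledQuality μ δ x.1).2.2 measureReal_nonneg measureReal_le_one⟩
    have h2 := Measure.integral_compProd hint
    simp only [integral_const_mul, ← h1] at h2
    rw [← hcμ, ← h2]
    rw [compProd_posterior_eq_map_swap] at hint ⊢
    rw [integral_map measurable_swap.aemeasurable hint.aestronglyMeasurable]
    refine (Measure.integral_compProd ((integrable_map_measure hint.aestronglyMeasurable
      measurable_swap.aemeasurable).1 hint)).trans ?_
    refine integral_congr_ae (Filter.Eventually.of_forall fun ω => ?_)
    simp only [hc]
    rw [Kernel.integral_deterministic]
    rfl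
  · have hQi : Integrable (fun q => (Q q : ℝ)) ν :=
      Integrable.of_mem_Icc 0 1 (by fun_prop) (Filter.Eventually.of_forall fun q => (Q q).2)
    -- Bayes consistency says that `q` is the conditional mean of the quality. Conditioning the
    -- inequality between quality minus `δ` and `g` therefore gives the claim, tested on sets `A`.
    refine ae_le_of_forall_setIntegral_le ((integrable_coe_I ν).sub (integrable_const δ)) hQi ?_
    intro A hA _
    rw [key A hA, integral_sub (integrable_coe_I _) (integrable_const δ), ← hρ A hA,
      setIntegral_const, smul_eq_mul, hν, measureReal_comp _ _ hA, ← integral_mul_const]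
    have hr := measurable_measureReal ρ hA
    have hi1 : Integrable (fun ω => (ρ ω).real A) μ :=
      Integrable.of_mem_Icc 0 1 hr.aemeasurable
        (Filter.Eventually.of_forall fun _ => ⟨measureReal_nonneg, measureReal_le_one⟩)
    have hi2 : ∀ f : I → I, Measurable f →
        Integrable (fun ω => (f ω : ℝ) * (ρ ω).real A) μ := fun f hf =>
      Integrable.of_mem_Icc 0 1 (by fun_prop) (Filter.Eventually.of_forall fun ω =>
        ⟨mul_nonneg (f ω).2.1 measureReal_nonneg,
          mul_le_one₀ (f ω).2.2 measureReal_nonneg measureReal_le_one⟩)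
    rw [← integral_sub (hi2 id measurable_id) (hi1.mul_const δ)]
    refine integral_mono_ae ((hi2 id measurable_id).sub (hi1.mul_const δ)) (hi2 g hgm) ?_
    filter_upwards [ae_sub_le_pooledQuality μ hδ] with ω hω
    have := mul_le_mul_of_nonneg_right hω (measureReal_nonneg (μ := ρ ω) (s := A))
    simp only [id]
    linarith

/-- The pooled strategy is offered at price `p - δ`. Every type that bought at `q` still buys at `Q
q ≥ q - δ`, and the lower price loses at most `δ` per sale. Prices up to `δ` earn at most `δ`
anyway. -/
theorem optRevenue_le_pooled {v : I → I → ℝ} (hv : RegularValuation v) (F : Measure I)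
    [IsProbabilityMeasure F] (μ : Measure I) [IsProbabilityMeasure μ] (U : ℝ) {δ : ℝ}
    (hδ : 0 < δ) :
    optRevenue μ id F v U ≤
      optRevenue (pooledPrior μ δ) (pooledQuality μ δ) F v U + δ := by
  have hopt : 0 ≤ optRevenue (pooledPrior μ δ) (pooledQuality μ δ) F v U := optRevenue_nonneg
  refine optRevenue_le (by linarith) fun p hp ρ hρ hb => ?_
  rcases le_or_gt p δ with hpδ | hpδ
  · linarith [rev_le (prior := μ) (F := F) (v := v) hp.1 (ρ := ρ)]
  obtain ⟨ρ', Q, hρ', hb', hQm, hνQ, hQ⟩ := exists_pooled_strategy μ hδ ρ hb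
  have h1 : rev (pooledPrior μ δ) F v (p - δ) ρ' ≤ _ :=
    rev_le_optRevenue (U := U) ⟨by linarith, by linarith [hp.2]⟩ hb'
  have h2 : ∫ q, F.real {θ : I | p ≤ v θ q} ∂(ρ ∘ₘ μ) ≤
      ∫ q, F.real {θ : I | p - δ ≤ v θ q} ∂(ρ' ∘ₘ pooledPrior μ δ) := by
    rw [hνQ, integral_map hQm.aemeasurable
      (monotone_purchase hv F _).measurable.aestronglyMeasurable]
    refine integral_mono_ae (integrable_purchase hv F p _) ?_ ?_
    · exact Integrable.of_mem_Icc 0 1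
        ((monotone_purchase hv F _).measurable.comp hQm).aemeasurable
        (Filter.Eventually.of_forall fun _ => ⟨measureReal_nonneg, measureReal_le_one⟩)
    · filter_upwards [hQ] with q hq
      refine measureReal_mono fun θ hθ => ?_
      have hθ' : p ≤ v θ q := hθ
      show p - δ ≤ v θ (Q q)
      rcases le_total q (Q q) with h | h
      · linarith [hv.mono_quality θ h]
      · linarith [hv.lipschitz_quality θ _ _ h]
  have h3 : ∫ q, F.real {θ : I | p ≤ v θ q} ∂(ρ ∘ₘ μ) ≤ 1 := by
    have := rev_le (prior := μ) (F := F) (v := v) hp.1 (ρ := ρ)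
    rw [rev] at this
    exact le_of_mul_le_mul_left (by simpa using this) (hδ.trans hpδ)
  rw [rev] at h1 ⊢
  nlinarith [mul_le_mul_of_nonneg_left h2 (by linarith : 0 ≤ p - δ)]

/-! ## Finitely supported advertising strategies -/

theorem integral_comp_measure {X Y : Type*} [MeasurableSpace X] [MeasurableSpace Y]
    {m : Measure X} [SFinite m] {ρ : Kernel X Y} [IsSFiniteKernel ρ] {f : Y → ℝ}
    (hf : Integrable f (ρ ∘ₘ m)) : ∫ y, f y ∂(ρ ∘ₘ m) = ∫ x, ∫ y, f y ∂(ρ x) ∂m := by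
  rw [Measure.comp_eq_comp_const_apply] at hf ⊢
  rw [Kernel.integral_comp hf, Kernel.const_apply]

/-- The linear system for the two fractions in `exists_split`. Its determinant is `y * z - w * x`;
the degenerate cases are solved by hand. -/
theorem exists_mul_eq_mul {x y z w : ℝ} (hx : 0 ≤ x) (hw : 0 ≤ w) (hxy : x ≤ y) (hwz : w ≤ z) :
    ∃ s ∈ Icc (0 : ℝ) 1, ∃ t ∈ Icc (0 : ℝ) 1, s * x = t * y ∧ (1 - s) * z = (1 - t) * w := by
  have hD : 0 ≤ y * z - w * x := by nlinarith
  rcases hD.lt_or_eq with hD | hD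
  · refine ⟨y * (z - w) / (y * z - w * x), ⟨div_nonneg (by nlinarith) hD.le, ?_⟩,
      x * (z - w) / (y * z - w * x), ⟨div_nonneg (by nlinarith) hD.le, ?_⟩, ?_, ?_⟩
    · rw [div_le_one hD]; nlinarith
    · rw [div_le_one hD]; nlinarith
    · field_simp
    · field_simp; ring
  · rcases eq_or_ne z 0 with hz | hz
    · have hw0 : w = 0 := by linarith
      rcases eq_or_ne y 0 with hy | hy
      · have hx0 : x = 0 := by linarith
        exact ⟨0, by simp, 0, by simp, by simp [hx0, hy], by simp [hw0, hz]⟩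
      · exact ⟨1, by simp, x / y, ⟨div_nonneg hx (hx.trans hxy),
          div_le_one_of_le₀ hxy (hx.trans hxy)⟩, by field_simp, by simp [hw0]⟩
    · have hz0 : 0 < z := lt_of_le_of_ne (hw.trans hwz) hz.symm
      have hyx : y = x := by
        by_contra hne
        have : x < y := lt_of_le_of_ne hxy (Ne.symm hne)
        nlinarith
      rcases eq_or_ne x 0 with hx0 | hx0
      · refine ⟨1 - w / z, ⟨sub_nonneg.2 (div_le_one_of_le₀ hwz hz0.le),
          sub_le_self _ (div_nonneg hw hz0.le)⟩, 0, by simp, by simp [hyx, hx0], ?_⟩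
        field_simp; ring
      · have hzw : z = w := by
          have : x * (z - w) = 0 := by rw [hyx] at hD; linarith
          rcases mul_eq_zero.1 this with h | h
          · exact absurd h hx0
          · linarith
        exact ⟨0, by simp, 0, by simp, by simp, by simp [hzw]⟩

/-- A distribution with mean in `[a, b]` and no mass in the interior of this interval splits into
a part with mean `a` and a part with mean `b`. -/
theorem exists_split {ι : Type*} [Fintype ι] (u x : ι → ℝ) (hu : ∀ i, 0 ≤ u i) {a b : ℝ}
    (hx : ∀ i, x i ≤ a ∨ b ≤ x i) (ha : 0 ≤ ∑ i, u i * (x i - a))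
    (hb : ∑ i, u i * (x i - b) ≤ 0) :
    ∃ c : ι → ℝ, (∀ i, c i ∈ Icc (0 : ℝ) 1) ∧ ∑ i, c i * (u i * (x i - a)) = 0 ∧
      ∑ i, (1 - c i) * (u i * (x i - b)) = 0 := by
  classical
  have hsplit : ∀ (f : ι → ℝ), ∑ i, f i =
      ∑ i ∈ Finset.univ.filter (fun i => x i ≤ a), f i +
        ∑ i ∈ Finset.univ.filter (fun i => ¬ x i ≤ a), f i := fun f =>
    (Finset.sum_filter_add_sum_filter_not _ _ _).symm
  set L := Finset.univ.filter fun i => x i ≤ a with hL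
  set R := Finset.univ.filter fun i => ¬ x i ≤ a with hR
  have hLm : ∀ i ∈ L, x i ≤ a := fun i hi => (Finset.mem_filter.1 hi).2
  have hRm : ∀ i ∈ R, b ≤ x i := fun i hi => (hx i).resolve_left (Finset.mem_filter.1 hi).2
  have h1 : ∑ i ∈ L, u i * (x i - a) ≤ 0 := Finset.sum_nonpos fun i hi =>
    mul_nonpos_of_nonneg_of_nonpos (hu i) (by linarith [hLm i hi])
  have h2 : 0 ≤ ∑ i ∈ R, u i * (x i - b) := Finset.sum_nonneg fun i hi =>
    mul_nonneg (hu i) (by linarith [hRm i hi])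
  rw [hsplit] at ha hb
  -- A fraction `s` of the mass left of the interval and `t` of the mass right of it go to `a`, the
  -- rest to `b`. The two equations balance the moments about `a` and `b`.
  obtain ⟨s, hs, t, ht, hst1, hst2⟩ := exists_mul_eq_mul
    (x := -∑ i ∈ L, u i * (x i - a)) (y := ∑ i ∈ R, u i * (x i - a))
    (z := -∑ i ∈ L, u i * (x i - b)) (w := ∑ i ∈ R, u i * (x i - b))
    (by linarith) h2 (by linarith) (by linarith)
  refine ⟨fun i => if x i ≤ a then s else t, fun i => ?_, ?_, ?_⟩
  · dsimp only; split_ifs <;> assumption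
  · rw [hsplit]
    have e1 : ∑ i ∈ L, (if x i ≤ a then s else t) * (u i * (x i - a)) =
        s * ∑ i ∈ L, u i * (x i - a) := by
      rw [Finset.mul_sum]
      exact Finset.sum_congr rfl fun i hi => by rw [if_pos (hLm i hi)]
    have e2 : ∑ i ∈ R, (if x i ≤ a then s else t) * (u i * (x i - a)) =
        t * ∑ i ∈ R, u i * (x i - a) := by
      rw [Finset.mul_sum]
      exact Finset.sum_congr rfl fun i hi => by rw [if_neg (Finset.mem_filter.1 hi).2]
    rw [e1, e2]; linarith
  · rw [hsplit]
    have e1 : ∑ i ∈ L, (1 - if x i ≤ a then s else t) * (u i * (x i - b)) =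
        (1 - s) * ∑ i ∈ L, u i * (x i - b) := by
      rw [Finset.mul_sum]
      exact Finset.sum_congr rfl fun i hi => by rw [if_pos (hLm i hi)]
    have e2 : ∑ i ∈ R, (1 - if x i ≤ a then s else t) * (u i * (x i - b)) =
        (1 - t) * ∑ i ∈ R, u i * (x i - b) := by
      rw [Finset.mul_sum]
      exact Finset.sum_congr rfl fun i hi => by rw [if_neg (Finset.mem_filter.1 hi).2]
    rw [e1, e2]; linarith

section FiniteSupport

variable {ι : Type} [Fintype ι] [MeasurableSpace ι] [MeasurableSingletonClass ι]

/-- The advertising strategy that recommends the posterior mean `g ∈ G` with probability `w i g`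
when the quality is `i`. -/
def weightKernel (G : Finset I) (w : ι → I → ℝ) : Kernel ι I where
  toFun i := ∑ g ∈ G, ENNReal.ofReal (w i g) • Measure.dirac g
  measurable' := measurable_of_countable _

/-- The weights of a finitely supported advertising strategy for which every posterior mean is
correct. -/
structure IsStrategyWeight (prior : Measure ι) (val : ι → I) (G : Finset I) (w : ι → I → ℝ) :
    Prop where
  nonneg : ∀ i g, 0 ≤ w i g
  le_one : ∀ i g, w i g ≤ 1
  sum_eq_one : ∀ i, ∑ g ∈ G, w i g = 1
  balanced : ∀ g ∈ G, ∑ i, prior.real {i} * (w i g * ((val i : ℝ) - g)) = 0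

namespace IsStrategyWeight

variable {prior : Measure ι} [IsProbabilityMeasure prior] {val : ι → I} {G : Finset I}
  {w : ι → I → ℝ} (hw : IsStrategyWeight prior val G w)

include hw

omit [IsProbabilityMeasure prior] in
theorem isMarkovKernel : IsMarkovKernel (weightKernel G w) := by
  refine ⟨fun i => ⟨?_⟩⟩
  simp only [weightKernel, Kernel.coe_mk, Measure.finsetSum_apply, Measure.smul_apply,
    measure_univ, smul_eq_mul, mul_one]
  rw [← ENNReal.ofReal_sum_of_nonneg fun g _ => hw.nonneg i g, hw.sum_eq_one, ENNReal.ofReal_one]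

omit [IsProbabilityMeasure prior] in
theorem integral_weightKernel (f : I → ℝ) (i : ι) :
    ∫ q, f q ∂(weightKernel G w i) = ∑ g ∈ G, w i g * f g := by
  simp only [weightKernel, Kernel.coe_mk]
  rw [integral_finsetSum_measure fun g _ =>
    (integrable_dirac (by simp)).smul_measure ENNReal.ofReal_ne_top]
  refine Finset.sum_congr rfl fun g _ => ?_
  rw [integral_smul_measure, integral_dirac, ENNReal.toReal_ofReal (hw.nonneg i g), smul_eq_mul]

theorem integral_comp {f : I → ℝ} (hf : Measurable f) {c : ℝ} (hc : ∀ q, f q ∈ Icc (-c) c) :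
    ∫ q, f q ∂(weightKernel G w ∘ₘ prior) = ∑ i, prior.real {i} * ∑ g ∈ G, w i g * f g := by
  have := hw.isMarkovKernel
  rw [integral_comp_measure (Integrable.of_mem_Icc (-c) c hf.aemeasurable
    (Filter.Eventually.of_forall hc)), integral_fintype Integrable.of_finite]
  simp only [hw.integral_weightKernel, smul_eq_mul]

omit [IsProbabilityMeasure prior] in
theorem measureReal_weightKernel {B : Set I} (hB : MeasurableSet B) (i : ι) :
    (weightKernel G w i).real B = ∑ g ∈ G, w i g * B.indicator 1 g := by
  rw [← integral_indicator_one hB, hw.integral_weightKernel]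

theorem bayesConsistent : BayesConsistent prior val (weightKernel G w) := by
  intro B hB
  have h1 : ∫ q in B, (q : ℝ) ∂(weightKernel G w ∘ₘ prior) =
      ∑ i, prior.real {i} * ∑ g ∈ G, w i g * B.indicator (fun q : I => (q : ℝ)) g := by
    rw [← integral_indicator hB]
    refine hw.integral_comp (c := 1) ((by fun_prop : Measurable fun q : I => (q : ℝ)).indicator hB)
      fun q => ?_
    by_cases hq : q ∈ B
    · rw [indicator_of_mem hq]; exact ⟨by linarith [q.2.1], q.2.2⟩
    · rw [indicator_of_notMem hq]; norm_num
  rw [h1, integral_fintype Integrable.of_finite, ← sub_eq_zero, ← Finset.sum_sub_distrib]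
  have h2 : ∀ i, prior.real {i} • ((val i : ℝ) * (weightKernel G w i).real B) -
      prior.real {i} * ∑ g ∈ G, w i g * B.indicator (fun q : I => (q : ℝ)) g =
      ∑ g ∈ G, B.indicator 1 g * (prior.real {i} * (w i g * ((val i : ℝ) - g))) := by
    intro i
    rw [hw.measureReal_weightKernel hB, smul_eq_mul, ← mul_sub, Finset.mul_sum,
      ← Finset.sum_sub_distrib, Finset.mul_sum]
    refine Finset.sum_congr rfl fun g _ => ?_
    by_cases hg : g ∈ B
    · simp only [indicator_of_mem hg, Pi.one_apply]; ring
    · simp only [indicator_of_notMem hg]; ring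
  simp only [h2]
  rw [Finset.sum_comm]
  refine Finset.sum_eq_zero fun g hg => ?_
  rw [← Finset.mul_sum, hw.balanced g hg, mul_zero]

omit hw in
omit [IsProbabilityMeasure prior] in
theorem weightKernel_compl {A : Set I} (hA : ∀ g ∈ G, g ∈ A) (i : ι) :
    weightKernel G w i Aᶜ = 0 := by
  simp only [weightKernel, Kernel.coe_mk, Measure.finsetSum_apply, Measure.smul_apply, smul_eq_mul]
  refine Finset.sum_eq_zero fun g hg => ?_
  simp [hA g hg]

end IsStrategyWeight

end FiniteSupport

/-! ## Rounding posterior means to a finite grid -/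

section Grid

variable (G : Finset I)

/-- The open gap between `g` and the next point of `G` (or the end of the interval). -/
def gap (g : I) : Set I := {q | g < q ∧ ∀ g' ∈ G, g < g' → q < g'}

open Classical in
/-- The smallest point of `G` beyond `g`, or `g` if there is none. -/
def nextPoint (g : I) : I :=
  if h : (G.filter fun g' => g < g').Nonempty then (G.filter fun g' => g < g').min' h else g

/-- There is no point of `G` strictly between `q` and `g`, and `q ∉ G` unless `q = g`. -/
def Adjacent (q g : I) : Prop :=
  ∀ g' ∈ G, ¬ (g < g' ∧ g' ≤ q) ∧ ¬ (q ≤ g' ∧ g' < g)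

variable {G} {g q : I}

theorem adjacent_self (g : I) : Adjacent G g g := fun _ _ =>
  ⟨fun h => absurd (h.1.trans_le h.2) (lt_irrefl _),
    fun h => absurd (h.1.trans_lt h.2) (lt_irrefl _)⟩

theorem nextPoint_mem (hg : g ∈ G) : nextPoint G g ∈ G := by
  unfold nextPoint
  split_ifs with h
  · exact (Finset.mem_filter.1 (Finset.min'_mem _ h)).1
  · exact hg

theorem nextPoint_eq_or_lt (g : I) :
    (nextPoint G g = g ∧ ∀ g' ∈ G, g' ≤ g) ∨
      (g < nextPoint G g ∧ ∀ g' ∈ G, g < g' → nextPoint G g ≤ g') := by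
  unfold nextPoint
  split_ifs with h
  · right
    exact ⟨(Finset.mem_filter.1 (Finset.min'_mem _ h)).2, fun g' hg' hlt =>
      Finset.min'_le _ _ (Finset.mem_filter.2 ⟨hg', hlt⟩)⟩
  · left
    refine ⟨rfl, fun g' hg' => ?_⟩
    by_contra! hlt
    exact h ⟨g', Finset.mem_filter.2 ⟨hg', hlt⟩⟩

theorem adjacent_of_mem_gap (hq : q ∈ gap G g) : Adjacent G q g := fun g' hg' =>
  ⟨fun h => absurd (hq.2 g' hg' h.1) (not_lt.2 h.2),
    fun h => absurd (hq.1.trans_le h.1) (not_lt.2 h.2.le)⟩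

theorem adjacent_nextPoint_of_mem_gap (hg : g ∈ G) (hq : q ∈ gap G g) :
    Adjacent G q (nextPoint G g) := by
  rcases nextPoint_eq_or_lt (G := G) g with ⟨h, -⟩ | ⟨h, h'⟩
  · rw [h]; exact adjacent_of_mem_gap hq
  · have hlt := hq.2 _ (nextPoint_mem hg) h
    exact fun g' hg' => ⟨fun hh => absurd ((hlt.trans hh.1).trans_le hh.2) (lt_irrefl _),
      fun hh => absurd (h' g' hg' (hq.1.trans_le hh.1)) (not_le.2 hh.2)⟩

theorem measurableSet_gap (g : I) : MeasurableSet (gap G g) := by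
  have : gap G g = Ioi g ∩ ⋂ g' ∈ G, {q | g < g' → q < g'} := by
    ext q; simp [gap]
  rw [this]
  refine measurableSet_Ioi.inter (Finset.measurableSet_biInter _ fun g' _ => ?_)
  by_cases h : g < g'
  · simp only [h, forall_const]
    exact measurableSet_Iio
  · simp [h]

/-- Since `0 ∈ G`, a point outside `G` lies in exactly one gap, the one after the largest grid point
below it. -/
theorem sum_indicator_gap (h0 : (0 : I) ∈ G) (f : I → ℝ) (q : I) :
    ∑ g ∈ G, ({g} : Set I).indicator f q + ∑ g ∈ G, (gap G g).indicator f q = f q := by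
  classical
  by_cases hq : q ∈ G
  · rw [Finset.sum_eq_single_of_mem q hq, Finset.sum_eq_zero]
    · simp
    · exact fun g _ => indicator_of_notMem (fun h => lt_irrefl _ (h.2 q hq h.1)) _
    · exact fun g _ hgq => indicator_of_notMem (by simpa using hgq.symm) _
  · have hne : (G.filter fun g => g ≤ q).Nonempty :=
      ⟨0, Finset.mem_filter.2 ⟨h0, q.2.1⟩⟩
    set m := (G.filter fun g => g ≤ q).max' hne with hm
    obtain ⟨hmG, hmq⟩ := Finset.mem_filter.1 (Finset.max'_mem _ hne)
    rw [← hm] at hmG hmq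
    have hmax : ∀ g ∈ G, g ≤ q → g ≤ m := fun g hg hgq =>
      Finset.le_max' _ _ (Finset.mem_filter.2 ⟨hg, hgq⟩)
    have hmq' : m < q := lt_of_le_of_ne hmq fun h => hq (h ▸ hmG)
    rw [Finset.sum_eq_zero, Finset.sum_eq_single_of_mem m hmG]
    · rw [indicator_of_mem, zero_add]
      exact ⟨hmq', fun g' hg' hlt => by
        by_contra! hle
        exact absurd (hmax g' hg' hle) (not_le.2 hlt)⟩
    · intro g hg hgm
      refine indicator_of_notMem (fun h => ?_) _
      have := lt_of_le_of_ne (hmax g hg h.1.le) hgm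
      exact absurd (h.2 m hmG this) (not_lt.2 hmq)
    · intro g hg
      exact indicator_of_notMem (fun h => hq (by rw [mem_singleton_iff.1 h]; exact hg)) _

theorem integral_eq_sum_gap (h0 : (0 : I) ∈ G) (m : Measure I) {f : I → ℝ} (hf : Integrable f m) :
    ∫ q, f q ∂m = ∑ g ∈ G, m.real {g} * f g + ∑ g ∈ G, ∫ q in gap G g, f q ∂m := by
  have h1 : ∀ q, f q = _ := fun q => (sum_indicator_gap h0 f q).symm
  have e1 : ∀ g, Integrable (({g} : Set I).indicator f) m := fun g =>
    hf.indicator (measurableSet_singleton g)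
  have e2 : ∀ g, Integrable ((gap G g).indicator f) m := fun g =>
    hf.indicator (measurableSet_gap g)
  rw [integral_congr_ae (Filter.Eventually.of_forall h1), integral_add
    (integrable_finsetSum _ fun g _ => e1 g) (integrable_finsetSum _ fun g _ => e2 g),
    integral_finsetSum _ fun g _ => e1 g, integral_finsetSum _ fun g _ => e2 g]
  congr 1
  · refine Finset.sum_congr rfl fun g _ => ?_
    rw [integral_indicator (measurableSet_singleton g), integral_singleton, smul_eq_mul]
  · exact Finset.sum_congr rfl fun g _ => integral_indicator (measurableSet_gap g)

end Grid

/-! ### Spreading a Bayes-consistent strategy to a grid -/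

section Rounding

variable {ι : Type} [Fintype ι] [MeasurableSpace ι] [MeasurableSingletonClass ι]
  {prior : Measure ι} [IsProbabilityMeasure prior] {val : ι → I} {ρ : Kernel ι I}
  [IsMarkovKernel ρ]

theorem BayesConsistent.sum_eq (hb : BayesConsistent prior val ρ) {B : Set I}
    (hB : MeasurableSet B) (a : ℝ) :
    ∑ i, prior.real {i} * (ρ i).real B * ((val i : ℝ) - a) =
      ∫ q in B, ((q : ℝ) - a) ∂(ρ ∘ₘ prior) := by
  rw [integral_sub (integrable_coe_I _) (integrable_const a), ← hb B hB, setIntegral_const,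
    smul_eq_mul, measureReal_comp _ _ hB, ← integral_mul_const,
    integral_fintype Integrable.of_finite, integral_fintype Integrable.of_finite,
    ← Finset.sum_sub_distrib]
  refine Finset.sum_congr rfl fun i _ => ?_
  simp only [smul_eq_mul]; ring

/-- Qualities are grid points, so none lies inside a gap. The qualities that lead to posterior means
in the gap have a mean between its ends, so `exists_split` applies. -/
theorem exists_gap_split (hb : BayesConsistent prior val ρ) {G : Finset I} (hG : ∀ i, val i ∈ G)
    {g : I} (hg : g ∈ G) :
    ∃ c : ι → ℝ, (∀ i, c i ∈ Icc (0 : ℝ) 1) ∧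
      ∑ i, c i * (prior.real {i} * (ρ i).real (gap G g) * ((val i : ℝ) - g)) = 0 ∧
      ∑ i, (1 - c i) *
        (prior.real {i} * (ρ i).real (gap G g) * ((val i : ℝ) - nextPoint G g)) = 0 := by
  have hm := measurableSet_gap (G := G) g
  have hpos : 0 ≤ ∑ i, prior.real {i} * (ρ i).real (gap G g) * ((val i : ℝ) - g) := by
    rw [hb.sum_eq hm]
    exact setIntegral_nonneg hm fun q hq => sub_nonneg.2 hq.1.le
  rcases nextPoint_eq_or_lt (G := G) g with ⟨-, h⟩ | ⟨h, h'⟩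
  -- Beyond the last grid point there are no qualities. The sum is then both nonpositive and
  -- nonnegative, and all mass can go to `g`.
  · refine ⟨fun _ => 1, fun _ => by simp, ?_, by simp⟩
    simp only [one_mul]
    refine le_antisymm (Finset.sum_nonpos fun i _ => ?_) hpos
    have : (val i : ℝ) ≤ g := h _ (hG i)
    exact mul_nonpos_of_nonneg_of_nonpos (by positivity) (by linarith)
  · refine exists_split _ _ (fun i => by positivity) (fun i => ?_) hpos ?_
    · rcases le_or_gt (val i) g with hi | hi
      · exact Or.inl hi
      · exact Or.inr (h' _ (hG i) hi)
    · rw [hb.sum_eq hm]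
      exact setIntegral_nonpos hm fun q hq => sub_nonpos.2 (hq.2 _ (nextPoint_mem hg) h).le

/-- Every Bayes-consistent strategy can be spread to a finite grid containing all qualities so that
the mass at a posterior mean moves to adjacent grid points only. -/
theorem exists_grid_weights (hb : BayesConsistent prior val ρ) {G : Finset I}
    (hG : ∀ i, val i ∈ G) (h0 : (0 : I) ∈ G) :
    ∃ w : ι → I → ℝ, IsStrategyWeight prior val G w ∧ ∀ f h : I → ℝ,
      (∀ i, Integrable h (ρ i)) → Integrable h (ρ ∘ₘ prior) →
      (∀ᵐ q ∂(ρ ∘ₘ prior), ∀ g ∈ G, Adjacent G q g → h q ≤ f g) →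
      ∫ q, h q ∂(ρ ∘ₘ prior) ≤ ∑ i, prior.real {i} * ∑ g ∈ G, w i g * f g := by
  classical
  choose! c hc01 hc1 hc2 using fun g hg => exists_gap_split hb hG (g := g) hg
  -- Mass at a grid point stays, and mass in a gap is divided between its ends. The proportion `c g'
  -- i` depends on the gap and the quality, not on the posterior mean within the gap.
  let w : ι → I → ℝ := fun i g => if g ∈ G then (ρ i).real {g} + ∑ g' ∈ G, (ρ i).real (gap G g') *
    (c g' i * (if g = g' then 1 else 0) + (1 - c g' i) * (if g = nextPoint G g' then 1 else 0))
    else 0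
  have hsum : ∀ (f : I → ℝ) i, ∑ g ∈ G, w i g * f g =
      ∑ g ∈ G, (ρ i).real {g} * f g + ∑ g ∈ G, (ρ i).real (gap G g) *
        (c g i * f g + (1 - c g i) * f (nextPoint G g)) := by
    intro f i
    have e1 : ∀ g ∈ G, w i g * f g = (ρ i).real {g} * f g + ∑ g' ∈ G, (ρ i).real (gap G g') *
        (c g' i * (if g = g' then f g else 0) +
          (1 - c g' i) * (if g = nextPoint G g' then f g else 0)) := by
      intro g hg
      simp only [w, if_pos hg, add_mul, Finset.sum_mul]
      congr 1
      refine Finset.sum_congr rfl fun g' _ => ?_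
      split_ifs <;> ring
    rw [Finset.sum_congr rfl e1, Finset.sum_add_distrib, Finset.sum_comm]
    congr 1
    refine Finset.sum_congr rfl fun g' hg' => ?_
    rw [← Finset.mul_sum, Finset.sum_add_distrib, ← Finset.mul_sum, ← Finset.mul_sum,
      Finset.sum_ite_eq' G g', Finset.sum_ite_eq' G (nextPoint G g'), if_pos hg',
      if_pos (nextPoint_mem hg')]
  have hw0 : ∀ i g, 0 ≤ w i g := by
    intro i g
    simp only [w]
    split_ifs with hg
    · refine add_nonneg measureReal_nonneg (Finset.sum_nonneg fun g' hg' =>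
        mul_nonneg measureReal_nonneg (add_nonneg ?_ ?_))
      · exact mul_nonneg (hc01 g' hg' i).1 (by split_ifs <;> norm_num)
      · exact mul_nonneg (sub_nonneg.2 (hc01 g' hg' i).2) (by split_ifs <;> norm_num)
    · exact le_rfl
  have hw1 : ∀ i, ∑ g ∈ G, w i g = 1 := by
    intro i
    have h1 := hsum (fun _ => 1) i
    have h2 := integral_eq_sum_gap h0 (ρ i) (integrable_const (1 : ℝ))
    simp only [mul_one, integral_const, probReal_univ, smul_eq_mul,
      measureReal_restrict_apply_univ] at h1 h2
    refine h1.trans (Eq.trans ?_ h2.symm)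
    congr 1
    exact Finset.sum_congr rfl fun g _ => by ring
  refine ⟨w, ⟨hw0, fun i g => ?_, hw1, fun g hg => ?_⟩, fun f h hi hint hfh => ?_⟩
  · by_cases hg : g ∈ G
    · rw [← hw1 i]
      exact Finset.single_le_sum (fun g _ => hw0 i g) hg
    · simp [w, hg]
  -- The atom at `g` is balanced by Bayes consistency of `ρ`, and each share received from a gap by
  -- the choice of `c`.
  · have e1 : ∀ i, prior.real {i} * (w i g * ((val i : ℝ) - g)) =
        prior.real {i} * (ρ i).real {g} * ((val i : ℝ) - g) + ∑ g' ∈ G,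
          ((if g = g' then
              c g' i * (prior.real {i} * (ρ i).real (gap G g') * ((val i : ℝ) - g')) else 0) +
            (if g = nextPoint G g' then (1 - c g' i) *
              (prior.real {i} * (ρ i).real (gap G g') * ((val i : ℝ) - nextPoint G g'))
              else 0)) := by
      intro i
      simp only [w, if_pos hg, add_mul, Finset.sum_mul, mul_add, Finset.mul_sum]
      congr 1
      · ring
      · refine Finset.sum_congr rfl fun g' _ => ?_
        split_ifs with ha hb hb
        · subst ha; rw [← hb]; ring
        · subst ha; ring
        · rw [← hb]; ring
        · ring
    simp only [e1, Finset.sum_add_distrib]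
    rw [hb.sum_eq (measurableSet_singleton g), integral_singleton, sub_self, smul_zero, zero_add,
      Finset.sum_comm, Finset.sum_comm (s := Finset.univ)]
    rw [Finset.sum_eq_zero, Finset.sum_eq_zero, zero_add]
    · intro g' hg'
      split_ifs
      · exact hc2 g' hg'
      · simp
    · intro g' hg'
      split_ifs
      · exact hc1 g' hg'
      · simp
  · rw [integral_comp_measure hint]
    have h1 : ∑ i, prior.real {i} * ∑ g ∈ G, w i g * f g =
        ∫ i, ∑ g ∈ G, w i g * f g ∂prior := by
      rw [integral_fintype Integrable.of_finite]; rfl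
    rw [h1]
    refine integral_mono_ae Integrable.of_finite Integrable.of_finite ?_
    filter_upwards [Measure.ae_ae_of_ae_comp hfh] with i hae
    rw [hsum, integral_eq_sum_gap h0 _ (hi i)]
    refine add_le_add (Finset.sum_le_sum fun g hg => ?_) (Finset.sum_le_sum fun g hg => ?_)
    · rcases eq_or_ne (ρ i {g}) 0 with hz | hz
      · simp [measureReal_def, hz]
      · refine mul_le_mul_of_nonneg_left ?_ measureReal_nonneg
        -- As `g` carries an atom, the almost sure bound holds at `g` itself.
        have hfreq : ∃ᵐ q ∂(ρ i), q ∈ ({g} : Set I) := frequently_ae_mem_iff.2 hz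
        obtain ⟨q, hq, hq'⟩ := (hfreq.and_eventually hae).exists
        rw [mem_singleton_iff] at hq
        subst hq
        exact hq' q hg (adjacent_self q)
    · have h2 : ∫ q in gap G g, h q ∂(ρ i) ≤
          ∫ q in gap G g, (c g i * f g + (1 - c g i) * f (nextPoint G g)) ∂(ρ i) := by
        refine setIntegral_mono_on_ae (hi i).integrableOn (integrable_const _)
          (measurableSet_gap g) ?_
        filter_upwards [hae] with q hq hqg
        have h3 := hq g hg (adjacent_of_mem_gap hqg)
        have h4 := hq _ (nextPoint_mem hg) (adjacent_nextPoint_of_mem_gap hg hqg)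
        have h5 := hc01 g hg i
        nlinarith [mul_le_mul_of_nonneg_left h3 h5.1,
          mul_le_mul_of_nonneg_left h4 (sub_nonneg.2 h5.2)]
      rwa [setIntegral_const, smul_eq_mul] at h2

end Rounding

/-! ## The optimistic program -/

theorem mem_Icc_of_mem_priceGrid {U ε p : ℝ} (hU : 0 ≤ U) (hε : 0 < ε) (hp : p ∈ priceGrid U ε) :
    p ∈ Icc 0 U := by
  obtain ⟨k, -, rfl⟩ := Finset.mem_image.1 hp
  exact ⟨le_min (by positivity) hU, min_le_right _ _⟩

theorem priceGrid_nonempty {U ε : ℝ} (hU : 0 < U) (hε : 0 < ε) : (priceGrid U ε).Nonempty :=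
  Finset.image_nonempty.2 (Finset.nonempty_Icc.2 (Nat.one_le_iff_ne_zero.2
    (Nat.ceil_pos.2 (div_pos hU hε)).ne'))

section Program

variable {ι : Type} [Fintype ι] {v : I → I → ℝ} {U ε p : ℝ} {val : ι → I} {q g : I}

open Classical in
/-- The qualities, together with the end points of the sets of posterior means whose critical type
is a given grid type. -/
def programGrid (v : I → I → ℝ) (U ε : ℝ) (val : ι → I) (p : ℝ) : Finset I :=
  Finset.univ.image val ∪
    (((typeGrid v U ε val).filter fun x => {q : I | criticalType v p q = x}.Nonempty).image
      (fun x => sInf {q : I | criticalType v p q = x}) ∪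
    ((typeGrid v U ε val).filter fun x => {q : I | criticalType v p q = x}.Nonempty).image
      (fun x => sSup {q : I | criticalType v p q = x}))

theorem val_mem_programGrid (i : ι) : val i ∈ programGrid v U ε val p :=
  Finset.mem_union_left _ (Finset.mem_image_of_mem _ (Finset.mem_univ i))

theorem sInf_mem_programGrid (hq : criticalType v p q ∈ typeGrid v U ε val) :
    sInf {q' : I | criticalType v p q' = criticalType v p q} ∈ programGrid v U ε val p := by
  classical
  exact Finset.mem_union_right _ (Finset.mem_union_left _ (Finset.mem_image.2
    ⟨criticalType v p q, Finset.mem_filter.2 ⟨hq, ⟨q, rfl⟩⟩, rfl⟩))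

theorem sSup_mem_programGrid (hq : criticalType v p q ∈ typeGrid v U ε val) :
    sSup {q' : I | criticalType v p q' = criticalType v p q} ∈ programGrid v U ε val p := by
  classical
  exact Finset.mem_union_right _ (Finset.mem_union_right _ (Finset.mem_image.2
    ⟨criticalType v p q, Finset.mem_filter.2 ⟨hq, ⟨q, rfl⟩⟩, rfl⟩))

theorem criticalType_mem_typeGrid (hp : p ∈ priceGrid U ε) (i : ι) :
    criticalType v p (val i) ∈ typeGrid v U ε val :=
  Finset.mem_union_right _ (Finset.mem_image.2 ⟨(p, i), by simp [hp], rfl⟩)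

theorem criticalType_mem_of_mem_programGrid (hv : RegularValuation v) (hp : p ∈ priceGrid U ε)
    (hg : g ∈ programGrid v U ε val p) : criticalType v p g ∈ typeGrid v U ε val := by
  classical
  rcases Finset.mem_union.1 hg with h | h
  · obtain ⟨i, -, rfl⟩ := Finset.mem_image.1 h
    exact criticalType_mem_typeGrid hp i
  · rcases Finset.mem_union.1 h with h | h
    · obtain ⟨x, hx, rfl⟩ := Finset.mem_image.1 h
      obtain ⟨hx, hne⟩ := Finset.mem_filter.1 hx
      rw [show criticalType v p _ = x from (hv.isClosed_criticalType_eq p x).sInf_mem hne]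
      exact hx
    · obtain ⟨x, hx, rfl⟩ := Finset.mem_image.1 h
      obtain ⟨hx, hne⟩ := Finset.mem_filter.1 hx
      rw [show criticalType v p _ = x from (hv.isClosed_criticalType_eq p x).sSup_mem hne]
      exact hx

/-- Both end points of the level set containing `q` are grid points. An adjacent grid point cannot
lie beyond them, and the critical type is antitone. -/
theorem criticalType_eq_of_adjacent (hv : RegularValuation v)
    (hq : criticalType v p q ∈ typeGrid v U ε val)
    (hqg : Adjacent (programGrid v U ε val p) q g) : criticalType v p g = criticalType v p q := by
  have hc := hv.isClosed_criticalType_eq p (criticalType v p q)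
  have hne : {q' : I | criticalType v p q' = criticalType v p q}.Nonempty := ⟨q, rfl⟩
  have h1 := hqg _ (sInf_mem_programGrid hq)
  have h2 := hqg _ (sSup_mem_programGrid hq)
  have h3 : sInf {q' : I | criticalType v p q' = criticalType v p q} ≤ q := sInf_le rfl
  have h4 : q ≤ sSup {q' : I | criticalType v p q' = criticalType v p q} := le_sSup rfl
  have h5 := not_lt.1 fun h => h1.1 ⟨h, h3⟩
  have h6 := not_lt.1 fun h => h2.2 ⟨h4, h⟩
  refine le_antisymm ?_ ?_
  · exact (hv.criticalType_antitone h5).trans (hc.sInf_mem hne).le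
  · exact (hc.sSup_mem hne).ge.trans (hv.criticalType_antitone h6)

variable [MeasurableSpace ι] [MeasurableSingletonClass ι] {prior : Measure ι}

theorem programFeasible_weightKernel (hv : RegularValuation v) (hp : p ∈ priceGrid U ε)
    [IsProbabilityMeasure prior] {w : ι → I → ℝ}
    (hw : IsStrategyWeight prior val (programGrid v U ε val p) w) :
    ProgramFeasible prior val v U ε p (weightKernel (programGrid v U ε val p) w) :=
  ⟨hp, hw.isMarkovKernel, hw.bayesConsistent, fun i =>
    IsStrategyWeight.weightKernel_compl (A := {q | criticalType v p q ∈ typeGrid v U ε val})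
      (fun _ hg => criticalType_mem_of_mem_programGrid hv hp hg) i⟩

omit [MeasurableSingletonClass ι] in
open Classical in
theorem isStrategyWeight_fullInformation {G : Finset I} (hG : ∀ i, val i ∈ G) :
    IsStrategyWeight prior val G fun i g => if g = val i then 1 else 0 where
  nonneg i g := by split_ifs <;> norm_num
  le_one i g := by split_ifs <;> norm_num
  sum_eq_one i := by simp [hG]
  balanced g _ := by
    refine Finset.sum_eq_zero fun i _ => ?_
    split_ifs with h <;> simp [h]

omit [MeasurableSingletonClass ι] in
theorem isCompact_strategyWeights (prior : Measure ι) (val : ι → I) (G : Finset I) :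
    IsCompact {w : ι → I → ℝ | IsStrategyWeight prior val G w} := by
  have h1 : IsCompact (univ.pi fun _ : ι => univ.pi fun _ : I => Icc (0 : ℝ) 1) :=
    isCompact_univ_pi fun _ => isCompact_univ_pi fun _ => isCompact_Icc
  refine h1.of_isClosed_subset ?_ fun w hw i _ g _ => ⟨hw.nonneg i g, hw.le_one i g⟩
  have h2 : {w : ι → I → ℝ | IsStrategyWeight prior val G w} =
      (⋂ i, ⋂ g, {w | 0 ≤ w i g}) ∩ (⋂ i, ⋂ g, {w | w i g ≤ 1}) ∩
      (⋂ i, {w | ∑ g ∈ G, w i g = 1}) ∩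
      ⋂ g ∈ G, {w | ∑ i, prior.real {i} * (w i g * ((val i : ℝ) - g)) = 0} := by
    ext w
    simp only [mem_inter_iff, mem_iInter]
    exact ⟨fun h => ⟨⟨⟨h.1, h.2⟩, h.3⟩, h.4⟩, fun h => ⟨h.1.1.1, h.1.1.2, h.1.2, h.2⟩⟩
  rw [h2]
  refine (((isClosed_iInter fun i => isClosed_iInter fun g => ?_).inter
    (isClosed_iInter fun i => isClosed_iInter fun g => ?_)).inter
    (isClosed_iInter fun i => ?_)).inter (isClosed_biInter fun g _ => ?_)
  · exact isClosed_le (by fun_prop) (by fun_prop)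
  · exact isClosed_le (by fun_prop) (by fun_prop)
  · exact isClosed_eq (by fun_prop) (by fun_prop)
  · exact isClosed_eq (by fun_prop) (by fun_prop)

variable [IsProbabilityMeasure prior]

theorem integrable_demand (hv : RegularValuation v) {f : I → ℝ} (hf : Antitone f)
    (hf01 : ∀ x, f x ∈ Icc (0 : ℝ) 1) (m : Measure I) [IsFiniteMeasure m] :
    Integrable (fun q => f (criticalType v p q)) m :=
  Integrable.of_mem_Icc 0 1 (hf.measurable.comp (hv.measurable_criticalType_right p)).aemeasurable
    (Filter.Eventually.of_forall fun _ => hf01 _)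

omit [MeasurableSingletonClass ι] [IsProbabilityMeasure prior] in
theorem ae_mem_typeGrid (hv : RegularValuation v) {ρ : Kernel ι I}
    (hρ : ProgramFeasible prior val v U ε p ρ) :
    ∀ᵐ q ∂(ρ ∘ₘ prior), criticalType v p q ∈ typeGrid v U ε val := by
  refine Measure.ae_comp_of_ae_ae ?_ (Filter.Eventually.of_forall fun i => ?_)
  · exact hv.measurable_criticalType_right p (typeGrid v U ε val).measurableSet
  · rw [ae_iff]; exact hρ.2.2.2 i

/-- Spreading a feasible strategy to `programGrid` leaves critical types, hence the objective,
unchanged. It remains to maximize a linear function over a compact set of weights, nonempty by full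
information. -/
theorem exists_program_maximizer_of_price (hv : RegularValuation v) (h0 : ∃ i, val i = 0)
    (hp : p ∈ priceGrid U ε) {f : I → ℝ} (hf : Antitone f) (hf01 : ∀ x, f x ∈ Icc (0 : ℝ) 1) :
    ∃ ρ, ProgramFeasible prior val v U ε p ρ ∧ ∀ ρ', ProgramFeasible prior val v U ε p ρ' →
      ∫ q, f (criticalType v p q) ∂(ρ' ∘ₘ prior) ≤
        ∫ q, f (criticalType v p q) ∂(ρ ∘ₘ prior) := by
  set G := programGrid v U ε val p with hG
  have hGv : ∀ i, val i ∈ G := val_mem_programGrid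
  have h0G : (0 : I) ∈ G := by obtain ⟨i, hi⟩ := h0; exact hi ▸ hGv i
  have hfm : Measurable fun q => f (criticalType v p q) :=
    hf.measurable.comp (hv.measurable_criticalType_right p)
  obtain ⟨w, hw, hmax⟩ := (isCompact_strategyWeights prior val G).exists_isMaxOn
    ⟨_, isStrategyWeight_fullInformation hGv⟩
    (f := fun w => ∑ i, prior.real {i} * ∑ g ∈ G, w i g * f (criticalType v p g))
    (Continuous.continuousOn (by fun_prop))
  refine ⟨weightKernel G w, programFeasible_weightKernel hv hp hw, fun ρ' hρ' => ?_⟩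
  have hM := hρ'.2.1
  obtain ⟨w', hw', hle⟩ := exists_grid_weights hρ'.2.2.1 hGv h0G
  have h1 := hle (fun q => f (criticalType v p q)) (fun q => f (criticalType v p q))
    (fun i => integrable_demand hv hf hf01 _) (integrable_demand hv hf hf01 _) (by
      filter_upwards [ae_mem_typeGrid hv hρ'] with q hq g _ hqg
      rw [criticalType_eq_of_adjacent hv hq hqg])
  have h2 : ∑ i, prior.real {i} * ∑ g ∈ G, w' i g * f (criticalType v p g) ≤
      ∑ i, prior.real {i} * ∑ g ∈ G, w i g * f (criticalType v p g) := hmax hw'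
  refine h1.trans (h2.trans (hw.integral_comp (c := 1) hfm fun q => ?_).ge)
  exact ⟨by linarith [(hf01 (criticalType v p q)).1], (hf01 _).2⟩

theorem exists_program_maximizer (hv : RegularValuation v) (hU : 0 < U) (hε : 0 < ε)
    (h0 : ∃ i, val i = 0) {f : I → ℝ} (hf : Antitone f) (hf01 : ∀ x, f x ∈ Icc (0 : ℝ) 1) :
    ∃ p ρ, ProgramFeasible prior val v U ε p ρ ∧ ∀ p' ρ', ProgramFeasible prior val v U ε p' ρ' →
      p' * ∫ q, f (criticalType v p' q) ∂(ρ' ∘ₘ prior) ≤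
        p * ∫ q, f (criticalType v p q) ∂(ρ ∘ₘ prior) := by
  choose! r hr hrmax using fun p hp =>
    exists_program_maximizer_of_price (prior := prior) (p := p) hv h0 hp hf hf01
  obtain ⟨p, hp, hmax⟩ := (priceGrid U ε).exists_max_image
    (fun p => p * ∫ q, f (criticalType v p q) ∂(r p ∘ₘ prior)) (priceGrid_nonempty hU hε)
  exact ⟨p, r p, hr p hp, fun p' ρ' hρ' => (mul_le_mul_of_nonneg_left (hrmax p' hρ'.1 ρ' hρ')
    (mem_Icc_of_mem_priceGrid hU.le hε hρ'.1).1).trans (hmax p' hρ'.1)⟩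

/-- The witness is one step below `p` rounded down to a multiple of `ε`. Rounding down alone would
not guarantee a cut of `ε`, which must pay for the spreading of posterior means. -/
theorem exists_priceGrid_mem (hε : 0 < ε) (hp : 2 * ε < p) (hpU : p ≤ U) :
    ∃ p' ∈ priceGrid U ε, p' + ε ≤ p ∧ p < p' + 2 * ε := by
  have h1 : 2 ≤ ⌊p / ε⌋₊ := Nat.le_floor (by rw [le_div_iff₀ hε]; exact_mod_cast hp.le)
  obtain ⟨k, hk⟩ : ∃ k, ⌊p / ε⌋₊ = k + 1 := ⟨⌊p / ε⌋₊ - 1, by omega⟩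
  have h2 : ((k + 1 : ℕ) : ℝ) ≤ p / ε := by
    rw [← hk]; exact Nat.floor_le (div_nonneg (by linarith) hε.le)
  have h3 : p / ε < ((k + 1 : ℕ) : ℝ) + 1 := by rw [← hk]; exact Nat.lt_floor_add_one _
  rw [le_div_iff₀ hε] at h2
  rw [div_lt_iff₀ hε] at h3
  push_cast at h2 h3
  have hkU : (k : ℝ) * ε ≤ U := by linarith
  refine ⟨k * ε, Finset.mem_image.2 ⟨k, Finset.mem_Icc.2 ⟨by omega, ?_⟩, min_eq_left hkU⟩,
    by linarith, by linarith⟩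
  have h4 : (k : ℝ) ≤ U / ε := by rwa [le_div_iff₀ hε]
  exact_mod_cast h4.trans (Nat.le_ceil _)

omit [MeasurableSpace ι] [MeasurableSingletonClass ι] in
theorem grid_mem_typeGrid (hε : 0 < ε) {k : ℕ} {s : I} (hs : (s : ℝ) = k * ε) :
    s ∈ typeGrid v U ε val := by
  refine Finset.mem_union_left _ (Finset.mem_image.2 ⟨k, Finset.mem_range.2 ?_, ?_⟩)
  · have h : (k : ℝ) ≤ 1 / ε := by rw [le_div_iff₀ hε, ← hs]; exact s.2.2
    have : k ≤ ⌈1 / ε⌉₊ := by exact_mod_cast h.trans (Nat.le_ceil _)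
    omega
  · rw [← hs]; exact projIcc_val _ s

omit [MeasurableSpace ι] [MeasurableSingletonClass ι] in
/-- Grid points adjacent to a posterior mean have a critical type that is larger by less than
`ε`. -/
theorem criticalType_le_of_adjacent (hv : RegularValuation v) (hε : 0 < ε)
    (hg : Adjacent (programGrid v U ε val p) q g) {x : I} (hx : x < 1)
    (hqx : (criticalType v p q : ℝ) ≤ max 0 ((x : ℝ) - ε)) : criticalType v p g ≤ x := by
  by_contra! hlt
  set y := criticalType v p q with hy
  -- The multiple `k * ε` is `y` rounded up. The slack `ε` in the hypothesis keeps it below `x`; for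
  -- `y = 0` it is `0`.
  set k := ⌈(y : ℝ) / ε⌉₊ with hk
  have hky : (y : ℝ) ≤ k * ε := by rw [← div_le_iff₀ hε]; exact Nat.le_ceil _
  have hkx : (k : ℝ) * ε ≤ x := by
    rcases (y.2.1 : (0 : ℝ) ≤ y).lt_or_eq with h | h
    · have h1 : (y : ℝ) ≤ x - ε := (le_max_iff.1 hqx).resolve_left (not_le.2 h)
      have h2 : (k : ℝ) < y / ε + 1 := Nat.ceil_lt_add_one (div_nonneg y.2.1 hε.le)
      rw [div_add_one hε.ne', lt_div_iff₀ hε] at h2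
      linarith
    · have : k = 0 := by rw [hk, ← h]; simp
      rw [this]; simpa using x.2.1
  let s : I := ⟨k * ε, by positivity, hkx.trans x.2.2⟩
  have hsS : s ∈ typeGrid v U ε val := grid_mem_typeGrid hε rfl
  have hsx : s ≤ x := hkx
  have hs1 : s < 1 := hsx.trans_lt hx
  have hys : y ≤ s := hky
  have hcl : IsClosed {q' : I | criticalType v p q' ≤ s} := by
    simp only [hv.criticalType_le_iff hs1]
    exact isClosed_le continuous_const (hv.continuous_quality s)
  -- `z` is the least posterior mean with critical type at most `s`. If `g < z`, continuity forces
  -- critical type exactly `s` at `z`, so `z` is a grid point separating `g` from `q`, against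
  -- adjacency.
  set z := sInf {q' : I | criticalType v p q' ≤ s} with hz
  have hzs : criticalType v p z ≤ s := hcl.sInf_mem ⟨q, hys⟩
  have hzq : z ≤ q := sInf_le hys
  have hgz : g < z := by
    by_contra! h
    exact absurd ((hv.criticalType_antitone h).trans (hzs.trans hsx)) (not_le.2 hlt)
  have hzG : z ∈ programGrid v U ε val p := by
    have hz0 : 0 < z := lt_of_le_of_lt g.2.1 hgz
    have hzeq : criticalType v p z = s := by
      have h1 : p ≤ v s z := (hv.criticalType_le_iff hs1).1 hzs
      rcases h1.lt_or_eq with h | h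
      · obtain ⟨l, hl, hls⟩ := exists_Ioc_subset_of_mem_nhds
          ((isOpen_lt continuous_const (hv.continuous_quality s)).mem_nhds h) ⟨0, hz0⟩
        obtain ⟨m, hlm, hmz⟩ := exists_between hl
        have h2 : p < v s m := hls ⟨hlm, hmz.le⟩
        exact absurd (sInf_le (criticalType_le h2.le) : z ≤ m) (not_le.2 hmz)
      · rw [h, hv.criticalType_valuation]
    have h3 : sInf {q' : I | criticalType v p q' = criticalType v p z} = z :=
      IsLeast.csInf_eq ⟨rfl, fun q' hq' => sInf_le (show criticalType v p q' ≤ s from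
        (show criticalType v p q' = criticalType v p z from hq').le.trans hzs)⟩
    rw [← h3]
    exact sInf_mem_programGrid (hzeq ▸ hsS)
  exact (hg z hzG).1 ⟨hgz, hzq⟩

/-- The price falls by at least `ε` and less than `2ε`. The drop in critical types absorbs the
effect of spreading (`criticalType_le_of_adjacent`), so no demand is lost, only less than `2ε` per
sale. -/
theorem exists_programFeasible_rev_le (hv : RegularValuation v) (hU : 0 < U) (hε : 0 < ε)
    (h0 : ∃ i, val i = 0) {F : Measure I} [IsProbabilityMeasure F] (hF : F {1} = 0)
    (hp : p ∈ Icc 0 U) {ρ : Kernel ι I} [IsMarkovKernel ρ] (hb : BayesConsistent prior val ρ) :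
    ∃ p' ρ', ProgramFeasible prior val v U ε p' ρ' ∧ rev prior F v p ρ ≤
      p' * ∫ q, F.real (Ici (criticalType v p' q)) ∂(ρ' ∘ₘ prior) + 2 * ε := by
  have hD : Antitone fun x : I => F.real (Ici x) :=
    fun _ _ h => measureReal_mono (Ici_subset_Ici.2 h)
  have hD01 : ∀ x : I, F.real (Ici x) ∈ Icc (0 : ℝ) 1 := fun x =>
    ⟨measureReal_nonneg, measureReal_le_one⟩
  rcases le_or_gt p (2 * ε) with hpε | hpε
  · obtain ⟨p', hp'⟩ := priceGrid_nonempty hU hε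
    refine ⟨p', _, programFeasible_weightKernel hv hp'
      (isStrategyWeight_fullInformation val_mem_programGrid), (rev_le hp.1).trans (hpε.trans
        (le_add_of_nonneg_left (mul_nonneg (mem_Icc_of_mem_priceGrid hU.le hε hp').1
          (integral_nonneg fun _ => measureReal_nonneg))))⟩
  · obtain ⟨p', hp', hpp', hp'p⟩ := exists_priceGrid_mem hε hpε hp.2
    set G := programGrid v U ε val p' with hG
    have hGv : ∀ i, val i ∈ G := val_mem_programGrid
    have h0G : (0 : I) ∈ G := by obtain ⟨i, hi⟩ := h0; exact hi ▸ hGv i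
    obtain ⟨w, hw, hle⟩ := exists_grid_weights hb hGv h0G
    refine ⟨p', _, programFeasible_weightKernel hv hp' hw, ?_⟩
    have h1 := hle (fun q => F.real (Ici (criticalType v p' q)))
      (fun q => F.real (Ici (criticalType v p q)))
      (fun i => integrable_demand hv hD hD01 _) (integrable_demand hv hD hD01 _)
      (Filter.Eventually.of_forall fun q g _ hqg => by
        refine hD ?_
        rcases (unitInterval.le_one' : criticalType v p q ≤ 1).lt_or_eq with h | h
        · exact criticalType_le_of_adjacent hv hε hqg h (hv.criticalType_sub_le hε.le hpp' h)
        · rw [h]; exact unitInterval.le_one')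
    rw [← hw.integral_comp (f := fun q => F.real (Ici (criticalType v p' q))) (c := 1)
      (hD.measurable.comp (hv.measurable_criticalType_right p'))
      fun q => ⟨by linarith [(hD01 (criticalType v p' q)).1], (hD01 _).2⟩] at h1
    have h2 : ∫ q, F.real (Ici (criticalType v p q)) ∂(ρ ∘ₘ prior) ≤ 1 := by
      have h := integral_mono (integrable_demand (p := p) hv hD hD01 (ρ ∘ₘ prior))
        (integrable_const 1) fun q => (hD01 _).2
      simpa using h
    have h3 : 0 ≤ ∫ q, F.real (Ici (criticalType v p q)) ∂(ρ ∘ₘ prior) :=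
      integral_nonneg fun _ => measureReal_nonneg
    have h4 := (mem_Icc_of_mem_priceGrid hU.le hε hp').1
    simp only [rev, hv.measureReal_purchase hF]
    nlinarith [mul_le_mul_of_nonneg_left h1 h4]

end Program

/-! ## Upper confidence bounds -/

section UpperConfidence

/-- Number of the first `t` rounds with critical type `x` and a purchase. -/
def purchases {t : ℕ} (d : Fin t → I × Bool) (x : I) : ℕ :=
  (Finset.univ.filter fun s => (d s).1 = x ∧ (d s).2 = true).card

/-- The counts on which the upper confidence bounds depend. -/
def counts (S : Finset I) {t : ℕ} (d : Fin t → I × Bool) : S → ℕ × ℕ :=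
  fun x => (visits d x, purchases d x)

/-- The confidence radius after `n` visits. -/
def radius (T n : ℕ) : ℝ := √(16 * Real.log T / n) + √((1 + n) * Real.log (1 + n)) / n

theorem radius_nonneg (T n : ℕ) : 0 ≤ radius T n := by unfold radius; positivity

variable {S : Finset I} {T t : ℕ} {d d' : Fin t → I × Bool}

theorem empDemand_eq (d : Fin t → I × Bool) (x : I) :
    empDemand d x = (purchases d x : ℝ) / visits d x := rfl

theorem ucbDemand_eq (d : Fin t → I × Bool) (x : I) : ucbDemand S T d x =
    (S.filter fun x' => x' ≤ x).fold min 1 fun x' => empDemand d x' + radius T (visits d x') := by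
  simp only [ucbDemand, radius, add_assoc]

theorem le_ucbDemand_iff {x : I} {c : ℝ} : c ≤ ucbDemand S T d x ↔
    c ≤ 1 ∧ ∀ x' ∈ S, x' ≤ x → c ≤ empDemand d x' + radius T (visits d x') := by
  rw [ucbDemand_eq, Finset.le_fold_min]
  simp only [Finset.mem_filter, and_imp]

theorem ucbDemand_le {x : I} (hx : x ∈ S) :
    ucbDemand S T d x ≤ empDemand d x + radius T (visits d x) :=
  (le_ucbDemand_iff.1 le_rfl).2 x hx le_rfl

theorem ucbDemand_antitone : Antitone (ucbDemand S T d) := fun _ _ h =>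
  le_ucbDemand_iff.2 ⟨(le_ucbDemand_iff.1 le_rfl).1, fun x' hx' hle =>
    (le_ucbDemand_iff.1 le_rfl).2 x' hx' (hle.trans h)⟩

theorem ucbDemand_mem_Icc (x : I) : ucbDemand S T d x ∈ Icc (0 : ℝ) 1 :=
  ⟨le_ucbDemand_iff.2 ⟨zero_le_one, fun x' _ _ => add_nonneg
    (by rw [empDemand_eq]; positivity) (radius_nonneg _ _)⟩, (le_ucbDemand_iff.1 le_rfl).1⟩

/-- The history enters the program only through `counts`, which take countably many values. Choosing
one maximizer per value therefore gives a measurable policy. -/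
theorem ucbDemand_congr (h : counts S d = counts S d') : ucbDemand S T d = ucbDemand S T d' := by
  funext x
  rw [ucbDemand_eq, ucbDemand_eq]
  refine Finset.fold_congr fun x' hx' => ?_
  have h1 := congrFun h ⟨x', (Finset.mem_filter.1 hx').1⟩
  simp only [counts, Prod.mk.injEq] at h1
  rw [empDemand_eq, empDemand_eq, h1.1, h1.2]

theorem measurable_visits (x : I) : Measurable fun d : Fin t → I × Bool => visits d x := by
  simp only [visits, Finset.card_filter]
  refine Finset.measurable_fun_sum _ fun s _ => Measurable.ite ?_ measurable_const measurable_const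
  exact (measurable_fst.comp (measurable_pi_apply s)) (measurableSet_singleton x)

theorem measurable_purchases (x : I) : Measurable fun d : Fin t → I × Bool => purchases d x := by
  simp only [purchases, Finset.card_filter]
  refine Finset.measurable_fun_sum _ fun s _ => Measurable.ite ?_ measurable_const measurable_const
  exact ((measurable_fst.comp (measurable_pi_apply s)) (measurableSet_singleton x)).inter
    ((measurable_snd.comp (measurable_pi_apply s)) (measurableSet_singleton true))

theorem measurable_counts (S : Finset I) : Measurable fun d : Fin t → I × Bool => counts S d :=
  measurable_pi_lambda _ fun x => (measurable_visits (x : I)).prodMk (measurable_purchases (x : I))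

end UpperConfidence

/-! ## Existence of runs of the algorithm -/

/-- The critical types and purchases of the past rounds, for a given sequence of price rules. -/
def pastData (v : I → I → ℝ) (price : (t : ℕ) → (Fin t → Obs) → ℝ) {t : ℕ} (h : Fin t → Obs) :
    Fin t → I × Bool :=
  fun s => (criticalType v (price s fun r => h (Fin.castLE s.2.le r)) (h s).2.1, (h s).2.2)

theorem measurable_pastData {v : I → I → ℝ} (hv : RegularValuation v)
    {price : (t : ℕ) → (Fin t → Obs) → ℝ} {t : ℕ} (hp : ∀ s < t, Measurable (price s)) :
    Measurable fun h : Fin t → Obs => pastData v price h := by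
  refine measurable_pi_lambda _ fun s => Measurable.prodMk ?_ (by fun_prop)
  refine hv.measurable_criticalType.comp (Measurable.prodMk ?_ (by fun_prop))
  exact (hp s s.2).comp (measurable_pi_lambda _ fun r => measurable_pi_apply _)

/-- The price rule obtained from a rule that depends on past critical types and purchases. -/
def recursivePrice (v : I → I → ℝ) (P : (t : ℕ) → (Fin t → I × Bool) → ℝ) :
    (t : ℕ) → (Fin t → Obs) → ℝ
  | t, h => P t fun s =>
      (criticalType v (recursivePrice v P s fun r => h (Fin.castLE s.2.le r)) (h s).2.1, (h s).2.2)
termination_by t => t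
decreasing_by exact s.2

theorem recursivePrice_eq (v : I → I → ℝ) (P : (t : ℕ) → (Fin t → I × Bool) → ℝ) (t : ℕ)
    (h : Fin t → Obs) :
    recursivePrice v P t h = P t (pastData v (recursivePrice v P) h) := by
  rw [recursivePrice]; rfl

section AlgorithmOne

variable {ι : Type} [Fintype ι] [MeasurableSpace ι] [MeasurableSingletonClass ι]
  {prior : Measure ι} [IsProbabilityMeasure prior] {val : ι → I} {v : I → I → ℝ} {U ε : ℝ}

theorem exists_algorithmOneDecision (hv : RegularValuation v) (hU : 0 < U) (hε : 0 < ε)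
    (h0 : ∃ i, val i = 0) (hm : ∀ θ, v θ (priorMean prior val) ∈ Icc 0 U) (T : ℕ)
    (e : Fin (typeGrid v U ε val).card ≃ typeGrid v U ε val) (t : ℕ)
    (c : typeGrid v U ε val → ℕ × ℕ) :
    ∃ (p : ℝ) (ρ : Kernel ι I), p ∈ Icc 0 U ∧ IsMarkovKernel ρ ∧ BayesConsistent prior val ρ ∧
      ∀ d : Fin t → I × Bool, counts _ d = c →
        AlgorithmOneDecision prior val v U ε T e d p ρ := by
  rcases lt_or_ge t (typeGrid v U ε val).card with ht | ht
  · refine ⟨v (e ⟨t, ht⟩) (priorMean prior val), _, hm _, inferInstance,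
      bayesConsistent_const_dirac, fun d _ => ⟨fun _ => ⟨?_, rfl⟩, fun h => ?_⟩⟩
    · exact hv.criticalType_valuation _ _
    · exact absurd ht (not_lt.2 h)
  · have key : ∀ d : Fin t → I × Bool, ∃ (p : ℝ) (ρ : Kernel ι I), p ∈ Icc 0 U ∧
        IsMarkovKernel ρ ∧ BayesConsistent prior val ρ ∧
          ∀ d' : Fin t → I × Bool, counts (typeGrid v U ε val) d' = counts _ d →
            AlgorithmOneDecision prior val v U ε T e d' p ρ := by
      intro d
      obtain ⟨p, ρ, hρ, hmax⟩ := exists_program_maximizer (prior := prior) hv hU hε h0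
        (ucbDemand_antitone (S := typeGrid v U ε val) (T := T) (d := d)) ucbDemand_mem_Icc
      refine ⟨p, ρ, mem_Icc_of_mem_priceGrid hU.le hε hρ.1, hρ.2.1, hρ.2.2.1, fun d' hd' =>
        ⟨fun h => absurd h (not_lt.2 ht), fun _ => ⟨hρ, fun p' ρ' hρ' => ?_⟩⟩⟩
      rw [ucbRevenue, ucbRevenue, ucbDemand_congr hd']
      exact hmax p' ρ' hρ'
    by_cases h : ∃ d : Fin t → I × Bool, counts _ d = c
    · obtain ⟨d, rfl⟩ := h
      exact key d
    -- No data have these counts, so any feasible pair will do; it is taken from arbitrary data.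
    · obtain ⟨p, ρ, h1, h2, h3, -⟩ := key fun _ => (0, false)
      exact ⟨p, ρ, h1, h2, h3, fun d hd => absurd ⟨d, hd⟩ h⟩

end AlgorithmOne

/-- The cell `{0}` puts `0` among the pooled qualities, hence into the grids, as
`exists_grid_weights` requires. -/
theorem pooledQuality_zero (μ : Measure I) {δ : ℝ} (hδ : 0 < δ) : pooledQuality μ δ 0 = 0 := by
  have h : cell δ ⁻¹' {0} = {0} := by
    ext ω
    rw [mem_preimage, mem_singleton_iff, mem_singleton_iff, Fin.ext_iff, cell_val hδ, Fin.val_zero,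
      Nat.ceil_eq_zero, div_nonpos_iff]
    constructor
    · rintro (h | h)
      · exact absurd h.2 (not_le.2 hδ)
      · exact Subtype.ext (le_antisymm h.1 ω.2.1)
    · rintro rfl
      exact Or.inr ⟨by simp, hδ.le⟩
  have h2 : ⨍ ω in ({0} : Set I), (ω : ℝ) ∂μ = 0 := by
    rw [setAverage_eq, integral_singleton]; simp
  rw [pooledQuality, h, h2]
  exact projIcc_left (a := (0 : ℝ)) (b := 1) zero_le_one

theorem exists_isAlgorithmTwo {v : I → I → ℝ} (hv : RegularValuation v) {U : ℝ}
    (μ : Measure I) [IsProbabilityMeasure μ] (hm : ∀ θ, v θ (priorMean μ id) ∈ Icc 0 U)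
    {ε δ : ℝ} (hε : 0 < ε) (hδ : 0 < δ) (T : ℕ) :
    ∃ π : Policy μ U, IsAlgorithmTwo v ε δ T π := by
  have hU : 0 < U := (hm 0).1.trans_lt ((hv.strictMono_type _ (zero_lt_one : (0 : I) < 1)).trans_le
    (hm 1).2)
  have hm' : ∀ θ, v θ (priorMean (pooledPrior μ δ) (pooledQuality μ δ)) ∈ Icc 0 U := by
    rw [priorMean_pooled]; exact hm
  set S := typeGrid v U ε (pooledQuality μ δ) with hS
  let e : Fin S.card ≃ S := S.equivFin.symm
  choose P R hP hRm hRb hPR using fun (t : ℕ) (c : S → ℕ × ℕ) => exists_algorithmOneDecision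
    hv hU hε ⟨0, pooledQuality_zero μ hδ⟩ hm' T e t c
  let price := recursivePrice v fun t d => P t (counts S d)
  have hprice : ∀ t h, price t h = P t (counts S (pastData v price h)) := fun t h =>
    recursivePrice_eq _ _ t h
  have hmeas : ∀ t, Measurable (price t) := by
    intro t
    induction t using Nat.strong_induction_on with
    -- The data in round `t` involve earlier prices, so measurability is proved by strong induction.
    | _ t ih =>
      rw [show price t = _ from funext (hprice t)]
      exact (measurable_of_countable (P t)).comp
        ((measurable_counts S).comp (measurable_pastData hv ih))
  have hcounts : ∀ t, Measurable fun h : Fin t → Obs => counts S (pastData v price h) := fun t =>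
    (measurable_counts S).comp (measurable_pastData hv fun s _ => hmeas s)
  let base : ∀ t, Kernel ((S → ℕ × ℕ) × Fin (⌈1 / δ⌉₊ + 1)) I := fun t =>
    ⟨fun x => R t x.1 x.2, measurable_of_countable _⟩
  let arg : ∀ t, (Fin t → Obs) × I → (S → ℕ × ℕ) × Fin (⌈1 / δ⌉₊ + 1) := fun t x =>
    (counts S (pastData v price x.1), cell δ x.2)
  have harg : ∀ t, Measurable (arg t) := fun t =>
    ((hcounts t).comp measurable_fst).prodMk ((measurable_cell δ).comp measurable_snd)
  let adv : ∀ t, Kernel ((Fin t → Obs) × I) I := fun t => (base t).comap (arg t) (harg t)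
  have hadv : ∀ t h ω, (adv t).sectR h ω = R t (counts S (pastData v price h)) (cell δ ω) :=
    fun _ _ _ => rfl
  let π : Policy μ U :=
    { price := price
      adv := adv
      measurable_price := hmeas
      price_mem := fun t h => by rw [hprice]; exact hP t _
      markov := fun t => ⟨fun x => (hRm t _).isProbabilityMeasure _⟩
      feasible := fun t h => bayesConsistent_comap_cell μ δ (hadv t h) (hRb t _) }
  refine ⟨π, e, fun t h => ⟨R t (counts S (pastData v price h)), ?_, hadv t h⟩⟩
  have h1 := hPR t (counts S (pastData v price h)) (pastData v price h) rfl
  rw [← hprice] at h1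
  exact h1

/-! ## The law of the repeated game -/

section RoundLaw

variable {μ F : Measure I} [IsProbabilityMeasure μ] [IsProbabilityMeasure F] {v : I → I → ℝ}
  {p : ℝ} {ρ : Kernel I I} [IsMarkovKernel ρ]

theorem measurable_outcome (hv : RegularValuation v) :
    Measurable fun x : ℝ × ((I × I) × I) =>
      ((x.2.1.1, x.2.1.2, decide (x.1 ≤ v x.2.2 x.2.1.2)) : Obs) := by
  have hm : Measurable fun x : ℝ × ((I × I) × I) => v x.2.2 x.2.1.2 :=
    hv.continuous_uncurry.measurable.comp
      (by fun_prop : Measurable fun x : ℝ × ((I × I) × I) => (x.2.2, x.2.1.2))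
  refine Measurable.prodMk (by fun_prop) (Measurable.prodMk (by fun_prop) ?_)
  refine measurable_to_bool ?_
  convert measurableSet_le measurable_fst hm using 1
  ext x; simp

theorem measurable_outcome_of_price (hv : RegularValuation v) (p : ℝ) :
    Measurable fun x : (I × I) × I => ((x.1.1, x.1.2, decide (p ≤ v x.2 x.1.2)) : Obs) :=
  (measurable_outcome hv).comp (by fun_prop : Measurable fun x : (I × I) × I => (p, x))

theorem isProbabilityMeasure_roundLaw (hv : RegularValuation v) :
    IsProbabilityMeasure (roundLaw μ F v p ρ) :=
  Measure.isProbabilityMeasure_map (measurable_outcome_of_price hv p).aemeasurable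

/-- Given `q`, the type is still distributed as `F`, so the purchase is Bernoulli with success
probability `F[κ(p,q),1]`. -/
theorem integral_roundLaw (hv : RegularValuation v) (hF : F {1} = 0) {φ : I → Bool → ℝ}
    (hφ : Measurable fun x : I × Bool => φ x.1 x.2) {c : ℝ} (hc : ∀ q y, φ q y ∈ Icc (-c) c) :
    ∫ o, φ o.2.1 o.2.2 ∂(roundLaw μ F v p ρ) =
      ∫ q, (F.real (Ici (criticalType v p q)) * φ q true +
        (1 - F.real (Ici (criticalType v p q))) * φ q false) ∂(ρ ∘ₘ μ) := by
  have hout := measurable_outcome_of_price hv p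
  have hm1 : Measurable fun o : Obs => φ o.2.1 o.2.2 :=
    hφ.comp (by fun_prop : Measurable fun o : Obs => (o.2.1, o.2.2))
  rw [roundLaw, integral_map hout.aemeasurable hm1.aestronglyMeasurable]
  refine (integral_prod _ (Integrable.of_mem_Icc (-c) c (hm1.comp hout).aemeasurable
    (Filter.Eventually.of_forall fun _ => hc _ _))).trans ?_
  dsimp only [Function.comp_apply]
  have h1 : ∀ q : I, ∫ θ, φ q (decide (p ≤ v θ q)) ∂F =
      F.real (Ici (criticalType v p q)) * φ q true +
        (1 - F.real (Ici (criticalType v p q))) * φ q false := by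
    intro q
    have hA : MeasurableSet {θ : I | p ≤ v θ q} :=
      (isClosed_le continuous_const (hv.continuous_type q)).measurableSet
    have h2 : ∀ θ, φ q (decide (p ≤ v θ q)) =
        {θ : I | p ≤ v θ q}.indicator (fun _ => φ q true) θ +
          {θ : I | p ≤ v θ q}ᶜ.indicator (fun _ => φ q false) θ := by
      intro θ
      by_cases h : p ≤ v θ q <;> simp [h]
    simp only [h2]
    rw [integral_add ((integrable_const _).indicator hA) ((integrable_const _).indicator hA.compl),
      integral_indicator hA, integral_indicator hA.compl, setIntegral_const, setIntegral_const,
      probReal_compl_eq_one_sub hA, hv.measureReal_purchase hF, smul_eq_mul, smul_eq_mul]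
  simp only [h1]
  rw [← Measure.snd_compProd, Measure.snd, integral_map measurable_snd.aemeasurable]
  have hD : Measurable fun q => F.real (Ici (criticalType v p q)) :=
    (Antitone.measurable fun _ _ h => measureReal_mono (Ici_subset_Ici.2 h)).comp
      (hv.measurable_criticalType_right p)
  have hφt : Measurable fun q => φ q true :=
    hφ.comp (by fun_prop : Measurable fun q : I => (q, true))
  have hφf : Measurable fun q => φ q false :=
    hφ.comp (by fun_prop : Measurable fun q : I => (q, false))
  exact ((hD.mul hφt).add ((measurable_const.sub hD).mul hφf)).aestronglyMeasurable

theorem measureReal_roundLaw_posterior (hv : RegularValuation v) (hF : F {1} = 0) {A : Set I}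
    (hA : MeasurableSet A) :
    (roundLaw μ F v p ρ).real {o | o.2.1 ∈ A} = (ρ ∘ₘ μ).real A := by
  have hm : MeasurableSet {o : Obs | o.2.1 ∈ A} :=
    (by fun_prop : Measurable fun o : Obs => o.2.1) hA
  have h1 := integral_roundLaw (μ := μ) (p := p) (ρ := ρ) hv hF
    (φ := fun q _ => A.indicator 1 q) ((measurable_one.indicator hA).comp measurable_fst) (c := 1)
    (fun q _ => by by_cases h : q ∈ A <;> simp [h])
  rw [← integral_indicator_one hm, ← integral_indicator_one hA]
  refine Eq.trans h1 (integral_congr_ae (Filter.Eventually.of_forall fun q => ?_))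
  dsimp only; ring

theorem ae_roundLaw_posterior (hv : RegularValuation v) (hF : F {1} = 0) {A : Set I}
    (hA : MeasurableSet A) (h : ∀ᵐ q ∂(ρ ∘ₘ μ), q ∈ A) :
    ∀ᵐ o ∂(roundLaw μ F v p ρ), o.2.1 ∈ A := by
  have := isProbabilityMeasure_roundLaw (μ := μ) (F := F) (p := p) (ρ := ρ) hv
  have h1 := measureReal_roundLaw_posterior (μ := μ) (p := p) (ρ := ρ) hv hF hA.compl
  rw [ae_iff] at h ⊢
  have h2 : (ρ ∘ₘ μ).real Aᶜ = 0 := by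
    rw [measureReal_def, show (ρ ∘ₘ μ) Aᶜ = 0 from h, ENNReal.toReal_zero]
  rw [h2, measureReal_eq_zero_iff] at h1
  exact h1

theorem rev_eq_roundLaw (hv : RegularValuation v) (hF : F {1} = 0) :
    rev μ F v p ρ = p * (roundLaw μ F v p ρ).real {o | o.2.2 = true} := by
  have hm : MeasurableSet {o : Obs | o.2.2 = true} :=
    (by fun_prop : Measurable fun o : Obs => o.2.2) (measurableSet_singleton true)
  have h1 := integral_roundLaw (μ := μ) (p := p) (ρ := ρ) hv hF
    (φ := fun _ y => if y = true then 1 else 0)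
    ((measurable_of_countable fun y : Bool => (if y = true then 1 else 0 : ℝ)).comp measurable_snd)
    (c := 1) (fun q y => by cases y <;> simp)
  simp only [if_true, Bool.false_eq_true, if_false, mul_one, mul_zero, add_zero] at h1
  rw [rev, ← integral_indicator_one hm]
  simp only [hv.measureReal_purchase hF]
  rw [← h1]
  congr 1
  refine integral_congr_ae (Filter.Eventually.of_forall fun o => ?_)
  by_cases h : o.2.2 = true <;> simp [h]

end RoundLaw

section History

variable {μ F : Measure I} [IsProbabilityMeasure μ] [IsProbabilityMeasure F] {v : I → I → ℝ}
  {U : ℝ} (π : Policy μ U)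

instance (t : ℕ) : IsMarkovKernel (π.adv t) := π.markov t

/-- The law of the observation in round `t` given the past, as a kernel. -/
def obsKernel (F : Measure I) (v : I → I → ℝ) (π : Policy μ U) (t : ℕ) :
    Kernel (Fin t → Obs) Obs :=
  (Kernel.id ×ₖ ((Kernel.const _ μ ⊗ₖ π.adv t) ×ₖ Kernel.const _ F)).map
    fun x : (Fin t → Obs) × ((I × I) × I) =>
      (x.2.1.1, x.2.1.2, decide (π.price t x.1 ≤ v x.2.2 x.2.1.2))

theorem obsKernel_apply (hv : RegularValuation v) (t : ℕ) (h : Fin t → Obs) :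
    obsKernel F v π t h = roundLaw μ F v (π.price t h) ((π.adv t).sectR h) := by
  have hm : Measurable fun x : (Fin t → Obs) × ((I × I) × I) =>
      ((x.2.1.1, x.2.1.2, decide (π.price t x.1 ≤ v x.2.2 x.2.1.2)) : Obs) :=
    (measurable_outcome hv).comp
      (((π.measurable_price t).comp measurable_fst).prodMk measurable_snd)
  rw [obsKernel, Kernel.map_apply _ hm, Kernel.prod_apply, Kernel.prod_apply, Kernel.id_apply,
    Kernel.const_apply, Measure.dirac_prod, Measure.map_map hm measurable_prodMk_left,
    Kernel.compProd_apply_eq_compProd_sectR, Kernel.const_apply]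
  rfl

theorem isMarkovKernel_obsKernel (hv : RegularValuation v) (t : ℕ) :
    IsMarkovKernel (obsKernel F v π t) :=
  ⟨fun h => by rw [obsKernel_apply π hv]; exact isProbabilityMeasure_roundLaw hv⟩

theorem measurable_snoc (t : ℕ) :
    Measurable fun x : (Fin t → Obs) × Obs => (Fin.snoc x.1 x.2 : Fin (t + 1) → Obs) := by
  refine measurable_pi_lambda _ fun s => ?_
  refine Fin.lastCases ?_ (fun s => ?_) s
  · simp only [Fin.snoc_last]; exact measurable_snd
  · simp only [Fin.snoc_castSucc]; exact (measurable_pi_apply s).comp measurable_fst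

/-- As a composition-product with a kernel, the history law can be integrated one round at a time.
-/
theorem histLaw_succ (hv : RegularValuation v) (t : ℕ) [SFinite (histLaw F v π t)] :
    histLaw F v π (t + 1) = (histLaw F v π t ⊗ₘ obsKernel F v π t).map
      fun x => (Fin.snoc x.1 x.2 : Fin (t + 1) → Obs) := by
  have := isMarkovKernel_obsKernel (F := F) π hv t
  rw [Measure.compProd_eq_comp_prod, Measure.map_comp _ _ (measurable_snoc t)]
  change Measure.bind _ _ = Measure.bind _ _
  congr 1
  funext h
  rw [Kernel.map_apply _ (measurable_snoc t), Kernel.prod_apply, Kernel.id_apply,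
    Measure.dirac_prod, Measure.map_map (measurable_snoc t) measurable_prodMk_left,
    obsKernel_apply π hv]
  rfl

theorem isProbabilityMeasure_histLaw (hv : RegularValuation v) (t : ℕ) :
    IsProbabilityMeasure (histLaw F v π t) := by
  induction t with
  | zero => exact Measure.dirac.isProbabilityMeasure
  | succ t ih =>
    have := isMarkovKernel_obsKernel (F := F) π hv t
    rw [histLaw_succ π hv]
    exact Measure.isProbabilityMeasure_map (measurable_snoc t).aemeasurable

theorem integral_histLaw_succ (hv : RegularValuation v) (t : ℕ) {G : (Fin (t + 1) → Obs) → ℝ}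
    (hG : Measurable G) {c : ℝ} (hc : ∀ h, G h ∈ Icc (-c) c) :
    ∫ h, G h ∂(histLaw F v π (t + 1)) =
      ∫ h, ∫ o, G (Fin.snoc h o) ∂(obsKernel F v π t h) ∂(histLaw F v π t) := by
  have := isMarkovKernel_obsKernel (F := F) π hv t
  have := isProbabilityMeasure_histLaw (F := F) π hv t
  rw [histLaw_succ π hv, integral_map (measurable_snoc t).aemeasurable hG.aestronglyMeasurable,
    Measure.integral_compProd]
  exact Integrable.of_mem_Icc (-c) c (hG.comp (measurable_snoc t)).aemeasurable
    (Filter.Eventually.of_forall fun _ => hc _)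

end History

/-! ## Concentration of the empirical demand -/

section Counts

variable {μ : Measure I} {U : ℝ} {v : I → I → ℝ} (π : Policy μ U) {t : ℕ}

theorem policyData_snoc_castSucc (h : Fin t → Obs) (o : Obs) (s : Fin t) :
    policyData v π (Fin.snoc h o : Fin (t + 1) → Obs) s.castSucc = policyData v π h s := by
  have h1 : (fun r : Fin (s.castSucc : Fin (t + 1)) =>
      (Fin.snoc h o : Fin (t + 1) → Obs) (Fin.castLE s.castSucc.2.le r)) =
      fun r : Fin s => h (Fin.castLE s.2.le r) := by
    funext r
    have : Fin.castLE s.castSucc.2.le r = (Fin.castLE s.2.le r : Fin t).castSucc := rfl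
    rw [this, Fin.snoc_castSucc]
  simp only [policyData, Fin.snoc_castSucc]
  rw [h1]
  rfl

theorem policyData_snoc_last (h : Fin t → Obs) (o : Obs) :
    policyData v π (Fin.snoc h o : Fin (t + 1) → Obs) (Fin.last t) =
      (criticalType v (π.price t h) o.2.1, o.2.2) := by
  have h1 : (fun r : Fin (Fin.last t : Fin (t + 1)) =>
      (Fin.snoc h o : Fin (t + 1) → Obs) (Fin.castLE (Fin.last t).2.le r)) = h := by
    funext r
    have : Fin.castLE (Fin.last t).2.le r = Fin.castSucc r := rfl
    rw [this, Fin.snoc_castSucc]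
  simp only [policyData, Fin.snoc_last]
  rw [h1]
  rfl

theorem visits_snoc (h : Fin t → Obs) (o : Obs) (x : I) :
    visits (policyData v π (Fin.snoc h o : Fin (t + 1) → Obs)) x =
      visits (policyData v π h) x + if criticalType v (π.price t h) o.2.1 = x then 1 else 0 := by
  simp only [visits, Finset.card_filter, Fin.sum_univ_castSucc, policyData_snoc_castSucc,
    policyData_snoc_last]

theorem purchases_snoc (h : Fin t → Obs) (o : Obs) (x : I) :
    purchases (policyData v π (Fin.snoc h o : Fin (t + 1) → Obs)) x =
      purchases (policyData v π h) x +
        if criticalType v (π.price t h) o.2.1 = x ∧ o.2.2 = true then 1 else 0 := by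
  simp only [purchases, Finset.card_filter, Fin.sum_univ_castSucc, policyData_snoc_castSucc,
    policyData_snoc_last]

theorem purchases_le_visits (d : Fin t → I × Bool) (x : I) : purchases d x ≤ visits d x :=
  Finset.card_le_card fun _ hs => Finset.mem_filter.2
    ⟨Finset.mem_univ _, (Finset.mem_filter.1 hs).2.1⟩

theorem visits_le (d : Fin t → I × Bool) (x : I) : visits d x ≤ t :=
  (Finset.card_filter_le _ _).trans (by simp)

theorem sum_visits_le (d : Fin t → I × Bool) (S : Finset I) : ∑ x ∈ S, visits d x ≤ t := by
  simp only [visits]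
  rw [← Finset.card_biUnion]
  · exact (Finset.card_le_univ _).trans (by simp)
  · intro x _ y _ hxy
    refine Finset.disjoint_left.2 fun s hs hs' => hxy ?_
    rw [← (Finset.mem_filter.1 hs).2, (Finset.mem_filter.1 hs').2]

theorem measurable_policyData (hv : RegularValuation v) :
    Measurable fun h : Fin t → Obs => policyData v π h :=
  measurable_pastData hv fun s _ => π.measurable_price s

end Counts

/-- Hoeffding's lemma for a Bernoulli variable; it gives `a ^ 2 / 8`, and the weaker `a ^ 2 / 2`
suffices. -/
theorem two_point_mgf_le (F : Measure I) [IsProbabilityMeasure F] (x : I) (a : ℝ) :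
    F.real (Ici x) * Real.exp (a * (1 - F.real (Ici x)) - a ^ 2 / 2) +
      (1 - F.real (Ici x)) * Real.exp (a * (0 - F.real (Ici x)) - a ^ 2 / 2) ≤ 1 := by
  have hA : MeasurableSet (Ici x) := measurableSet_Ici
  set D := F.real (Ici x) with hD
  let X : I → ℝ := (Ici x).indicator 1
  have hX : ∫ θ, X θ ∂F = D := integral_indicator_one hA
  have h1 := (hasSubgaussianMGF_of_mem_Icc (μ := F) (X := X) (a := 0) (b := 1)
    (measurable_one.indicator hA).aemeasurable (Filter.Eventually.of_forall fun θ => by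
      by_cases h : θ ∈ Ici x <;> simp [X, h])).mgf_le a
  rw [hX, mgf] at h1
  have h2 : ∀ θ, Real.exp (a * (X θ - D)) =
      (Ici x).indicator (fun _ => Real.exp (a * (1 - D))) θ +
        (Ici x)ᶜ.indicator (fun _ => Real.exp (a * (0 - D))) θ := by
    intro θ
    by_cases h : θ ∈ Ici x
    · have h' : θ ∉ (Ici x)ᶜ := fun hh => hh h
      rw [indicator_of_mem h, indicator_of_notMem h', add_zero,
        show X θ = 1 from indicator_of_mem h _]
    · rw [indicator_of_notMem h, indicator_of_mem (show θ ∈ (Ici x)ᶜ from h), zero_add,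
        show X θ = 0 from indicator_of_notMem h _]
  simp only [h2] at h1
  rw [integral_add ((integrable_const _).indicator hA) ((integrable_const _).indicator hA.compl),
    integral_indicator hA, integral_indicator hA.compl, setIntegral_const, setIntegral_const,
    probReal_compl_eq_one_sub hA, smul_eq_mul, smul_eq_mul, ← hD] at h1
  have h3 : Real.exp (((‖(1 : ℝ) - 0‖₊ / 2) ^ 2 : NNReal) * a ^ 2 / 2) ≤ Real.exp (a ^ 2 / 2) := by
    refine Real.exp_le_exp.2 ?_
    push_cast
    simp only [sub_zero, norm_one]
    nlinarith [sq_nonneg a]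
  rw [Real.exp_sub, Real.exp_sub, ← mul_div_assoc, ← mul_div_assoc, ← add_div,
    div_le_one (Real.exp_pos _)]
  exact h1.trans h3

/-! ### Exponential supermartingale and deviation probabilities -/

section Martingale

variable {μ F : Measure I} [IsProbabilityMeasure μ] [IsProbabilityMeasure F] {v : I → I → ℝ}
  {U : ℝ} (π : Policy μ U)

/-- The exponential supermartingale of the purchases at critical type `x`. -/
def expMartingale (F : Measure I) (v : I → I → ℝ) (π : Policy μ U) (x : I) (a : ℝ) {t : ℕ}
    (h : Fin t → Obs) : ℝ :=
  Real.exp (a * (purchases (policyData v π h) x - visits (policyData v π h) x * F.real (Ici x)) -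
    a ^ 2 / 2 * visits (policyData v π h) x)

omit [IsProbabilityMeasure μ] [IsProbabilityMeasure F] in
theorem measurable_expMartingale (hv : RegularValuation v) (x : I) (a : ℝ) (t : ℕ) :
    Measurable fun h : Fin t → Obs => expMartingale F v π x a h := by
  have h1 : Measurable fun h : Fin t → Obs => (visits (policyData v π h) x : ℝ) :=
    measurable_from_top.comp ((measurable_visits x).comp (measurable_policyData π hv))
  have h2 : Measurable fun h : Fin t → Obs => (purchases (policyData v π h) x : ℝ) :=
    measurable_from_top.comp ((measurable_purchases x).comp (measurable_policyData π hv))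
  unfold expMartingale
  fun_prop

omit [IsProbabilityMeasure μ] in
theorem expMartingale_mem (x : I) (a : ℝ) {t : ℕ} (h : Fin t → Obs) :
    expMartingale F v π x a h ∈ Icc (-Real.exp (|a| * t)) (Real.exp (|a| * t)) := by
  have h0 : 0 < expMartingale F v π x a h := Real.exp_pos _
  refine ⟨by linarith [Real.exp_pos (|a| * t)], Real.exp_le_exp.2 ?_⟩
  set d := policyData v π h
  have h1 : (purchases d x : ℝ) ≤ visits d x := by exact_mod_cast purchases_le_visits d x
  have h2 : (visits d x : ℝ) ≤ t := by exact_mod_cast visits_le d x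
  have h3 : (visits d x : ℝ) * F.real (Ici x) ≤ visits d x :=
    mul_le_of_le_one_right (by positivity) measureReal_le_one
  have h4 : 0 ≤ (visits d x : ℝ) * F.real (Ici x) := by positivity
  have h5 : |(purchases d x : ℝ) - visits d x * F.real (Ici x)| ≤ t := by
    rw [abs_le]
    have : (0 : ℝ) ≤ purchases d x := by positivity
    constructor <;> linarith
  have h6 : a * ((purchases d x : ℝ) - visits d x * F.real (Ici x)) ≤ |a| * t :=
    (le_abs_self _).trans (by rw [abs_mul]; exact mul_le_mul_of_nonneg_left h5 (abs_nonneg a))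
  have h7 : 0 ≤ a ^ 2 / 2 * visits d x := by positivity
  linarith

/-- A round whose critical type differs from `x` leaves the process unchanged. Otherwise it
multiplies it by a factor of conditional mean at most `1`, whatever the price and strategy, by
`two_point_mgf_le`. -/
theorem integral_expMartingale_le (hv : RegularValuation v) (hF : F {1} = 0) (x : I) (a : ℝ)
    (t : ℕ) : ∫ h, expMartingale F v π x a h ∂(histLaw F v π t) ≤ 1 := by
  induction t with
  | zero =>
    rw [histLaw, integral_dirac]
    simp [expMartingale, purchases, visits]
  | succ t ih =>
    have := isProbabilityMeasure_histLaw (F := F) π hv t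
    rw [integral_histLaw_succ π hv t (measurable_expMartingale π hv x a (t + 1))
      (expMartingale_mem π x a)]
    refine le_trans (integral_mono_of_nonneg (Filter.Eventually.of_forall fun h =>
      integral_nonneg fun o => (Real.exp_pos _).le) (Integrable.of_mem_Icc _ _
        (measurable_expMartingale π hv x a t).aemeasurable (Filter.Eventually.of_forall
          (expMartingale_mem π x a))) (Filter.Eventually.of_forall fun h => ?_)) ih
    set D := F.real (Ici x) with hD
    set p := π.price t h with hp
    let φ : I → Bool → ℝ := fun q y => if criticalType v p q = x then
      Real.exp (a * ((if y = true then 1 else 0) - D) - a ^ 2 / 2) else 1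
    have hφ : ∀ o : Obs, expMartingale F v π x a (Fin.snoc h o : Fin (t + 1) → Obs) =
        expMartingale F v π x a h * φ o.2.1 o.2.2 := by
      intro o
      simp only [expMartingale, visits_snoc, purchases_snoc, φ, ← hp]
      by_cases hx : criticalType v p o.2.1 = x
      · rw [if_pos hx, if_pos hx, ← Real.exp_add]
        congr 1
        by_cases hy : o.2.2 = true
        · rw [if_pos ⟨hx, hy⟩, if_pos hy, hD]; push_cast; ring
        · rw [if_neg fun hh => hy hh.2, if_neg hy, hD]; push_cast; ring
      · simp [hx]
    have hφm : Measurable fun y : I × Bool => φ y.1 y.2 := by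
      have hm : Measurable fun y : I × Bool => criticalType v p y.1 :=
        (hv.measurable_criticalType_right p).comp measurable_fst
      refine Measurable.ite (hm (measurableSet_singleton x)) ?_ measurable_const
      exact (measurable_of_countable fun y : Bool =>
        Real.exp (a * ((if y = true then 1 else 0) - D) - a ^ 2 / 2)).comp measurable_snd
    have hφb : ∀ q y, φ q y ∈ Icc (-Real.exp |a|) (Real.exp |a|) := by
      intro q y
      have hD0 : 0 ≤ D := measureReal_nonneg
      have hD1 : D ≤ 1 := measureReal_le_one
      have h1 : 0 ≤ φ q y := by
        simp only [φ]; split_ifs <;> positivity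
      refine ⟨by linarith [Real.exp_pos |a|], ?_⟩
      simp only [φ]
      split_ifs
      · refine Real.exp_le_exp.2 ?_
        have := le_abs_self (a * (1 - D))
        rw [abs_mul, abs_of_nonneg (by linarith : 0 ≤ 1 - D)] at this
        nlinarith [abs_nonneg a, sq_nonneg a]
      · refine Real.exp_le_exp.2 ?_
        have := le_abs_self (a * (0 - D))
        rw [abs_mul, abs_of_nonpos (by linarith : 0 - D ≤ 0)] at this
        nlinarith [abs_nonneg a, sq_nonneg a]
      · exact Real.one_le_exp (abs_nonneg a)
    simp only [hφ]
    rw [integral_const_mul, obsKernel_apply π hv, integral_roundLaw hv hF hφm hφb]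
    refine mul_le_of_le_one_right (Real.exp_pos _).le ?_
    have hle : ∀ q, F.real (Ici (criticalType v p q)) * φ q true +
        (1 - F.real (Ici (criticalType v p q))) * φ q false ≤ 1 := by
      intro q
      simp only [φ]
      by_cases hq : criticalType v p q = x
      · simp only [hq, if_true]
        exact two_point_mgf_le F x a
      · simp [hq]
    have h1 := integral_mono_of_nonneg (μ := (π.adv t).sectR h ∘ₘ μ) (g := fun _ => (1 : ℝ))
      (f := fun q => F.real (Ici (criticalType v p q)) * φ q true +
        (1 - F.real (Ici (criticalType v p q))) * φ q false)
      (Filter.Eventually.of_forall fun q => ?_) (integrable_const 1)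
      (Filter.Eventually.of_forall hle)
    · simpa using h1
    · have hp0 : ∀ y, 0 ≤ φ q y := fun y => by
        simp only [φ]; split_ifs <;> positivity
      exact add_nonneg (mul_nonneg measureReal_nonneg (hp0 _))
        (mul_nonneg (sub_nonneg.2 measureReal_le_one) (hp0 _))

/-- Markov's inequality for the supermartingale with `a = r` or `a = -r`: on the event its exponent
is at least `n * r ^ 2 - n * r ^ 2 / 2`. -/
theorem measureReal_deviation_le (hv : RegularValuation v) (hF : F {1} = 0) (x : I) (n t : ℕ)
    {r : ℝ} (a : ℝ) (ha : a ^ 2 = r ^ 2) :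
    (histLaw F v π t).real {h | visits (policyData v π h) x = n ∧
      n * r ^ 2 ≤ a * (purchases (policyData v π h) x - n * F.real (Ici x))} ≤
      Real.exp (-(n * r ^ 2 / 2)) := by
  have := isProbabilityMeasure_histLaw (F := F) π hv t
  have h1 := mul_meas_ge_le_integral_of_nonneg (μ := histLaw F v π t)
    (f := fun h => expMartingale F v π x a h)
    (Filter.Eventually.of_forall fun h => (Real.exp_pos _).le) (Integrable.of_mem_Icc _ _
        (measurable_expMartingale π hv x a t).aemeasurable (Filter.Eventually.of_forall
          (expMartingale_mem π x a))) (Real.exp (n * r ^ 2 / 2))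
  have h2 := h1.trans (integral_expMartingale_le π hv hF x a t)
  have h3 : (histLaw F v π t).real {h | visits (policyData v π h) x = n ∧
      n * r ^ 2 ≤ a * (purchases (policyData v π h) x - n * F.real (Ici x))} ≤
      (histLaw F v π t).real {h | Real.exp (n * r ^ 2 / 2) ≤ expMartingale F v π x a h} := by
    refine measureReal_mono fun h hh => ?_
    obtain ⟨hn, hh⟩ := hh
    refine Real.exp_le_exp.2 ?_
    rw [hn, ha]
    linarith
  rw [Real.exp_neg]
  refine h3.trans ?_
  rw [← one_div, le_div_iff₀ (Real.exp_pos _), mul_comm]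
  exact h2

/-- The empirical demand at some visited grid type deviates from the demand. -/
def deviationSet (F : Measure I) (v : I → I → ℝ) (π : Policy μ U) (S : Finset I) (T t : ℕ) :
    Set (Fin t → Obs) :=
  {h | ∃ x ∈ S, 0 < visits (policyData v π h) x ∧
    √(16 * Real.log T / visits (policyData v π h) x) ≤
      |empDemand (policyData v π h) x - F.real (Ici x)|}

omit [IsProbabilityMeasure μ] [IsProbabilityMeasure F] in
theorem measurableSet_deviationSet (hv : RegularValuation v) (S : Finset I) (T t : ℕ) :
    MeasurableSet (deviationSet F v π S T t) := by
  have h1 : ∀ x, Measurable fun h : Fin t → Obs => visits (policyData v π h) x := fun x =>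
    (measurable_visits x).comp (measurable_policyData π hv)
  have h1' : ∀ x, Measurable fun h : Fin t → Obs => (visits (policyData v π h) x : ℝ) := fun x =>
    measurable_from_top.comp (h1 x)
  have h2 : ∀ x, Measurable fun h : Fin t → Obs => (purchases (policyData v π h) x : ℝ) := fun x =>
    measurable_from_top.comp ((measurable_purchases x).comp (measurable_policyData π hv))
  have h3 : deviationSet F v π S T t = ⋃ x ∈ S, {h | 0 < visits (policyData v π h) x} ∩
      {h | √(16 * Real.log T / visits (policyData v π h) x) ≤
        |(purchases (policyData v π h) x : ℝ) / visits (policyData v π h) x - F.real (Ici x)|} := by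
    ext h
    simp only [deviationSet, empDemand_eq, mem_iUnion, exists_prop]
    rfl
  rw [h3]
  refine Finset.measurableSet_biUnion _ fun x _ => MeasurableSet.inter ?_ ?_
  · exact h1 x measurableSet_Ioi
  · have := h1' x
    have := h2 x
    refine measurableSet_le (by fun_prop) ?_
    simp only [← Real.norm_eq_abs]
    fun_prop

/-- Fixing the number `n` of visits makes the radius deterministic. With `n * r ^ 2 = 16 log T` each
event has probability at most `T⁻⁸`; the union is over grid types, `n ≤ t` and two signs. -/
theorem measureReal_deviationSet_le (hv : RegularValuation v) (hF : F {1} = 0) (S : Finset I)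
    {T : ℕ} (hT : 1 ≤ T) (t : ℕ) :
    (histLaw F v π t).real (deviationSet F v π S T t) ≤ S.card * t * (2 * ((T : ℝ) ^ 8)⁻¹) := by
  have := isProbabilityMeasure_histLaw (F := F) π hv t
  have hL : 0 ≤ Real.log T := Real.log_natCast_nonneg T
  let E : I → ℕ → ℝ → Set (Fin t → Obs) := fun x n s => {h | visits (policyData v π h) x = n ∧
      n * (√(16 * Real.log T / n)) ^ 2 ≤
        (s * √(16 * Real.log T / n)) * (purchases (policyData v π h) x - n * F.real (Ici x))}
  have hE : ∀ x n, 0 < n → ∀ s : ℝ, s ^ 2 = 1 →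
      (histLaw F v π t).real (E x n s) ≤ ((T : ℝ) ^ 8)⁻¹ := by
    intro x n hn s hs
    refine (measureReal_deviation_le π hv hF x n t (s * √(16 * Real.log T / n))
      (r := √(16 * Real.log T / n)) (by rw [mul_pow, hs, one_mul])).trans ?_
    have hn' : (0 : ℝ) < n := by exact_mod_cast hn
    rw [Real.sq_sqrt (by positivity), mul_div_cancel₀ _ hn'.ne', Real.exp_neg]
    refine le_of_eq ?_
    rw [show 16 * Real.log T / 2 = (8 : ℕ) * Real.log T by push_cast; ring, Real.exp_nat_mul,
      Real.exp_log (by exact_mod_cast hT)]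
  have hsub : deviationSet F v π S T t ⊆
      ⋃ x ∈ S, ⋃ n ∈ Finset.Icc 1 t, (E x n 1 ∪ E x n (-1)) := by
    rintro h ⟨x, hx, hn, hdev⟩
    set n := visits (policyData v π h) x with hndef
    refine mem_biUnion hx (mem_biUnion (Finset.mem_Icc.2 ⟨hn, visits_le _ _⟩) ?_)
    have hn' : (0 : ℝ) < n := by exact_mod_cast hn
    set r := √(16 * Real.log T / n) with hr
    have hr0 : 0 ≤ r := Real.sqrt_nonneg _
    rw [empDemand_eq, ← hndef] at hdev
    set K : ℝ := (purchases (policyData v π h) x : ℝ)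
    have hK : K - n * F.real (Ici x) = n * (K / n - F.real (Ici x)) := by field_simp
    rcases le_abs.1 hdev with h1 | h1
    · refine Or.inl ⟨rfl, ?_⟩
      change n * r ^ 2 ≤ 1 * r * (K - n * F.real (Ici x))
      rw [hK]
      nlinarith [mul_le_mul_of_nonneg_left h1 (mul_nonneg hn'.le hr0)]
    · refine Or.inr ⟨rfl, ?_⟩
      change n * r ^ 2 ≤ -1 * r * (K - n * F.real (Ici x))
      rw [hK]
      nlinarith [mul_le_mul_of_nonneg_left h1 (mul_nonneg hn'.le hr0)]
  refine (measureReal_mono hsub (measure_ne_top _ _)).trans ?_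
  refine (measureReal_biUnion_finset_le _ _).trans ?_
  have h1 : ∀ x ∈ S, (histLaw F v π t).real (⋃ n ∈ Finset.Icc 1 t, (E x n 1 ∪ E x n (-1))) ≤
      t * (2 * ((T : ℝ) ^ 8)⁻¹) := by
    intro x _
    refine (measureReal_biUnion_finset_le _ _).trans ?_
    have h2 : ∀ n ∈ Finset.Icc 1 t, (histLaw F v π t).real (E x n 1 ∪ E x n (-1)) ≤
        2 * ((T : ℝ) ^ 8)⁻¹ := by
      intro n hn
      have hn' := (Finset.mem_Icc.1 hn).1
      refine (measureReal_union_le _ _).trans ?_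
      linarith [hE x n hn' 1 (by norm_num), hE x n hn' (-1) (by norm_num)]
    refine (Finset.sum_le_sum h2).trans ?_
    simp
  refine (Finset.sum_le_sum h1).trans ?_
  rw [Finset.sum_const, nsmul_eq_mul, mul_assoc]

end Martingale

/-! ## Regret of the algorithm -/

section Radius

theorem sqrt_succ_sub_sqrt_nonneg (n : ℕ) : 0 ≤ √((n : ℝ) + 1) - √n :=
  sub_nonneg.2 (Real.sqrt_le_sqrt (by linarith))

/-- For `n ≥ 1` the radius is at most `6 √(log T) / √n`, since `n < T` bounds the second logarithm,
while `√(n+1) - √n ≥ 1 / (3 √n)`. For `n = 0` division by zero makes the radius `0`. -/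
theorem radius_le {T n : ℕ} (hn : n < T) :
    radius T n ≤ 18 * √(Real.log T) * (√((n : ℝ) + 1) - √n) := by
  rcases Nat.eq_zero_or_pos n with rfl | hn0
  · simp only [radius, Nat.cast_zero, div_zero, Real.sqrt_zero, zero_add]
    simp
  have hn1 : (1 : ℝ) ≤ n := by exact_mod_cast hn0
  have hn' : (0 : ℝ) < n := by linarith
  set L := Real.log T with hL
  have hL0 : 0 ≤ L := Real.log_natCast_nonneg T
  set s := √(n : ℝ) with hs
  have hs0 : 0 < s := Real.sqrt_pos.2 hn'
  have hss : s * s = n := Real.mul_self_sqrt hn'.le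
  have h1 : √(16 * L / n) = 4 * √L / s := by
    rw [Real.sqrt_div' _ hn'.le, Real.sqrt_mul (by norm_num),
      show √(16 : ℝ) = 4 by rw [show (16 : ℝ) = 4 ^ 2 by norm_num]; exact Real.sqrt_sq (by norm_num)]
  have h2 : √((1 + n) * Real.log (1 + n)) / n ≤ 2 * √L / s := by
    have h3 : Real.log (1 + n) ≤ L := by
      refine Real.log_le_log (by linarith) ?_
      have : n + 1 ≤ T := hn
      have : ((n + 1 : ℕ) : ℝ) ≤ T := by exact_mod_cast this
      push_cast at this; linarith
    have h4 : √((1 + n) * Real.log (1 + n)) ≤ √(4 * (n * L)) := by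
      refine Real.sqrt_le_sqrt ?_
      have h5 : 0 ≤ Real.log (1 + n) := Real.log_nonneg (by linarith)
      nlinarith
    rw [Real.sqrt_mul (x := (4 : ℝ)) (by norm_num), Real.sqrt_mul hn'.le,
      show √(4 : ℝ) = 2 by rw [show (4 : ℝ) = 2 ^ 2 by norm_num]; exact Real.sqrt_sq (by norm_num),
      ← hs] at h4
    have h7 := mul_le_mul_of_nonneg_right h4 hs0.le
    rw [div_le_div_iff₀ hn' hs0]
    exact h7.trans_eq (by rw [show 2 * (s * √L) * s = 2 * √L * (s * s) by ring, hss])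
  have h6 : 1 / (3 * s) ≤ √((n : ℝ) + 1) - s := by
    set r := √((n : ℝ) + 1) with hr
    have hrr : r * r = n + 1 := Real.mul_self_sqrt (by linarith)
    have hr0 : 0 ≤ r := Real.sqrt_nonneg _
    have hr2 : r ≤ 2 * s := by
      refine abs_le_of_sq_le_sq' ?_ (by linarith) |>.2
      nlinarith
    have hrs : s ≤ r := Real.sqrt_le_sqrt (by linarith)
    rw [div_le_iff₀ (by linarith)]
    nlinarith
  calc radius T n ≤ 4 * √L / s + 2 * √L / s := by
        unfold radius
        exact add_le_add h1.le h2
    _ = 18 * √L * (1 / (3 * s)) := by field_simp; ring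
    _ ≤ _ := mul_le_mul_of_nonneg_left h6 (by positivity)

/-- The sum of the square roots of the numbers of visits. -/
def potential (S : Finset I) {t : ℕ} (d : Fin t → I × Bool) : ℝ := ∑ x ∈ S, √(visits d x : ℝ)

theorem potential_nonneg (S : Finset I) {t : ℕ} (d : Fin t → I × Bool) : 0 ≤ potential S d :=
  Finset.sum_nonneg fun _ _ => Real.sqrt_nonneg _

/-- Cauchy–Schwarz, since the visits to distinct types add up to at most `t`. -/
theorem potential_le (S : Finset I) {t : ℕ} (d : Fin t → I × Bool) :
    potential S d ≤ √(S.card * t) := by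
  have h1 := Real.sum_sqrt_mul_sqrt_le S (f := fun x => (visits d x : ℝ)) (g := fun _ => 1)
    (fun _ => by positivity) (fun _ => zero_le_one)
  simp only [Real.sqrt_one, mul_one, Finset.sum_const, nsmul_eq_mul] at h1
  refine h1.trans ?_
  rw [mul_comm, ← Real.sqrt_mul (by positivity)]
  refine Real.sqrt_le_sqrt (mul_le_mul_of_nonneg_left ?_ (by positivity))
  exact_mod_cast sum_visits_le d S

theorem potential_mem (S : Finset I) {t : ℕ} (d : Fin t → I × Bool) :
    potential S d ∈ Icc (-√(S.card * t)) √(S.card * t) :=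
  ⟨(neg_nonpos.2 (Real.sqrt_nonneg _)).trans (potential_nonneg S d), potential_le S d⟩

theorem measurable_potential (S : Finset I) (t : ℕ) :
    Measurable fun d : Fin t → I × Bool => potential S d :=
  Finset.measurable_fun_sum _ fun x _ =>
    (measurable_from_top (f := fun n : ℕ => √(n : ℝ))).comp (measurable_visits x)

theorem potential_snoc {μ : Measure I} {U : ℝ} {v : I → I → ℝ} (π : Policy μ U) (S : Finset I)
    {t : ℕ} (h : Fin t → Obs) (o : Obs) :
    potential S (policyData v π (Fin.snoc h o : Fin (t + 1) → Obs)) =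
      potential S (policyData v π h) + ∑ x ∈ S, if criticalType v (π.price t h) o.2.1 = x then
        √((visits (policyData v π h) x : ℝ) + 1) - √(visits (policyData v π h) x : ℝ) else 0 := by
  simp only [potential, visits_snoc]
  rw [← Finset.sum_add_distrib]
  refine Finset.sum_congr rfl fun x _ => ?_
  split_ifs <;> simp

end Radius

/-! ### Per-round inequality and summation -/

section Regret

variable {μ F : Measure I} [IsProbabilityMeasure μ] [IsProbabilityMeasure F] {v : I → I → ℝ}
  {U ε δ : ℝ} {T : ℕ} {π : Policy μ U}

/-- Visits are counted by the realized critical type, so exploration reaches its target only when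
the realized posterior mean is the prior mean. -/
theorem ae_exploration (hv : RegularValuation v) (hF : F {1} = 0)
    (hπ : IsAlgorithmTwo v ε δ T π) (t : ℕ) :
    ∀ᵐ h ∂(histLaw F v π t), ∀ s : Fin t, (s : ℕ) < (typeGrid v U ε (pooledQuality μ δ)).card →
      (h s).2.1 = priorMean (pooledPrior μ δ) (pooledQuality μ δ) := by
  set m := priorMean (pooledPrior μ δ) (pooledQuality μ δ) with hm
  set n := (typeGrid v U ε (pooledQuality μ δ)).card with hn
  obtain ⟨e, he⟩ := hπ
  induction t with
  | zero => exact Filter.Eventually.of_forall fun h s => s.elim0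
  | succ t ih =>
    have := isProbabilityMeasure_histLaw (F := F) π hv t
    have := isMarkovKernel_obsKernel (F := F) π hv t
    have hmeas : MeasurableSet {h : Fin (t + 1) → Obs |
        ∀ s : Fin (t + 1), (s : ℕ) < n → (h s).2.1 = m} := by
      have : {h : Fin (t + 1) → Obs | ∀ s : Fin (t + 1), (s : ℕ) < n → (h s).2.1 = m} =
          ⋂ s : Fin (t + 1), ⋂ _ : (s : ℕ) < n, (fun h => (h s).2.1) ⁻¹' {m} := by
        ext h; simp only [mem_iInter]; rfl
      rw [this]
      refine MeasurableSet.iInter fun s => MeasurableSet.iInter fun _ => ?_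
      exact (by fun_prop : Measurable fun h : Fin (t + 1) → Obs => (h s).2.1)
        (measurableSet_singleton m)
    rw [histLaw_succ π hv, ae_map_iff (measurable_snoc t).aemeasurable hmeas,
      Measure.ae_compProd_iff (p := fun x : (Fin t → Obs) × Obs => ∀ s : Fin (t + 1),
        (s : ℕ) < n → ((Fin.snoc x.1 x.2 : Fin (t + 1) → Obs) s).2.1 = m) (measurable_snoc t hmeas)]
    filter_upwards [ih] with h hh
    have hlast : ∀ᵐ o ∂(obsKernel F v π t h), t < n → o.2.1 = m := by
      by_cases ht : t < n
      · obtain ⟨ρ, hρ, hadv⟩ := he t h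
        have hρm := (hρ.1 ht).2
        have hν : (π.adv t).sectR h ∘ₘ μ = Measure.dirac m := by
          rw [comap_cell_comp μ δ ρ hadv, hρm, Measure.const_comp, measure_univ, one_smul]
        rw [obsKernel_apply π hv]
        have h1 : ∀ᵐ q ∂((π.adv t).sectR h ∘ₘ μ), q ∈ ({m} : Set I) := by
          rw [hν]
          exact (ae_dirac_iff (p := fun q => q ∈ ({m} : Set I)) (measurableSet_singleton m)).2 rfl
        filter_upwards [ae_roundLaw_posterior hv hF (measurableSet_singleton m) h1] with o ho _
        exact ho
      · exact Filter.Eventually.of_forall fun o hlt => absurd hlt ht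
    filter_upwards [hlast] with o ho s
    refine Fin.lastCases ?_ (fun s => ?_) s
    · intro hs
      rw [Fin.snoc_last]
      exact ho hs
    · intro hs
      rw [Fin.snoc_castSucc]
      exact hh s hs

theorem ae_visits_pos (hv : RegularValuation v) (hF : F {1} = 0)
    (hπ : IsAlgorithmTwo v ε δ T π) {t : ℕ}
    (ht : (typeGrid v U ε (pooledQuality μ δ)).card ≤ t) :
    ∀ᵐ h ∂(histLaw F v π t), ∀ x ∈ typeGrid v U ε (pooledQuality μ δ),
      0 < visits (policyData v π h) x := by
  filter_upwards [ae_exploration hv hF hπ t] with h hh x hx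
  obtain ⟨e, he⟩ := hπ
  set i := e.symm ⟨x, hx⟩ with hi
  let s : Fin t := ⟨i, i.2.trans_le ht⟩
  refine Finset.card_pos.2 ⟨s, Finset.mem_filter.2 ⟨Finset.mem_univ _, ?_⟩⟩
  obtain ⟨ρ, hρ, -⟩ := he s fun r => h (Fin.castLE s.2.le r)
  have h1 := (hρ.1 i.2).1
  simp only [policyData]
  rw [hh s i.2, h1]
  change ((e i : typeGrid v U ε (pooledQuality μ δ)) : I) = x
  rw [hi, Equiv.apply_symm_apply]

/-- The per-round step. Pooling, discretization and optimism bound the optimum by the optimistic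
revenue of the pair played, and the optimistic excess is paid by the expected growth of the
potential. -/
theorem rev_add_potential_ge (hv : RegularValuation v) (hF : F {1} = 0) (hU : 0 < U) (hε : 0 < ε)
    (hδ : 0 < δ) (hπ : IsAlgorithmTwo v ε δ T π) {t : ℕ} (htT : t < T)
    (ht : (typeGrid v U ε (pooledQuality μ δ)).card ≤ t) {h : Fin t → Obs}
    (hvis : ∀ x ∈ typeGrid v U ε (pooledQuality μ δ), 0 < visits (policyData v π h) x)
    (hdev : h ∉ deviationSet F v π (typeGrid v U ε (pooledQuality μ δ)) T t) :
    optRevenue μ id F v U - (δ + 2 * ε) ≤ rev μ F v (π.price t h) ((π.adv t).sectR h) +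
      36 * U * √(Real.log T) *
        (∫ o, potential (typeGrid v U ε (pooledQuality μ δ))
            (policyData v π (Fin.snoc h o : Fin (t + 1) → Obs)) ∂(obsKernel F v π t h) -
          potential (typeGrid v U ε (pooledQuality μ δ)) (policyData v π h)) := by
  set S := typeGrid v U ε (pooledQuality μ δ) with hS
  set d := policyData v π h with hd
  set p := π.price t h with hp
  set L := Real.log T with hL
  obtain ⟨e, he⟩ := hπ
  obtain ⟨ρ, hρ, hadv⟩ := he t h
  obtain ⟨hfeas, hmax⟩ := hρ.2 ht
  rw [← hp, ← hd] at hmax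
  rw [← hp] at hfeas
  have hM := hfeas.2.1
  set ν := (π.adv t).sectR h ∘ₘ μ with hν
  have hνρ : ν = ρ ∘ₘ pooledPrior μ δ := comap_cell_comp μ δ ρ hadv
  have hpU : p ∈ Icc 0 U := π.price_mem t h
  set D : I → ℝ := fun x => F.real (Ici x) with hD
  have hDanti : Antitone D := fun _ _ h => measureReal_mono (Ici_subset_Ici.2 h)
  have hD01 : ∀ x, D x ∈ Icc (0 : ℝ) 1 := fun x => ⟨measureReal_nonneg, measureReal_le_one⟩
  have hclose : ∀ x ∈ S, |empDemand d x - D x| < √(16 * L / visits d x) := by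
    intro x hx
    by_contra! hle
    exact hdev ⟨x, hx, hvis x hx, hle⟩
  have hrad : ∀ x, √(16 * L / visits d x) ≤ radius T (visits d x) := fun x =>
    le_add_of_nonneg_right (by positivity)
  -- Optimism survives the minimum over `x' ≤ x` because `D x ≤ D x'`.
  have hlow : ∀ x, D x ≤ ucbDemand S T d x := fun x =>
    le_ucbDemand_iff.2 ⟨(hD01 x).2, fun x' hx' hle => by
      have h1 := (abs_lt.1 (hclose x' hx')).1
      linarith [hDanti hle, hrad x']⟩
  let g : I → ℝ := fun q => ∑ x ∈ S, if criticalType v p q = x then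
    √((visits d x : ℝ) + 1) - √(visits d x : ℝ) else 0
  have hg0 : ∀ q, 0 ≤ g q := fun q => Finset.sum_nonneg fun x _ => by
    split_ifs
    · exact sqrt_succ_sub_sqrt_nonneg _
    · exact le_rfl
  -- The excess is at most the deviation plus the radius, hence twice the radius; this is where `36
  -- = 2 * 18` comes from.
  have hup : ∀ q, criticalType v p q ∈ S → ucbDemand S T d (criticalType v p q) ≤
      D (criticalType v p q) + 36 * √L * g q := by
    intro q hq
    set x := criticalType v p q with hx
    have h1 := (abs_lt.1 (hclose x hq)).2
    have h2 : ucbDemand S T d x ≤ empDemand d x + radius T (visits d x) := ucbDemand_le hq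
    have h3 : radius T (visits d x) ≤ 18 * √L * (√((visits d x : ℝ) + 1) - √(visits d x : ℝ)) :=
      radius_le ((visits_le d x).trans_lt htT)
    have h4 : g q = √((visits d x : ℝ) + 1) - √(visits d x : ℝ) := by
      simp only [g, ← hx]
      rw [Finset.sum_ite_eq, if_pos hq]
    rw [h4]
    linarith [hrad x]
  have hgm : Measurable g := Finset.measurable_fun_sum _ fun x _ => Measurable.ite
    (hv.measurable_criticalType_right p (measurableSet_singleton x)) measurable_const
    measurable_const
  have hgsnoc : ∀ o : Obs, potential S (policyData v π (Fin.snoc h o : Fin (t + 1) → Obs)) =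
      potential S d + g o.2.1 := fun o => potential_snoc π S h o
  have hgb : ∀ q, potential S d + g q ∈ Icc (-√(S.card * (t + 1 : ℕ))) √(S.card * (t + 1 : ℕ)) := by
    intro q
    -- The quality and purchase are placeholders: the increment depends only on the posterior mean.
    have := hgsnoc (0, q, true)
    rw [← this]
    exact potential_mem _ _
  have hint : Integrable g ν := by
    have h1 : Integrable (fun q => potential S d + g q) ν := Integrable.of_mem_Icc _ _
      (measurable_const.add hgm).aemeasurable (Filter.Eventually.of_forall hgb)
    have h2 := h1.sub (integrable_const (potential S d))
    refine h2.congr (Filter.Eventually.of_forall fun q => ?_)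
    simp
  have hpot : ∫ o, potential S (policyData v π (Fin.snoc h o : Fin (t + 1) → Obs))
      ∂(obsKernel F v π t h) - potential S d = ∫ q, g q ∂ν := by
    simp only [hgsnoc]
    rw [obsKernel_apply π hv, integral_roundLaw hv hF (φ := fun q _ => potential S d + g q)
      ((measurable_const.add hgm).comp measurable_fst) fun q _ => hgb q]
    have h1 : ∀ q, F.real (Ici (criticalType v (π.price t h) q)) * (potential S d + g q) +
        (1 - F.real (Ici (criticalType v (π.price t h) q))) * (potential S d + g q) =
        potential S d + g q := fun q => by ring
    simp only [h1]
    rw [integral_add (integrable_const _) hint, integral_const, probReal_univ, one_smul,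
      add_sub_cancel_left]
  have hrev : rev μ F v p ((π.adv t).sectR h) = p * ∫ q, D (criticalType v p q) ∂ν := by
    simp only [rev, hv.measureReal_purchase hF, hD, hν]
  have hiu : ∀ p', ∀ m : Measure I, IsFiniteMeasure m →
      Integrable (fun q => ucbDemand S T d (criticalType v p' q)) m := fun p' m _ =>
    integrable_demand hv ucbDemand_antitone ucbDemand_mem_Icc m
  have hiD : ∀ p', ∀ m : Measure I, IsFiniteMeasure m →
      Integrable (fun q => D (criticalType v p' q)) m := fun p' m _ =>
    integrable_demand hv hDanti hD01 m
  have hchain : optRevenue (pooledPrior μ δ) (pooledQuality μ δ) F v U ≤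
      p * ∫ q, ucbDemand S T d (criticalType v p q) ∂ν + 2 * ε := by
    refine optRevenue_le (add_nonneg (mul_nonneg hpU.1 (integral_nonneg fun q =>
      (ucbDemand_mem_Icc _).1)) (by linarith)) fun p₀ hp₀ ρ₀ hρ₀ hb₀ => ?_
    obtain ⟨p', ρ', hf', hle⟩ := exists_programFeasible_rev_le hv hU hε
      ⟨0, pooledQuality_zero μ hδ⟩ hF hp₀ hb₀
    have hM' := hf'.2.1
    have h1 : ucbRevenue (pooledPrior μ δ) (pooledQuality μ δ) v U ε T d p' ρ' ≤ _ :=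
      hmax p' ρ' hf'
    have h2 : p' * ∫ q, D (criticalType v p' q) ∂(ρ' ∘ₘ pooledPrior μ δ) ≤
        ucbRevenue (pooledPrior μ δ) (pooledQuality μ δ) v U ε T d p' ρ' :=
      mul_le_mul_of_nonneg_left (integral_mono (hiD _ _ inferInstance) (hiu _ _ inferInstance)
        fun q => hlow _) (mem_Icc_of_mem_priceGrid hU.le hε hf'.1).1
    have h3 : ucbRevenue (pooledPrior μ δ) (pooledQuality μ δ) v U ε T d p ρ =
        p * ∫ q, ucbDemand S T d (criticalType v p q) ∂ν := by rw [hνρ]; rfl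
    linarith
  have hfinal : ∫ q, ucbDemand S T d (criticalType v p q) ∂ν ≤
      ∫ q, D (criticalType v p q) ∂ν + 36 * √L * ∫ q, g q ∂ν := by
    rw [← integral_const_mul, ← integral_add (hiD _ _ inferInstance) (hint.const_mul _)]
    refine integral_mono_ae (hiu _ _ inferInstance)
      ((hiD _ _ inferInstance).add (hint.const_mul _)) ?_
    rw [hνρ]
    filter_upwards [ae_mem_typeGrid hv hfeas] with q hq
    exact hup q hq
  have hpool := optRevenue_le_pooled hv F μ U hδ
  have hg1 : 0 ≤ 36 * √L * ∫ q, g q ∂ν := by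
    have : 0 ≤ ∫ q, g q ∂ν := integral_nonneg fun q => hg0 q
    positivity
  rw [hpot, hrev]
  nlinarith [mul_le_mul_of_nonneg_left hfinal hpU.1, mul_le_mul_of_nonneg_right hpU.2 hg1]

/-- Expected value of the potential after `t` rounds. -/
def meanPotential (F : Measure I) (v : I → I → ℝ) (π : Policy μ U) (S : Finset I) (t : ℕ) : ℝ :=
  ∫ h, potential S (policyData v π h) ∂(histLaw F v π t)

/-- Exploration rounds and the deviation event lose at most `U`, and the potential never decreases,
so the good-event inequality can be averaged over all histories. -/
theorem integral_rev_ge (hv : RegularValuation v) (hF : F {1} = 0) (hU : 0 < U) (hε : 0 < ε)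
    (hδ : 0 < δ) (hT : 2 ≤ T) (hπ : IsAlgorithmTwo v ε δ T π) {t : ℕ} (htT : t < T) :
    optRevenue μ id F v U - (δ + 2 * ε) ≤
      ∫ h, rev μ F v (π.price t h) ((π.adv t).sectR h) ∂(histLaw F v π t) +
      U * ((if t < (typeGrid v U ε (pooledQuality μ δ)).card then 1 else 0) + (T : ℝ)⁻¹) +
      36 * U * √(Real.log T) *
        (meanPotential F v π (typeGrid v U ε (pooledQuality μ δ)) (t + 1) -
          meanPotential F v π (typeGrid v U ε (pooledQuality μ δ)) t) := by
  have := isProbabilityMeasure_histLaw (F := F) π hv t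
  have := isMarkovKernel_obsKernel (F := F) π hv t
  set S := typeGrid v U ε (pooledQuality μ δ) with hS
  have hT0 : (0 : ℝ) < T := by positivity
  set A := 36 * U * √(Real.log T) with hA
  have hA0 : 0 ≤ A := by positivity
  let R : (Fin t → Obs) → ℝ := fun h => rev μ F v (π.price t h) ((π.adv t).sectR h)
  let Ψ : (Fin t → Obs) → ℝ := fun h => ∫ o, potential S
    (policyData v π (Fin.snoc h o : Fin (t + 1) → Obs)) ∂(obsKernel F v π t h)
  let Φ : (Fin t → Obs) → ℝ := fun h => potential S (policyData v π h)
  have hRi : Integrable R (histLaw F v π t) := by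
    refine Integrable.of_mem_Icc 0 U ?_ (Filter.Eventually.of_forall fun h =>
      ⟨rev_nonneg (π.price_mem t h).1, (rev_le (π.price_mem t h).1).trans (π.price_mem t h).2⟩)
    have h1 : R = fun h => π.price t h * (obsKernel F v π t h).real {o | o.2.2 = true} := by
      funext h
      simp only [R]
      rw [rev_eq_roundLaw hv hF, obsKernel_apply π hv]
    rw [h1]
    exact ((π.measurable_price t).mul (measurable_measureReal _
      ((by fun_prop : Measurable fun o : Obs => o.2.2) (measurableSet_singleton true)))).aemeasurable
  have hpm : Measurable fun h : Fin (t + 1) → Obs => potential S (policyData v π h) :=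
    (measurable_potential S _).comp (measurable_policyData π hv)
  have hΨle : ∀ h, Φ h ≤ Ψ h := by
    intro h
    have h1 : ∀ o : Obs, Φ h ≤ potential S (policyData v π (Fin.snoc h o : Fin (t + 1) → Obs)) := by
      intro o
      rw [potential_snoc]
      refine le_add_of_nonneg_right (Finset.sum_nonneg fun x _ => ?_)
      split_ifs
      · exact sqrt_succ_sub_sqrt_nonneg _
      · exact le_rfl
    have h2 := integral_mono (μ := obsKernel F v π t h) (integrable_const (Φ h))
      (Integrable.of_mem_Icc _ _ ((hpm.comp (measurable_snoc t)).comp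
        measurable_prodMk_left).aemeasurable
        (Filter.Eventually.of_forall fun o => potential_mem _ _)) h1
    simpa using h2
  have hΨi : Integrable Ψ (histLaw F v π t) := by
    refine Integrable.of_mem_Icc 0 (√(S.card * (t + 1 : ℕ)))
      ((hpm.comp (measurable_snoc t)).stronglyMeasurable.integral_kernel_prod_right'
        (κ := obsKernel F v π t)).measurable.aemeasurable
      (Filter.Eventually.of_forall fun h =>
        ⟨integral_nonneg fun o => potential_nonneg _ _, ?_⟩)
    have h2 := integral_mono_of_nonneg (μ := obsKernel F v π t h)
      (f := fun o => potential S (policyData v π (Fin.snoc h o : Fin (t + 1) → Obs)))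
      (g := fun _ => √(S.card * (t + 1 : ℕ)))
      (Filter.Eventually.of_forall fun o => potential_nonneg _ _) (integrable_const _)
      (Filter.Eventually.of_forall fun o => potential_le _ _)
    simpa [Ψ] using h2
  have hΦi : Integrable Φ (histLaw F v π t) := Integrable.of_mem_Icc _ _
    ((measurable_potential S _).comp (measurable_policyData π hv)).aemeasurable
    (Filter.Eventually.of_forall fun h => potential_mem _ _)
  have hΨ : ∫ h, Ψ h ∂(histLaw F v π t) = meanPotential F v π S (t + 1) :=
    (integral_histLaw_succ π hv t hpm fun h => potential_mem _ _).symm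
  have hoptU : optRevenue μ id F v U ≤ U := optRevenue_le hU.le fun p hp ρ hρ _ =>
    (rev_le hp.1).trans hp.2
  rw [← hΨ, meanPotential]
  change _ ≤ ∫ h, R h ∂_ + _ + A * (_ - ∫ h, Φ h ∂_)
  rw [← integral_sub hΨi hΦi, ← integral_const_mul]
  rcases lt_or_ge t S.card with ht | ht
  · rw [if_pos ht]
    have h1 : 0 ≤ ∫ h, R h ∂(histLaw F v π t) :=
      integral_nonneg fun h => rev_nonneg (π.price_mem t h).1
    have h2 : 0 ≤ ∫ h, A * (Ψ h - Φ h) ∂(histLaw F v π t) :=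
      integral_nonneg fun h => mul_nonneg hA0 (sub_nonneg.2 (hΨle h))
    have h3 : 0 ≤ U * (T : ℝ)⁻¹ := by positivity
    linarith
  · rw [if_neg (not_lt.2 ht), zero_add]
    set B := deviationSet F v π S T t with hB
    have hBm : MeasurableSet B := measurableSet_deviationSet π hv S T t
    -- With `|S|` and `t` at most `T`, the bound `2 T² / T⁸` is below `1 / T` because `2 ≤ T ^ 5`.
    have hPB : (histLaw F v π t).real B ≤ (T : ℝ)⁻¹ := by
      refine (measureReal_deviationSet_le π hv hF S (by omega) t).trans ?_
      have hT2 : (2 : ℝ) ≤ T := by exact_mod_cast hT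
      have h1 : (S.card : ℝ) ≤ T := by exact_mod_cast ht.trans htT.le
      have h2 : (t : ℝ) ≤ T := by exact_mod_cast htT.le
      have h3 : (S.card : ℝ) * t ≤ T * T := mul_le_mul h1 h2 (by positivity) hT0.le
      refine (mul_le_mul_of_nonneg_right h3 (by positivity)).trans ?_
      rw [inv_eq_one_div, inv_eq_one_div, mul_one_div, mul_div_assoc',
        div_le_div_iff₀ (by positivity) hT0]
      have h4 : (2 : ℝ) ≤ T ^ 5 := by
        calc (2 : ℝ) ≤ 2 ^ 5 := by norm_num
          _ ≤ T ^ 5 := by gcongr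
      nlinarith [pow_pos hT0 3]
    have hae : ∀ᵐ h ∂(histLaw F v π t), optRevenue μ id F v U - (δ + 2 * ε) ≤
        R h + U * B.indicator 1 h + A * (Ψ h - Φ h) := by
      filter_upwards [ae_visits_pos hv hF hπ ht] with h hvis
      by_cases hh : h ∈ B
      · have h1 : 0 ≤ R h := rev_nonneg (π.price_mem t h).1
        have h2 : 0 ≤ A * (Ψ h - Φ h) := mul_nonneg hA0 (sub_nonneg.2 (hΨle h))
        rw [indicator_of_mem hh, Pi.one_apply]
        linarith
      · rw [indicator_of_notMem hh, mul_zero, add_zero]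
        exact rev_add_potential_ge hv hF hU hε hδ hπ htT ht hvis hh
    have hBi : Integrable (fun h => U * B.indicator (1 : (Fin t → Obs) → ℝ) h)
        (histLaw F v π t) := ((integrable_const (1 : ℝ)).indicator hBm).const_mul U
    have hint := integral_mono_ae (integrable_const _)
      ((hRi.add hBi).add ((hΨi.sub hΦi).const_mul A)) hae
    rw [integral_const, probReal_univ, one_smul] at hint
    have h1 := integral_add (hRi.add hBi) ((hΨi.sub hΦi).const_mul A)
    have h2 := integral_add hRi hBi
    rw [integral_const_mul, integral_indicator_one hBm] at h2
    simp only [Pi.add_apply, Pi.sub_apply] at hint h1 h2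
    rw [h1, h2] at hint
    linarith [mul_le_mul_of_nonneg_left hPB hU.le]

/-- The potential differences telescope, and the deviation events contribute `U * T * T⁻¹ = U` in
total. -/
theorem regret_le (hv : RegularValuation v) (hF : F {1} = 0) (hU : 0 < U) (hε : 0 < ε)
    (hδ : 0 < δ) (hT : 2 ≤ T) (hπ : IsAlgorithmTwo v ε δ T π) :
    regret F v π T ≤ T * (δ + 2 * ε) +
      U * ((typeGrid v U ε (pooledQuality μ δ)).card + 1) +
      36 * U * √(Real.log T) * √((typeGrid v U ε (pooledQuality μ δ)).card * T) := by
  have := isProbabilityMeasure_histLaw (F := F) π hv T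
  set S := typeGrid v U ε (pooledQuality μ δ) with hS
  have hT0 : (0 : ℝ) < T := by positivity
  have hsum := Finset.sum_le_sum fun t (ht : t ∈ Finset.range T) =>
    integral_rev_ge hv hF hU hε hδ hT hπ (Finset.mem_range.1 ht)
  rw [Finset.sum_const, Finset.card_range, nsmul_eq_mul, Finset.sum_add_distrib,
    Finset.sum_add_distrib, ← Finset.mul_sum, ← Finset.mul_sum, Finset.sum_range_sub,
    Finset.sum_add_distrib, Finset.sum_const, Finset.card_range, nsmul_eq_mul,
    mul_inv_cancel₀ hT0.ne'] at hsum
  have h1 : ∑ t ∈ Finset.range T, (if t < S.card then (1 : ℝ) else 0) ≤ S.card := by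
    rw [← Finset.sum_filter, Finset.sum_const, nsmul_eq_mul, mul_one]
    have : (Finset.range T).filter (fun t => t < S.card) ⊆ Finset.range S.card := fun t ht =>
      Finset.mem_range.2 (Finset.mem_filter.1 ht).2
    exact_mod_cast (Finset.card_le_card this).trans_eq (Finset.card_range _)
  have h2 : meanPotential F v π S T ≤ √(S.card * T) := by
    have h := integral_mono_of_nonneg (μ := histLaw F v π T)
      (f := fun h => potential S (policyData v π h)) (g := fun _ => √(S.card * T))
      (Filter.Eventually.of_forall fun h => potential_nonneg _ _) (integrable_const _)
      (Filter.Eventually.of_forall fun h => potential_le _ _)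
    rwa [integral_const, probReal_univ, one_smul] at h
  have h3 : 0 ≤ meanPotential F v π S 0 := integral_nonneg fun h => potential_nonneg _ _
  have h4 : 36 * U * √(Real.log T) * (meanPotential F v π S T - meanPotential F v π S 0) ≤
      36 * U * √(Real.log T) * √(S.card * T) :=
    mul_le_mul_of_nonneg_left (by linarith) (by positivity)
  have h5 := mul_le_mul_of_nonneg_left h1 hU.le
  rw [regret]
  nlinarith

end Regret

/-! ## The rate -/

/-- The number of qualities is the number of cells, of order `1 / ε`; multiplied by the number of
prices it gives `1 / ε ^ 2`, whatever the original quality space. -/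
theorem card_typeGrid_le (v : I → I → ℝ) {U ε : ℝ} (hU : 0 < U) (hε : 0 < ε) (hε1 : ε ≤ 1)
    (quality : Fin (⌈1 / ε⌉₊ + 1) → I) :
    ((typeGrid v U ε quality).card : ℝ) ≤ 3 * (2 + U) / ε ^ 2 := by
  have h1 : (typeGrid v U ε quality).card ≤
      (⌈1 / ε⌉₊ + 1) + ⌈U / ε⌉₊ * (⌈1 / ε⌉₊ + 1) := by
    refine (Finset.card_union_le _ _).trans (add_le_add ?_ ?_)
    · exact Finset.card_image_le.trans_eq (Finset.card_range _)
    · refine Finset.card_image_le.trans ?_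
      rw [Finset.card_product, Finset.card_univ, Fintype.card_fin]
      refine Nat.mul_le_mul_right _ (Finset.card_image_le.trans_eq ?_)
      rw [Nat.card_Icc, Nat.add_sub_cancel]
  have h2 : ((typeGrid v U ε quality).card : ℝ) ≤
      (⌈1 / ε⌉₊ + 1) + ⌈U / ε⌉₊ * (⌈1 / ε⌉₊ + 1) := by exact_mod_cast h1
  have h3 : 1 ≤ 1 / ε := (one_le_div hε).2 hε1
  have h4 : (⌈1 / ε⌉₊ : ℝ) + 1 ≤ 3 * (1 / ε) := by
    have := Nat.ceil_lt_add_one (zero_le_one.trans h3)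
    linarith
  have h5 : (⌈U / ε⌉₊ : ℝ) ≤ U * (1 / ε) + 1 := by
    have := Nat.ceil_lt_add_one (div_nonneg hU.le hε.le)
    rw [mul_one_div]
    exact this.le
  rw [show 3 * (2 + U) / ε ^ 2 = 3 * (2 + U) * (1 / ε) ^ 2 by field_simp]
  generalize 1 / ε = x at *
  have h6 : (⌈U / ε⌉₊ : ℝ) + 1 ≤ (2 + U) * x := by nlinarith
  calc _ ≤ ((⌈U / ε⌉₊ : ℝ) + 1) * ((⌈x⌉₊ : ℝ) + 1) := h2.trans_eq (by ring)
    _ ≤ ((2 + U) * x) * (3 * x) := mul_le_mul h6 h4 (by positivity) (by positivity)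
    _ = _ := by ring

/-- All parts follow from `T * ε ^ 4 = log T`; they express every error term through `T * ε`. -/
theorem discretization_bounds {T : ℕ} (hT : 2 ≤ T) {ε : ℝ}
    (hε : ε = (Real.log T / T) ^ (1 / 4 : ℝ)) :
    0 < ε ∧ ε ≤ 1 ∧ T * ε = (T : ℝ) ^ (3 / 4 : ℝ) * Real.log T ^ (1 / 4 : ℝ) ∧
      √(Real.log T) * √T = T * ε ^ 2 ∧ 1 / ε ^ 2 ≤ 2 * (T * ε) := by
  have hT2 : (2 : ℝ) ≤ T := by exact_mod_cast hT
  have hT0 : (0 : ℝ) < T := by positivity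
  set L := Real.log T with hL
  have hL2 : 0.69 ≤ L := by
    have := Real.log_le_log (by norm_num) hT2
    have := Real.log_two_gt_d9
    linarith
  have hL0 : 0 < L := by linarith
  have hLT : L ≤ T := (Real.log_le_sub_one_of_pos hT0).trans (by linarith)
  have hr0 : 0 < L / T := by positivity
  have hε0 : 0 < ε := hε ▸ Real.rpow_pos_of_pos hr0 _
  have hε1 : ε ≤ 1 := hε ▸ Real.rpow_le_one hr0.le ((div_le_one hT0).2 hLT) (by norm_num)
  have h4 : ε ^ 4 = L / T := by
    rw [hε, ← Real.rpow_natCast, ← Real.rpow_mul hr0.le]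
    norm_num
  have h4' : T * ε ^ 4 = L := by rw [h4]; field_simp
  refine ⟨hε0, hε1, ?_, ?_, ?_⟩
  · rw [hε, Real.div_rpow hL0.le hT0.le,
      show (3 / 4 : ℝ) = 1 - 1 / 4 by norm_num, Real.rpow_sub hT0, Real.rpow_one]
    ring
  · rw [← Real.sqrt_mul hL0.le, ← h4', show (T * ε ^ 4 * T : ℝ) = (T * ε ^ 2) ^ 2 by ring]
    exact Real.sqrt_sq (by positivity)
  -- Taking fourth powers, `(T * ε ^ 3) ^ 4 = T * (log T) ^ 3`, which `log 2 > 0.69` bounds from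
  -- below.
  · have h5 : (1 / 2 : ℝ) ≤ T * ε ^ 3 := by
      refine le_of_pow_le_pow_left₀ (n := 4) (by norm_num) (by positivity) ?_
      have h6 : (T * ε ^ 3) ^ 4 = T * L ^ 3 := by rw [← h4']; ring
      rw [h6]
      calc (1 / 2 : ℝ) ^ 4 ≤ 2 * 0.69 ^ 3 := by norm_num
        _ ≤ T * L ^ 3 := by gcongr
    rw [div_le_iff₀ (by positivity)]
    linarith [show 2 * (T * ε) * ε ^ 2 = 2 * (T * ε ^ 3) by ring]

theorem regret_le_rate {μ F : Measure I} [IsProbabilityMeasure μ] [IsProbabilityMeasure F]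
    {v : I → I → ℝ} {U : ℝ} {π : Policy μ U} {T : ℕ} (hv : RegularValuation v) (hF : F {1} = 0)
    (hU : 0 < U) (hT : 2 ≤ T) {ε : ℝ} (hε : ε = (Real.log T / T) ^ (1 / 4 : ℝ))
    (hπ : IsAlgorithmTwo v ε ε T π) :
    regret F v π T ≤ (3 + U * (6 * (2 + U) + 2) + 36 * U * √(3 * (2 + U))) *
      (T : ℝ) ^ (3 / 4 : ℝ) * Real.log T ^ (1 / 4 : ℝ) := by
  obtain ⟨hε0, hε1, hA, hs, hinv⟩ := discretization_bounds hT hε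
  rw [mul_assoc, ← hA]
  set c := 3 * (2 + U) with hc
  have hc0 : 0 < c := by positivity
  have hN := card_typeGrid_le v hU hε0 hε1 (pooledQuality μ ε)
  refine (regret_le hv hF hU hε0 hε0 hT hπ).trans ?_
  generalize ((typeGrid v U ε (pooledQuality μ ε)).card : ℝ) = N at *
  have h1 : N ≤ 2 * c * (T * ε) := by
    calc N ≤ c * (1 / ε ^ 2) := hN.trans_eq (by rw [mul_one_div])
      _ ≤ c * (2 * (T * ε)) := mul_le_mul_of_nonneg_left hinv hc0.le
      _ = _ := by ring
  have h2 : 1 ≤ 2 * (T * ε) :=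
    ((one_le_div (by positivity)).2 (pow_le_one₀ hε0.le hε1)).trans hinv
  -- The factor `1 / ε` from `√N` meets `√(T log T) = T * ε ^ 2`, leaving `T * ε`.
  have h3 : √(Real.log T) * √(N * T) ≤ √c * (T * ε) := by
    calc √(Real.log T) * √(N * T) ≤ √(Real.log T) * √(c / ε ^ 2 * T) := by gcongr
      _ = √c / ε * (√(Real.log T) * √T) := by
        rw [Real.sqrt_mul (by positivity), Real.sqrt_div hc0.le, Real.sqrt_sq hε0.le]
        ring
      _ = √c * (T * ε) := by rw [hs]; field_simp
  calc _ = 3 * (T * ε) + U * (N + 1) + 36 * U * (√(Real.log T) * √(N * T)) := by ring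
    _ ≤ 3 * (T * ε) + U * (2 * c * (T * ε) + 2 * (T * ε)) + 36 * U * (√c * (T * ε)) := by gcongr
    _ = _ := by rw [hc]; ring

end PricingPersuasion

end

theorem mainTheorem4 (U : ℝ) :
    ∃ C : ℝ, ∀ v : unitInterval → unitInterval → ℝ,
      ((∀ θ ω : unitInterval, v θ ω = (θ : ℝ) + (ω : ℝ)) ∨
        (PricingPersuasion.ValuationAssumption v ∧
          PricingPersuasion.CriticalTypeLipschitz v U)) →
      ∀ (F : MeasureTheory.Measure unitInterval) [MeasureTheory.IsProbabilityMeasure F],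
        F {1} = 0 →
      ∀ (μ : MeasureTheory.Measure unitInterval) [MeasureTheory.IsProbabilityMeasure μ],
        (∀ θ : unitInterval, v θ (PricingPersuasion.priorMean μ id) ∈ Set.Icc (0 : ℝ) U) →
        (∀ δ : ℝ, 0 < δ →
          PricingPersuasion.optRevenue μ id F v U ≤
            PricingPersuasion.optRevenue (PricingPersuasion.pooledPrior μ δ)
              (PricingPersuasion.pooledQuality μ δ) F v U + δ) ∧
        ∀ T : ℕ, 2 ≤ T → ∀ ε : ℝ, ε = (Real.log T / T) ^ (1 / 4 : ℝ) →
          (∃ π : PricingPersuasion.Policy μ U,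
            PricingPersuasion.IsAlgorithmTwo v ε ε T π) ∧
          ∀ π : PricingPersuasion.Policy μ U,
            PricingPersuasion.IsAlgorithmTwo v ε ε T π →
              PricingPersuasion.regret F v π T ≤
                C * (T : ℝ) ^ (3 / 4 : ℝ) * (Real.log T) ^ (1 / 4 : ℝ) := by
  refine ⟨3 + U * (6 * (2 + U) + 2) + 36 * U * √(3 * (2 + U)), ?_⟩
  intro v hv F _ hF μ _ hm
  have hreg : PricingPersuasion.RegularValuation v := by
    rcases hv with hv | ⟨hv, hκ⟩
    · exact PricingPersuasion.regularValuation_add hv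
    · exact hv.regularValuation hκ hm
  -- Values at the prior mean lie in `[0,U]` and increase strictly with the type, so the hypotheses
  -- exclude `U ≤ 0`.
  have hU : 0 < U := (hm 0).1.trans_lt
    ((hreg.strictMono_type _ (show (0 : unitInterval) < 1 from zero_lt_one)).trans_le (hm 1).2)
  refine ⟨fun δ hδ => PricingPersuasion.optRevenue_le_pooled hreg F μ U hδ, fun T hT ε hε => ?_⟩
  have hε0 := (PricingPersuasion.discretization_bounds hT hε).1
  exact ⟨PricingPersuasion.exists_isAlgorithmTwo hreg μ hm hε0 hε0 T, fun π hπ =>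
    PricingPersuasion.regret_le_rate hreg hF hU hT hε hπ⟩
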